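/- Let $M$ be a smooth manifold (Hausdorff, second countable, without boundary) of dimension $n\ge 3$, let $g$ be a smooth semi-Riemannian metric on $M$ (of any signature) and let $f:M\to\mathbb{R}$ be a smooth function. Let $R_{(g,f)}=\mathrm{tr}_g(\mathrm{Ric}_f^1)$ be the trace of the $1$-Bakry-Émery Ricci tensor $$\mathrm{Ric}_f^1=\mathrm{Ric}+\mathrm{Hess} f-df\otimes df ,$$ where $\mathrm{Ric}$ and $\mathrm{Hess} f=\nabla df$ are the Ricci tensor and the Hessian of $f$ with respect to $g$. Let $dV_g$ be the volume measure of $g$. The pair $(g,f)$ is called critical for the Hilbert action $\mathcal{L}(g,f)=\int_M R_{(g,f)}\,dV_g$ if for every smooth symmetric $2$-covariant tensor field $s$ and every smooth function $h$ on $M$, and every compact set $K\subseteq M$ outside which $s$ and $h$ vanish, $$\frac{d}{dt}\Big|_{t=0}\int_K R_{(g+ts,\,f+th)}\,dV_{g+ts}=0,$$ the derivative being required to exist (if $M$ is compact, $K$ can be taken to be $M$, with arbitrary $s$ and $h$). Then $(g,f)$ is critical if and only if $$\mathrm{Ric}=df\otimes df\qquad\text{and}\qquad \Delta f=0\quad\text{on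 } M,$$ where $\Delta f=\mathrm{tr}_g(\mathrm{Hess} f)$. -/

import Mathlib

open MeasureTheory
open scoped Manifold ContDiff

noncomputable section

namespace BakryEmery

/-! ### Coordinate geometry on `ℝⁿ`

`G : ℝⁿ → Matrix` is the matrix `(G_ij)` of a metric in some coordinates, `G⁻¹` its inverse
`(G^ij)`. -/

/-- The standard basis vector `e_i` of `ℝⁿ`. -/
def stdVec {n : ℕ} (i : Fin n) : EuclideanSpace ℝ (Fin n) := EuclideanSpace.single i 1

/-- The partial derivative `∂F/∂x^i` at `y`. -/
def pd {n : ℕ} (i : Fin n) (F : EuclideanSpace ℝ (Fin n) → ℝ)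
    (y : EuclideanSpace ℝ (Fin n)) : ℝ :=
  fderiv ℝ F y (stdVec i)

/-- Christoffel symbols
`Γ^k_ij = 1/2 G^kl (∂_i G_jl + ∂_j G_il - ∂_l G_ij)` of the Levi-Civita connection. -/
def christoffel {n : ℕ} (G : EuclideanSpace ℝ (Fin n) → Matrix (Fin n) (Fin n) ℝ)
    (k i j : Fin n) (y : EuclideanSpace ℝ (Fin n)) : ℝ :=
  (1 / 2 : ℝ) * ∑ l, (G y)⁻¹ k l *
    (pd i (fun z => G z j l) y + pd j (fun z => G z i l) y - pd l (fun z => G z i j) y)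

/-- Ricci curvature in coordinates:
`Ric_ij = ∂_k Γ^k_ij - ∂_j Γ^k_ik + Γ^k_kl Γ^l_ij - Γ^k_jl Γ^l_ik`
(the sign for which round spheres have positive Ricci curvature). -/
def ricciCoord {n : ℕ} (G : EuclideanSpace ℝ (Fin n) → Matrix (Fin n) (Fin n) ℝ)
    (y : EuclideanSpace ℝ (Fin n)) : Matrix (Fin n) (Fin n) ℝ := fun i j =>
  (∑ k, (pd k (christoffel G k i j) y - pd j (christoffel G k i k) y))
    + ∑ k, ∑ l, (christoffel G k k l y * christoffel G l i j y
        - christoffel G k j l y * christoffel G l i k y)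

/-- The Hessian `∇df` in coordinates: `∂_i ∂_j F - Γ^k_ij ∂_k F`. -/
def hessCoord {n : ℕ} (G : EuclideanSpace ℝ (Fin n) → Matrix (Fin n) (Fin n) ℝ)
    (F : EuclideanSpace ℝ (Fin n) → ℝ)
    (y : EuclideanSpace ℝ (Fin n)) : Matrix (Fin n) (Fin n) ℝ := fun i j =>
  pd i (pd j F) y - ∑ k, christoffel G k i j y * pd k F y

/-! ### Tensor fields on a manifold -/

section Manifold

variable {n : ℕ} {M : Type*} [TopologicalSpace M] [ChartedSpace (EuclideanSpace ℝ (Fin n)) M]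

/-- (Not necessarily smooth) 2-covariant tensor fields on `M`. -/
abbrev CovTensor (n : ℕ) (M : Type*) [TopologicalSpace M]
    [ChartedSpace (EuclideanSpace ℝ (Fin n)) M] : Type _ :=
  (x : M) → TangentSpace (𝓡 n) x →L[ℝ] TangentSpace (𝓡 n) x →L[ℝ] ℝ

/-- Smooth symmetric 2-covariant tensor fields. -/
structure IsSmoothSymmetric [IsManifold (𝓡 n) ∞ M] (s : CovTensor n M) : Prop where
  symm : ∀ (x : M) (v w : TangentSpace (𝓡 n) x), s x v w = s x w v
  smooth : ContMDiff (𝓡 n)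
    ((𝓡 n).prod 𝓘(ℝ, EuclideanSpace ℝ (Fin n) →L[ℝ] EuclideanSpace ℝ (Fin n) →L[ℝ] ℝ)) ∞
    (fun x => Bundle.TotalSpace.mk'
      (EuclideanSpace ℝ (Fin n) →L[ℝ] EuclideanSpace ℝ (Fin n) →L[ℝ] ℝ)
      (E := fun x : M => TangentSpace (𝓡 n) x →L[ℝ] TangentSpace (𝓡 n) x →L[ℝ] ℝ) x (s x))

/-- Smooth semi-Riemannian metrics (of arbitrary signature). -/
structure IsSemiRiemannianMetric [IsManifold (𝓡 n) ∞ M] (g : CovTensor n M) : Prop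
    extends IsSmoothSymmetric g where
  nondegenerate : ∀ (x : M) (v : TangentSpace (𝓡 n) x),
    (∀ w : TangentSpace (𝓡 n) x, g x v w = 0) → v = 0

/-- The coordinate vector field `∂_i` of the preferred chart `φ` at `p`, at the point `φ⁻¹(y)`. -/
def coordVec (p : M) (i : Fin n) (y : EuclideanSpace ℝ (Fin n)) :
    TangentSpace (𝓡 n) ((extChartAt (𝓡 n) p).symm y) :=
  mfderiv 𝓘(ℝ, EuclideanSpace ℝ (Fin n)) (𝓡 n) (extChartAt (𝓡 n) p).symm y (stdVec i)

/-- The coordinate 1-form `dx^i` at `p` of the preferred chart at `p`. -/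
def coordForm (p : M) (i : Fin n) : TangentSpace (𝓡 n) p →L[ℝ] ℝ :=
  mvfderiv (𝓡 n) (fun q : M => extChartAt (𝓡 n) p q i) p

/-- The components `B_ij = B(∂_i, ∂_j)` of `B` in the preferred chart at `p`, as functions of the
coordinates. -/
def comp (B : CovTensor n M) (p : M) (y : EuclideanSpace ℝ (Fin n)) :
    Matrix (Fin n) (Fin n) ℝ := fun i j =>
  B ((extChartAt (𝓡 n) p).symm y) (coordVec p i y) (coordVec p j y)

/-- The 2-tensor `∑ a_ij dx^i ⊗ dx^j` at `p`, in the preferred chart at `p`. -/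
def ofComp (p : M) (a : Matrix (Fin n) (Fin n) ℝ) :
    TangentSpace (𝓡 n) p →L[ℝ] TangentSpace (𝓡 n) p →L[ℝ] ℝ :=
  ∑ i, ∑ j, a i j • (coordForm p i).smulRight (coordForm p j)

/-- The Ricci tensor of `g`. Its value at `p` is computed in the preferred chart at `p`. -/
def ricci (g : CovTensor n M) : CovTensor n M := fun p =>
  ofComp p (ricciCoord (comp g p) (extChartAt (𝓡 n) p p))

/-- The Hessian `Hess f = ∇df` of `f` with respect to `g`. -/
def hessian (g : CovTensor n M) (f : M → ℝ) : CovTensor n M := fun p =>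
  ofComp p (hessCoord (comp g p) (f ∘ (extChartAt (𝓡 n) p).symm) (extChartAt (𝓡 n) p p))

/-- The tensor field `df ⊗ df`. -/
def dfTensorDf (n : ℕ) {M : Type*} [TopologicalSpace M]
    [ChartedSpace (EuclideanSpace ℝ (Fin n)) M] (f : M → ℝ) : CovTensor n M := fun p =>
  (mvfderiv (𝓡 n) f p).smulRight (mvfderiv (𝓡 n) f p)

/-- The trace `g^ij B_ij` of `B` with respect to `g`. -/
def traceOf (g B : CovTensor n M) (p : M) : ℝ :=
  ∑ i, ∑ j, (comp g p (extChartAt (𝓡 n) p p))⁻¹ i j * comp B p (extChartAt (𝓡 n) p p) i j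

/-- The Laplacian `Δf = tr Hess f`. -/
def laplacian (g : CovTensor n M) (f : M → ℝ) (p : M) : ℝ := traceOf g (hessian g f) p

/-- The `m`-Bakry-Émery Ricci tensor `Ric + Hess f - (1/m) df ⊗ df`. -/
def bakryEmeryRicci (m : ℝ) (g : CovTensor n M) (f : M → ℝ) : CovTensor n M :=
  ricci g + hessian g f - (1 / m) • dfTensorDf n f

/-- The scalar curvature `R_(g,f)` of the 1-Bakry-Émery Ricci tensor. -/
def bakryEmeryScalar (g : CovTensor n M) (f : M → ℝ) (p : M) : ℝ :=
  traceOf g (bakryEmeryRicci 1 g f) p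

/-! ### Volume and the Hilbert action -/

variable [MeasurableSpace M]

/-- The measure `√|det g_ij| dx^1 ⋯ dx^n` on the domain of the preferred chart at `p`, extended
by zero to `M`. -/
def chartVolume (g : CovTensor n M) (p : M) : Measure M :=
  Measure.map (extChartAt (𝓡 n) p).symm
    (((volume : Measure (EuclideanSpace ℝ (Fin n))).restrict
        (extChartAt (𝓡 n) p).target).withDensity
      (fun y => ENNReal.ofReal (Real.sqrt |(comp g p y).det|)))

/-- The volume measure `dV_g`. The measures `chartVolume g p` agree on overlaps of charts, so that
their least upper bound is the measure that restricts to each of them. -/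
def volumeMeasure (g : CovTensor n M) : Measure M := ⨆ p : M, chartVolume g p

/-- The Hilbert action `∫_K R_(g,f) dV_g` over `K`. -/
def action (K : Set M) (g : CovTensor n M) (f : M → ℝ) : ℝ :=
  ∫ x in K, bakryEmeryScalar g f x ∂(volumeMeasure g)

/-- `(g, f)` is critical for the Hilbert action: for all smooth variations `(s, h)` that vanish
outside a compact set `K`, the derivative at `t = 0` of the action of `(g + t s, f + t h)` over `K`
exists and is zero. If `M` is compact, then `K` can be all of `M` and `(s, h)` is arbitrary. -/
def IsCritical [IsManifold (𝓡 n) ∞ M] (g : CovTensor n M) (f : M → ℝ) : Prop :=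
  ∀ (s : CovTensor n M) (h : M → ℝ), IsSmoothSymmetric s → ContMDiff (𝓡 n) 𝓘(ℝ, ℝ) ∞ h →
    ∀ K : Set M, IsCompact K → (∀ x, x ∉ K → s x = 0 ∧ h x = 0) →
      HasDerivAt (fun t : ℝ => action K (g + t • s) (f + t • h)) 0 0

end Manifold

end BakryEmery

end

/-!
Both sides of the equivalence are local, and everything is computed in charts. Write `G_ij` for the
components of `g`, `Γ` for its Christoffel symbols and `𝔤^ij = √|det G| G^ij`. The action over a
subset of a chart is the integral of the Lagrangian `𝔤^ij (Ric_ij + ∇_i∇_j f - ∂_i f ∂_j f)`.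

*First variation.* Let `G` vary in the direction `S` and `f` in the direction `h`, and let `C` be
the resulting derivative of `Γ`. The variation of `Ric` is linear in `C`, and since `G` is parallel,
its trace is a divergence: `𝔤^ij δRic_ij = ∂_k (𝔤^ij C^k_ij - 𝔤^ik C^j_ij)` (Palatini's identity,
`IsMetricOn.sum_densInv_ricciLin`). Also `𝔤^ij ∇_i∇_j f = ∂_i (𝔤^ij ∂_j f)`
(`IsMetricOn.sum_densInv_hessCoord`). Hence (`IsMetricFamilyOn.hasDerivAt_lagrangian`) the
derivative of the Lagrangian is

  `δ𝔤^ij (Ric_ij - ∂_i f ∂_j f) + 2 h 𝔤^ij ∇_i∇_j f + ∂_k V^k`,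

where `V` vanishes wherever `S` and `h` vanish nearby. If the variation is supported in a compact
subset of a chart, the divergence integrates to zero (`hasDerivAt_action_of_chart`).

*The equations imply criticality* (`isCritical_of_ricci_eq`). For a family depending on finitely
many parameters, the action over a compact set is a differentiable function of the parameters
(`IsSmoothVariation.differentiableAt_action`). By a partition of unity, `s` and `h` are finite sums
of variations supported in charts, so the derivative in question is a sum of partial derivatives,
each of which vanishes by the formula for the first variation.

*Criticality implies the equations.* Variations `s = ρ A_ij dx^i dx^j`, `h = c ρ` with a bump
function `ρ` and constant `A`, `c` show that the expression above without the divergence vanishes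
at every point for all `(A, c)` (`IsCritical.eulerLagrange_eq_zero`). With `A = 0` this is
`Δf = 0`. With `c = 0`, put `T = Ric - df ⊗ df`: the choice `A = G` gives `(n/2 - 1) tr T = 0`, so
`tr T = 0` as `n ≥ 3`, and then `A = G T G` gives `∑ T_ij² = 0`
(`eq_zero_of_sum_densInvVar_eq_zero`).

*Charts.* Tensors and the volume measure are defined through the preferred chart at each point, so
that coordinate independence has to be proved: for the Ricci tensor and the Hessian from the
transformation law of the Christoffel symbols, which follows from Koszul's formula
(`IsLeviCivitaAt.transform`, `curv_transform`), and for the volume from the change of variables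
formula (`volumeMeasure_apply`).
-/

noncomputable section

namespace BakryEmery

open Filter Topology Set

/-! ### Partial derivatives -/

section Partial

variable {n : ℕ} {F H : EuclideanSpace ℝ (Fin n) → ℝ} {y : EuclideanSpace ℝ (Fin n)}
  {U : Set (EuclideanSpace ℝ (Fin n))}

lemma pd_congr (k : Fin n) (h : F =ᶠ[𝓝 y] H) : pd k F y = pd k H y := by
  unfold pd; rw [h.fderiv_eq]

lemma pd_eventuallyEq (k : Fin n) (h : F =ᶠ[𝓝 y] H) : pd k F =ᶠ[𝓝 y] pd k H :=
  h.eventuallyEq_nhds.mono fun _ hz => pd_congr k hz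

lemma pd_add (k : Fin n) (hF : DifferentiableAt ℝ F y) (hH : DifferentiableAt ℝ H y) :
    pd k (fun z => F z + H z) y = pd k F y + pd k H y := by
  unfold pd; rw [fderiv_fun_add hF hH]; rfl

lemma pd_sub (k : Fin n) (hF : DifferentiableAt ℝ F y) (hH : DifferentiableAt ℝ H y) :
    pd k (fun z => F z - H z) y = pd k F y - pd k H y := by
  unfold pd; rw [fderiv_fun_sub hF hH]; rfl

lemma pd_mul (k : Fin n) (hF : DifferentiableAt ℝ F y) (hH : DifferentiableAt ℝ H y) :
    pd k (fun z => F z * H z) y = pd k F y * H y + F y * pd k H y := by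
  unfold pd; rw [fderiv_fun_mul hF hH]; simp; ring

lemma pd_const_mul (k : Fin n) (c : ℝ) (hF : DifferentiableAt ℝ F y) :
    pd k (fun z => c * F z) y = c * pd k F y := by
  unfold pd; rw [fderiv_const_mul hF]; rfl

lemma pd_sum (k : Fin n) {ι : Type*} (s : Finset ι) {F : ι → EuclideanSpace ℝ (Fin n) → ℝ}
    (hF : ∀ a ∈ s, DifferentiableAt ℝ (F a) y) :
    pd k (fun z => ∑ a ∈ s, F a z) y = ∑ a ∈ s, pd k (F a) y := by
  unfold pd; rw [fderiv_fun_sum hF]; simp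

lemma contDiffOn_pd (k : Fin n) (hU : IsOpen U) (hF : ContDiffOn ℝ ∞ F U) :
    ContDiffOn ℝ ∞ (pd k F) U := by
  have := hF.fderiv_of_isOpen (m := ∞) hU (by simp)
  exact this.clm_apply contDiffOn_const

lemma pd_comm (i j : Fin n) (hF : ContDiffAt ℝ 2 F y) :
    pd i (pd j F) y = pd j (pd i F) y := by
  have hd : DifferentiableAt ℝ (fderiv ℝ F) y :=
    (hF.fderiv_right (m := 1) (by norm_num)).differentiableAt (by norm_num)
  have hs := hF.isSymmSndFDerivAt (by simp)
  have key : ∀ a b : Fin n, pd a (pd b F) y = fderiv ℝ (fderiv ℝ F) y (stdVec a) (stdVec b) := by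
    intro a b
    change fderiv ℝ (fun z => fderiv ℝ F z (stdVec b)) y (stdVec a) = _
    rw [fderiv_clm_apply hd (differentiableAt_const _)]
    simp
  rw [key, key]; exact hs _ _

lemma vec_eq_sum (v : EuclideanSpace ℝ (Fin n)) : v = ∑ i, v i • stdVec i := by
  ext k
  simp [stdVec, Finset.sum_apply, Pi.single_apply]

@[simp] lemma stdVec_apply (i j : Fin n) : (stdVec i : EuclideanSpace ℝ (Fin n)) j =
    if j = i then 1 else 0 := by
  simp [stdVec]

end Partial

/-! ### Determinant and inverse of a matrix-valued function -/

section MatrixCalculus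

variable {n : ℕ} {X : Type*} [NormedAddCommGroup X] [NormedSpace ℝ X]
  {A : X → Matrix (Fin n) (Fin n) ℝ} {A' : Fin n → Fin n → X →L[ℝ] ℝ} {x : X} {m : WithTop ℕ∞}

/-- Jacobi's formula for the derivative of a determinant. -/
lemma hasFDerivAt_det (h : ∀ i j, HasFDerivAt (fun z => A z i j) (A' i j) x) :
    HasFDerivAt (fun z => (A z).det) (∑ i, ∑ j, (A x).adjugate j i • A' i j) x := by
  have h1 : HasFDerivAt (fun z => (A z).det)
      (∑ σ : Equiv.Perm (Fin n), ((Equiv.Perm.sign σ : ℤ) : ℝ) •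
        ∑ i, (∏ j ∈ Finset.univ.erase i, A x (σ j) j) • A' (σ i) i) x := by
    simp_rw [Matrix.det_apply']
    refine HasFDerivAt.fun_sum fun σ _ => ?_
    exact (HasFDerivAt.finsetProd fun i _ => h (σ i) i).const_mul _
  convert h1 using 1
  ext v
  simp only [sum_apply, smul_apply, smul_eq_mul,
    Finset.mul_sum]
  rw [Finset.sum_comm, Finset.sum_comm (s := (Finset.univ : Finset (Equiv.Perm (Fin n))))]
  refine Finset.sum_congr rfl fun j _ => ?_
  have h2 : (Matrix.cramer (A x) (fun i => A' i j v)) j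
      = ∑ i, (A x).adjugate j i * A' i j v := by
    rw [Matrix.cramer_eq_adjugate_mulVec]; rfl
  rw [← h2, Matrix.cramer_apply, Matrix.det_apply']
  refine Finset.sum_congr rfl fun σ _ => ?_
  rw [← Finset.mul_prod_erase Finset.univ _ (Finset.mem_univ j)]
  rw [Matrix.updateCol_self, mul_comm (A' (σ j) j v)]
  congr 2
  refine Finset.prod_congr rfl fun i hi => ?_
  rw [Matrix.updateCol_ne (Finset.ne_of_mem_erase hi)]

lemma contDiffAt_det (h : ∀ i j, ContDiffAt ℝ m (fun z => A z i j) x) :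
    ContDiffAt ℝ m (fun z => (A z).det) x := by
  simp_rw [Matrix.det_apply']
  exact ContDiffAt.sum fun σ _ => contDiffAt_const.mul (contDiffAt_prod fun i _ => h _ _)

lemma contDiffAt_inv_apply (h : ∀ i j, ContDiffAt ℝ m (fun z => A z i j) x)
    (h0 : (A x).det ≠ 0) (i j : Fin n) : ContDiffAt ℝ m (fun z => (A z)⁻¹ i j) x := by
  simp_rw [Matrix.inv_def, Ring.inverse_eq_inv', Matrix.smul_apply, smul_eq_mul,
    Matrix.adjugate_apply]
  refine ((contDiffAt_det h).inv h0).mul (contDiffAt_det fun a b => ?_)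
  by_cases ha : a = j
  · subst ha; simpa using contDiffAt_const
  · simpa [Matrix.updateRow_ne ha] using h a b

/-- `(A⁻¹)' = - A⁻¹ A' A⁻¹`. -/
lemma hasFDerivAt_inv_apply (h : ∀ i j, HasFDerivAt (fun z => A z i j) (A' i j) x)
    (h0 : (A x).det ≠ 0) (i j : Fin n) :
    HasFDerivAt (fun z => (A z)⁻¹ i j)
      (-∑ a, ∑ b, ((A x)⁻¹ i a * (A x)⁻¹ b j) • A' a b) x := by
  have hdet := hasFDerivAt_det h
  have hd : ∀ a b, DifferentiableAt ℝ (fun z => (A z)⁻¹ a b) x := by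
    intro a b
    simp_rw [Matrix.inv_def, Ring.inverse_eq_inv', Matrix.smul_apply, smul_eq_mul,
      Matrix.adjugate_apply]
    refine (hdet.differentiableAt.inv h0).mul ?_
    have : ∀ c d, DifferentiableAt ℝ
        (fun z => ((A z).updateRow b (Pi.single a 1)) c d) x := by
      intro c d
      by_cases hc : c = b
      · subst hc; simp
      · simpa [Matrix.updateRow_ne hc] using (h c d).differentiableAt
    exact (hasFDerivAt_det fun c d => (this c d).hasFDerivAt).differentiableAt
  have hev : ∀ᶠ z in 𝓝 x, (A z).det ≠ 0 := hdet.continuousAt.eventually_ne h0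
  have hu : IsUnit (A x).det := isUnit_iff_ne_zero.mpr h0
  -- differentiate `A⁻¹ A = 1` and multiply by `A⁻¹` on the right
  have key : ∀ b, ∑ c, ((A x)⁻¹ i c • A' c b + (A x) c b • fderiv ℝ (fun z => (A z)⁻¹ i c) x)
      = 0 := by
    intro b
    have h1 : HasFDerivAt (fun z => ∑ c, (A z)⁻¹ i c * A z c b)
        (∑ c, ((A x)⁻¹ i c • A' c b + (A x) c b • fderiv ℝ (fun z => (A z)⁻¹ i c) x)) x :=
      HasFDerivAt.fun_sum fun c _ => (hd i c).hasFDerivAt.mul (h c b)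
    have h2 : (fun z => ∑ c, (A z)⁻¹ i c * A z c b)
        =ᶠ[𝓝 x] fun _ => (1 : Matrix (Fin n) (Fin n) ℝ) i b := by
      filter_upwards [hev] with z hz
      rw [← Matrix.nonsing_inv_mul (A z) (isUnit_iff_ne_zero.mpr hz)]; rfl
    exact (h1.congr_of_eventuallyEq h2.symm).unique (hasFDerivAt_const _ _)
  have hfin : fderiv ℝ (fun z => (A z)⁻¹ i j) x
      = -∑ a, ∑ b, ((A x)⁻¹ i a * (A x)⁻¹ b j) • A' a b := by
    have h3 : ∑ b, (A x)⁻¹ b j • ∑ c, ((A x)⁻¹ i c • A' c b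
        + (A x) c b • fderiv ℝ (fun z => (A z)⁻¹ i c) x) = 0 := by simp [key]
    have h4 : ∑ b, (A x)⁻¹ b j • ∑ c, (A x) c b • fderiv ℝ (fun z => (A z)⁻¹ i c) x
        = fderiv ℝ (fun z => (A z)⁻¹ i j) x := by
      simp_rw [Finset.smul_sum]
      rw [Finset.sum_comm]
      simp_rw [smul_smul, ← Finset.sum_smul]
      have : ∀ c, ∑ b, (A x)⁻¹ b j * A x c b = (1 : Matrix (Fin n) (Fin n) ℝ) c j := by
        intro c
        rw [← Matrix.mul_nonsing_inv (A x) hu, Matrix.mul_apply]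
        exact Finset.sum_congr rfl fun _ _ => mul_comm _ _
      simp_rw [this]
      simp [Matrix.one_apply]
    simp_rw [Finset.sum_add_distrib, smul_add, Finset.sum_add_distrib] at h3
    rw [h4] at h3
    rw [eq_neg_iff_add_eq_zero, add_comm, ← h3]
    congr 1
    rw [Finset.sum_comm]
    refine Finset.sum_congr rfl fun b _ => ?_
    rw [Finset.smul_sum]
    refine Finset.sum_congr rfl fun a _ => ?_
    rw [smul_smul, mul_comm]
  rw [← hfin]; exact (hd i j).hasFDerivAt

/-- The volume density `√|det A|`. -/
def dens (A : Matrix (Fin n) (Fin n) ℝ) : ℝ := Real.sqrt |A.det|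

lemma dens_pos {A : Matrix (Fin n) (Fin n) ℝ} (h : A.det ≠ 0) : 0 < dens A :=
  Real.sqrt_pos.mpr (abs_pos.mpr h)

lemma contDiffAt_dens (h : ∀ i j, ContDiffAt ℝ ∞ (fun z => A z i j) x)
    (h0 : (A x).det ≠ 0) : ContDiffAt ℝ ∞ (fun z => dens (A z)) x :=
  ((contDiffAt_det h).abs h0).sqrt (abs_ne_zero.mpr h0)

lemma hasFDerivAt_dens (h : ∀ i j, HasFDerivAt (fun z => A z i j) (A' i j) x)
    (h0 : (A x).det ≠ 0) :
    HasFDerivAt (fun z => dens (A z))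
      ((dens (A x) / 2) • ∑ i, ∑ j, (A x)⁻¹ j i • A' i j) x := by
  have hdet := hasFDerivAt_det h
  have h1 := (hdet.abs h0).sqrt (abs_ne_zero.mpr h0)
  refine h1.congr_fderiv ?_
  simp_rw [Matrix.inv_def, Ring.inverse_eq_inv', Matrix.smul_apply, smul_eq_mul, mul_smul,
    ← Finset.smul_sum, smul_smul]
  congr 1
  have hp := dens_pos h0
  have hsq : dens (A x) * dens (A x) = |(A x).det| := Real.mul_self_sqrt (abs_nonneg _)
  change 1 / (2 * dens (A x)) * _ = _
  have hs : ((SignType.sign (A x).det : SignType) : ℝ) * (A x).det = |(A x).det| := by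
    exact_mod_cast sign_mul_self (A x).det
  rw [← hs] at hsq
  field_simp
  linear_combination -hsq

end MatrixCalculus

/-! ### Compatibility of the Levi-Civita connection with the metric -/

section Compatibility

variable {n : ℕ} {G : EuclideanSpace ℝ (Fin n) → Matrix (Fin n) (Fin n) ℝ}
  {F : EuclideanSpace ℝ (Fin n) → ℝ} {y : EuclideanSpace ℝ (Fin n)}
  {U : Set (EuclideanSpace ℝ (Fin n))}

/-- `G` is the matrix of a smooth semi-Riemannian metric on the open set `U ⊆ ℝⁿ`. -/
structure IsMetricOn (G : EuclideanSpace ℝ (Fin n) → Matrix (Fin n) (Fin n) ℝ)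
    (U : Set (EuclideanSpace ℝ (Fin n))) : Prop where
  isOpen : IsOpen U
  smooth : ∀ i j, ContDiffOn ℝ ∞ (fun y => G y i j) U
  symm : ∀ y ∈ U, ∀ i j, G y i j = G y j i
  det_ne : ∀ y ∈ U, (G y).det ≠ 0

/-- The matrix of partial derivatives `∂_k G_ij`. -/
def pdMatrix (G : EuclideanSpace ℝ (Fin n) → Matrix (Fin n) (Fin n) ℝ) (k : Fin n)
    (y : EuclideanSpace ℝ (Fin n)) : Matrix (Fin n) (Fin n) ℝ :=
  fun i j => pd k (fun z => G z i j) y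

/-- The matrix `(Γ^m_ki)_mi` of the connection form in the direction `∂_k`. -/
def connMatrix (G : EuclideanSpace ℝ (Fin n) → Matrix (Fin n) (Fin n) ℝ) (k : Fin n)
    (y : EuclideanSpace ℝ (Fin n)) : Matrix (Fin n) (Fin n) ℝ :=
  fun m i => christoffel G m k i y

/-- The components `√|det G| G^ij` of the inverse metric density. -/
def densInv (A : Matrix (Fin n) (Fin n) ℝ) (i j : Fin n) : ℝ := dens A * A⁻¹ i j

namespace IsMetricOn

variable (hG : IsMetricOn G U) (hy : y ∈ U)
include hG hy

lemma mem_nhds : U ∈ 𝓝 y := hG.isOpen.mem_nhds hy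

lemma contDiffAt (i j : Fin n) : ContDiffAt ℝ ∞ (fun z => G z i j) y :=
  (hG.smooth i j).contDiffAt (hG.mem_nhds hy)

lemma differentiableAt (i j : Fin n) : DifferentiableAt ℝ (fun z => G z i j) y :=
  (hG.contDiffAt hy i j).differentiableAt (by simp)

lemma isUnit_det : IsUnit (G y).det := isUnit_iff_ne_zero.mpr (hG.det_ne y hy)

lemma transpose_eq : (G y).transpose = G y := by
  ext i j; exact hG.symm y hy j i

lemma inv_symm (i j : Fin n) : (G y)⁻¹ i j = (G y)⁻¹ j i := by
  conv_lhs => rw [← hG.transpose_eq hy, ← Matrix.transpose_nonsing_inv]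
  rfl

lemma pd_symm (k i j : Fin n) : pd k (fun z => G z i j) y = pd k (fun z => G z j i) y :=
  pd_congr k (by filter_upwards [hG.mem_nhds hy] with z hz using hG.symm z hz i j)

lemma christoffel_symm (k i j : Fin n) : christoffel G k i j y = christoffel G k j i y := by
  unfold christoffel
  congr 1
  refine Finset.sum_congr rfl fun l _ => ?_
  rw [hG.pd_symm hy l i j]; ring

lemma lower_christoffel (l i j : Fin n) :
    ∑ m, G y l m * christoffel G m i j y = (1 / 2 : ℝ) *
      (pd i (fun z => G z j l) y + pd j (fun z => G z i l) y - pd l (fun z => G z i j) y) := by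
  unfold christoffel
  set X : Fin n → ℝ := fun l =>
    pd i (fun z => G z j l) y + pd j (fun z => G z i l) y - pd l (fun z => G z i j) y
  change ∑ m, G y l m * ((1 / 2 : ℝ) * ((G y)⁻¹.mulVec X) m) = (1 / 2 : ℝ) * X l
  have : (G y).mulVec ((G y)⁻¹.mulVec X) = X := by
    rw [Matrix.mulVec_mulVec, Matrix.mul_nonsing_inv _ (hG.isUnit_det hy), Matrix.one_mulVec]
  conv_rhs => rw [← this]
  rw [Matrix.mulVec, dotProduct, Finset.mul_sum]
  exact Finset.sum_congr rfl fun m _ => by ring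

/-- `∂_k G = G Γ_k + (G Γ_k)ᵀ`: the metric is parallel. -/
lemma pdMatrix_eq (k : Fin n) : pdMatrix G k y =
    G y * connMatrix G k y + (connMatrix G k y).transpose * G y := by
  ext i j
  have h1 := hG.lower_christoffel hy i k j
  have h2 := hG.lower_christoffel hy j k i
  have h3 : ((connMatrix G k y).transpose * G y) i j
      = ∑ m, G y j m * christoffel G m k i y := by
    rw [Matrix.mul_apply]
    exact Finset.sum_congr rfl fun m _ => by
      rw [hG.symm y hy j m, mul_comm]; rfl
  rw [Matrix.add_apply, h3, h2]
  change _ = ∑ m, G y i m * christoffel G m k j y + _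
  rw [h1, hG.pd_symm hy k j i, hG.pd_symm hy j k i, hG.pd_symm hy i k j, hG.pd_symm hy j i k,
    hG.pd_symm hy i j k, hG.pd_symm hy j k i]
  unfold pdMatrix
  rw [hG.pd_symm hy i k j]
  ring

/-- The derivative `∂_k G⁻¹` as a matrix. -/
lemma pd_inv (k i j : Fin n) : pd k (fun z => (G z)⁻¹ i j) y =
    -(connMatrix G k y * (G y)⁻¹ + (G y)⁻¹ * (connMatrix G k y).transpose) i j := by
  have h := hasFDerivAt_inv_apply (fun a b => (hG.differentiableAt hy a b).hasFDerivAt)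
    (hG.det_ne y hy) i j
  have hu := hG.isUnit_det hy
  have h1 : connMatrix G k y * (G y)⁻¹ + (G y)⁻¹ * (connMatrix G k y).transpose
      = (G y)⁻¹ * pdMatrix G k y * (G y)⁻¹ := by
    rw [hG.pdMatrix_eq hy, mul_add, add_mul, Matrix.nonsing_inv_mul_cancel_left _ _ hu,
      mul_assoc, mul_assoc _ (G y), Matrix.mul_nonsing_inv _ hu, mul_one]
  rw [h1]
  unfold pd
  rw [h.fderiv]
  simp only [neg_apply, sum_apply, smul_apply, smul_eq_mul, Matrix.mul_apply, Finset.sum_mul]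
  rw [Finset.sum_comm]
  congr 1
  refine Finset.sum_congr rfl fun a _ => Finset.sum_congr rfl fun b _ => ?_
  unfold pdMatrix pd
  ring

/-- `∂_k √|det G| = √|det G| Γ^l_kl`. -/
lemma pd_dens (k : Fin n) : pd k (fun z => dens (G z)) y =
    dens (G y) * ∑ l, christoffel G l k l y := by
  have h := hasFDerivAt_dens (fun a b => (hG.differentiableAt hy a b).hasFDerivAt)
    (hG.det_ne y hy)
  have hu := hG.isUnit_det hy
  have h1 : ∑ i, ∑ j, (G y)⁻¹ j i * pdMatrix G k y i j = ((G y)⁻¹ * pdMatrix G k y).trace := by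
    rw [Finset.sum_comm]
    rfl
  have h2 : ((G y)⁻¹ * pdMatrix G k y).trace = 2 * (connMatrix G k y).trace := by
    rw [hG.pdMatrix_eq hy, mul_add, Matrix.nonsing_inv_mul_cancel_left _ _ hu, Matrix.trace_add,
      ← mul_assoc, Matrix.trace_mul_comm, ← mul_assoc, Matrix.mul_nonsing_inv _ hu, one_mul,
      Matrix.trace_transpose]
    ring
  have h3 : pd k (fun z => dens (G z)) y
      = dens (G y) / 2 * ∑ i, ∑ j, (G y)⁻¹ j i * pdMatrix G k y i j := by
    unfold pd
    rw [h.fderiv]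
    simp only [sum_apply, smul_apply, smul_eq_mul]
    rfl
  rw [h3, h1, h2]
  change _ = dens (G y) * (connMatrix G k y).trace
  ring

lemma contDiffAt_inv (i j : Fin n) : ContDiffAt ℝ ∞ (fun z => (G z)⁻¹ i j) y :=
  contDiffAt_inv_apply (hG.contDiffAt hy) (hG.det_ne y hy) i j

lemma contDiffAt_densInv (i j : Fin n) : ContDiffAt ℝ ∞ (fun z => densInv (G z) i j) y :=
  (contDiffAt_dens (hG.contDiffAt hy) (hG.det_ne y hy)).mul (hG.contDiffAt_inv hy i j)

lemma densInv_symm (i j : Fin n) : densInv (G y) i j = densInv (G y) j i := by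
  unfold densInv; rw [hG.inv_symm hy]

/-- `∂_k (√|det G| G^ij) = √|det G| (G^ij Γ^m_km - Γ^i_km G^mj - Γ^j_km G^im)`. -/
lemma pd_densInv (k i j : Fin n) : pd k (fun z => densInv (G z) i j) y =
    ∑ m, (densInv (G y) i j * christoffel G m k m y - christoffel G i k m y * densInv (G y) m j
      - christoffel G j k m y * densInv (G y) i m) := by
  unfold densInv
  rw [pd_mul k ((contDiffAt_dens (hG.contDiffAt hy) (hG.det_ne y hy)).differentiableAt (by simp))
    ((hG.contDiffAt_inv hy i j).differentiableAt (by simp)), hG.pd_dens hy, hG.pd_inv hy]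
  simp only [Matrix.add_apply, Matrix.mul_apply, Finset.sum_sub_distrib, Matrix.transpose_apply,
    Finset.mul_sum, Finset.sum_mul, mul_neg, mul_add, connMatrix]
  rw [sub_sub, sub_eq_add_neg, neg_add, neg_add]
  congr 1
  · exact Finset.sum_congr rfl fun m _ => by ring
  · congr 1 <;> congr 1 <;> exact Finset.sum_congr rfl fun m _ => by ring

omit hG hy in
lemma contDiffOn_christoffel (hG : IsMetricOn G U) (k i j : Fin n) :
    ContDiffOn ℝ ∞ (christoffel G k i j) U := by
  unfold christoffel
  refine contDiffOn_const.mul (ContDiffOn.sum fun l _ => ?_)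
  have h := fun a b c => contDiffOn_pd a hG.isOpen (hG.smooth b c)
  refine ContDiffOn.mul (fun z hz => (hG.contDiffAt_inv hz k l).contDiffWithinAt) ?_
  exact ((h i j l).add (h j i l)).sub (h l i j)

end IsMetricOn

/-- `√|det G| tr Hess F` is the coordinate divergence of `√|det G| grad F`. -/
lemma IsMetricOn.sum_densInv_hessCoord (hG : IsMetricOn G U) (hy : y ∈ U)
    (hF : ContDiffOn ℝ ∞ F U) :
    ∑ i, ∑ j, densInv (G y) i j * hessCoord G F y i j =
      ∑ i, pd i (fun z => ∑ j, densInv (G z) i j * pd j F z) y := by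
  have hd : ∀ i j, DifferentiableAt ℝ (fun z => densInv (G z) i j) y := fun i j =>
    (hG.contDiffAt_densInv hy i j).differentiableAt (by simp)
  have hp : ∀ j, DifferentiableAt ℝ (pd j F) y := fun j =>
    ((contDiffOn_pd j hG.isOpen hF).contDiffAt (hG.mem_nhds hy)).differentiableAt (by simp)
  have h1 : ∀ i, pd i (fun z => ∑ j, densInv (G z) i j * pd j F z) y
      = ∑ j, ((∑ m, (densInv (G y) i j * christoffel G m i m y
        - christoffel G i i m y * densInv (G y) m j
        - christoffel G j i m y * densInv (G y) i m)) * pd j F y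
        + densInv (G y) i j * pd i (pd j F) y) := by
    intro i
    rw [pd_sum i _ fun j _ => (hd i j).fun_mul (hp j)]
    refine Finset.sum_congr rfl fun j _ => ?_
    rw [pd_mul i (hd i j) (hp j), hG.pd_densInv hy]
  simp_rw [h1, hessCoord, mul_sub, Finset.sum_add_distrib, Finset.sum_sub_distrib, sub_mul,
    Finset.sum_mul, Finset.mul_sum]
  simp_rw [Finset.sum_sub_distrib]
  -- the two terms with a contracted Christoffel symbol cancel
  have e1 : ∑ i, ∑ j, ∑ m, densInv (G y) i j * christoffel G m i m y * pd j F y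
      = ∑ i, ∑ j, ∑ m, christoffel G i i m y * densInv (G y) m j * pd j F y := by
    rw [Finset.sum_comm]
    conv_rhs => rw [Finset.sum_comm]
    refine Finset.sum_congr rfl fun j _ => ?_
    rw [Finset.sum_comm]
    refine Finset.sum_congr rfl fun m _ => Finset.sum_congr rfl fun i _ => ?_
    rw [hG.christoffel_symm hy m i m]; ring
  have e2 : ∑ i, ∑ j, ∑ m, christoffel G j i m y * densInv (G y) i m * pd j F y
      = ∑ i, ∑ j, ∑ k, densInv (G y) i j * (christoffel G k i j y * pd k F y) := by
    refine Finset.sum_congr rfl fun i _ => ?_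
    rw [Finset.sum_comm]
    refine Finset.sum_congr rfl fun j _ => Finset.sum_congr rfl fun m _ => ?_
    ring
  rw [e1, e2]; ring

/-- The linearization at the connection `Γ` of the coordinate expression of the Ricci tensor, in
the direction `C`. -/
def ricciLin (Γ C : Fin n → Fin n → Fin n → EuclideanSpace ℝ (Fin n) → ℝ)
    (y : EuclideanSpace ℝ (Fin n)) (i j : Fin n) : ℝ :=
  (∑ k, (pd k (C k i j) y - pd j (C k i k) y))
    + ∑ k, ∑ l, ((C k k l y * Γ l i j y + Γ k k l y * C l i j y)
        - (C k j l y * Γ l i k y + Γ k j l y * C l i k y))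

/-- Renaming of the indices of a fourfold sum. -/
lemma sum₄_reindex (e : (Fin n × Fin n × Fin n × Fin n) ≃ (Fin n × Fin n × Fin n × Fin n))
    (f g : Fin n → Fin n → Fin n → Fin n → ℝ)
    (h : ∀ p, f p.1 p.2.1 p.2.2.1 p.2.2.2 =
      g (e p).1 (e p).2.1 (e p).2.2.1 (e p).2.2.2) :
    ∑ a, ∑ b, ∑ c, ∑ d, f a b c d = ∑ a, ∑ b, ∑ c, ∑ d, g a b c d := by
  have key : ∀ f : Fin n → Fin n → Fin n → Fin n → ℝ, ∑ a, ∑ b, ∑ c, ∑ d, f a b c d =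
      ∑ p : Fin n × Fin n × Fin n × Fin n, f p.1 p.2.1 p.2.2.1 p.2.2.2 := by
    intro f; simp only [Fintype.sum_prod_type]
  rw [key, key]
  exact Fintype.sum_equiv e _ _ h

/-- Palatini's identity: the trace of the variation of the Ricci tensor is a divergence. -/
lemma IsMetricOn.sum_densInv_ricciLin (hG : IsMetricOn G U) (hy : y ∈ U)
    {C : Fin n → Fin n → Fin n → EuclideanSpace ℝ (Fin n) → ℝ}
    (hC : ∀ k i j, DifferentiableAt ℝ (C k i j) y) (hCs : ∀ k i j, C k i j y = C k j i y) :
    ∑ i, ∑ j, densInv (G y) i j * ricciLin (christoffel G) C y i j =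
      ∑ k, pd k (fun z => ∑ i, ∑ j, (densInv (G z) i j * C k i j z
        - densInv (G z) i k * C j i j z)) y := by
  have hd : ∀ i j, DifferentiableAt ℝ (fun z => densInv (G z) i j) y := fun i j =>
    (hG.contDiffAt_densInv hy i j).differentiableAt (by simp)
  have h1 : ∀ k, pd k (fun z => ∑ i, ∑ j, (densInv (G z) i j * C k i j z
        - densInv (G z) i k * C j i j z)) y
      = ∑ i, ∑ j, (((∑ m, (densInv (G y) i j * christoffel G m k m y
        - christoffel G i k m y * densInv (G y) m j
        - christoffel G j k m y * densInv (G y) i m)) * C k i j y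
        + densInv (G y) i j * pd k (C k i j) y)
        - ((∑ m, (densInv (G y) i k * christoffel G m k m y
        - christoffel G i k m y * densInv (G y) m k
        - christoffel G k k m y * densInv (G y) i m)) * C j i j y
        + densInv (G y) i k * pd k (C j i j) y)) := by
    intro k
    rw [pd_sum k _ fun i _ => DifferentiableAt.fun_sum fun j _ =>
      ((hd i j).fun_mul (hC k i j)).fun_sub ((hd i k).fun_mul (hC j i j))]
    refine Finset.sum_congr rfl fun i _ => ?_
    rw [pd_sum k _ fun j _ => ((hd i j).fun_mul (hC k i j)).fun_sub ((hd i k).fun_mul (hC j i j))]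
    refine Finset.sum_congr rfl fun j _ => ?_
    rw [pd_sub k ((hd i j).fun_mul (hC k i j)) ((hd i k).fun_mul (hC j i j)),
      pd_mul k (hd i j) (hC k i j), pd_mul k (hd i k) (hC j i j), hG.pd_densInv hy,
      hG.pd_densInv hy]
  -- Both sides are now expanded into sums of products. They agree term by term after renaming the
  -- indices and using the symmetry of `Γ` and `C`; the two terms compared in `ee` cancel.
  have hs := hG.christoffel_symm hy
  have ea : ∑ i, ∑ j, ∑ k, ∑ l, densInv (G y) i j * (christoffel G k k l y * C l i j y)
      = ∑ k, ∑ i, ∑ j, ∑ m, densInv (G y) i j * christoffel G m k m y * C k i j y :=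
    sum₄_reindex ⟨fun p => (p.2.2.2, p.1, p.2.1, p.2.2.1), fun p => (p.2.1, p.2.2.1, p.2.2.2, p.1),
      fun _ => rfl, fun _ => rfl⟩ _ _ fun p => by
        dsimp only [Equiv.coe_fn_mk]; rw [hs p.2.2.1 p.2.2.1 p.2.2.2]; ring
  have eb : ∑ i, ∑ j, ∑ k, ∑ l, densInv (G y) i j * (C k j l y * christoffel G l i k y)
      = ∑ k, ∑ i, ∑ j, ∑ m, christoffel G i k m y * densInv (G y) m j * C k i j y :=
    sum₄_reindex ⟨fun p => (p.2.2.1, p.2.2.2, p.2.1, p.1), fun p => (p.2.2.2, p.2.2.1, p.1, p.2.1),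
      fun _ => rfl, fun _ => rfl⟩ _ _ fun p => by
        dsimp only [Equiv.coe_fn_mk]; rw [hs p.2.2.2, hCs p.2.2.1 p.2.1]; ring
  have ec : ∑ i, ∑ j, ∑ k, ∑ l, densInv (G y) i j * (christoffel G k j l y * C l i k y)
      = ∑ k, ∑ i, ∑ j, ∑ m, christoffel G j k m y * densInv (G y) i m * C k i j y :=
    sum₄_reindex ⟨fun p => (p.2.2.2, p.1, p.2.2.1, p.2.1), fun p => (p.2.1, p.2.2.2, p.2.2.1, p.1),
      fun _ => rfl, fun _ => rfl⟩ _ _ fun p => by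
        dsimp only [Equiv.coe_fn_mk]; rw [hs p.2.2.1 p.2.1]; ring
  have ed : ∑ i, ∑ j, ∑ k, ∑ l, densInv (G y) i j * (C k k l y * christoffel G l i j y)
      = ∑ k, ∑ i, ∑ j, ∑ m, christoffel G i k m y * densInv (G y) m k * C j i j y :=
    sum₄_reindex ⟨fun p => (p.2.1, p.2.2.2, p.2.2.1, p.1), fun p => (p.2.2.2, p.1, p.2.2.1, p.2.1),
      fun _ => rfl, fun _ => rfl⟩ _ _ fun p => by
        dsimp only [Equiv.coe_fn_mk]; rw [hs p.2.2.2 p.1, hCs p.2.2.1 p.2.2.1]; ring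
  have ee : ∑ k, ∑ i, ∑ j, ∑ m, densInv (G y) i k * christoffel G m k m y * C j i j y
      = ∑ k, ∑ i, ∑ j, ∑ m, christoffel G k k m y * densInv (G y) i m * C j i j y :=
    sum₄_reindex ⟨fun p => (p.2.2.2, p.2.1, p.2.2.1, p.1), fun p => (p.2.2.2, p.2.1, p.2.2.1, p.1),
      fun _ => rfl, fun _ => rfl⟩ _ _ fun p => by
        dsimp only [Equiv.coe_fn_mk]; rw [hs p.2.2.2 p.1]; ring
  have ef : ∑ i, ∑ j, ∑ k, densInv (G y) i j * pd k (C k i j) y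
      = ∑ k, ∑ i, ∑ j, densInv (G y) i j * pd k (C k i j) y := by
    simp_rw [Finset.sum_comm (γ := Fin n) (f := fun j k => densInv (G y) _ j * pd k (C k _ j) y)]
    rw [Finset.sum_comm]
  have eg : ∑ i, ∑ j, ∑ k, densInv (G y) i j * pd j (C k i k) y
      = ∑ k, ∑ i, ∑ j, densInv (G y) i k * pd k (C j i j) y := Finset.sum_comm
  rw [Finset.sum_congr rfl fun k _ => h1 k]
  simp only [ricciLin, mul_add, mul_sub, sub_mul, Finset.sum_sub_distrib,
    Finset.sum_add_distrib, Finset.mul_sum, Finset.sum_mul]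
  rw [ea, eb, ec, ed, ee, ef, eg]
  ring

end Compatibility

/-! ### Smooth families of metrics -/

section Families

variable {n : ℕ} {P : Type*} [NormedAddCommGroup P] [NormedSpace ℝ P]
  {Ω : Set (P × EuclideanSpace ℝ (Fin n))}

/-- `Φ_u(y)` is jointly smooth in the parameter `u` and the coordinates `y` on `Ω`. -/
def JointlySmooth (Φ : P → EuclideanSpace ℝ (Fin n) → ℝ)
    (Ω : Set (P × EuclideanSpace ℝ (Fin n))) : Prop :=
  ContDiffOn ℝ ∞ (fun q : P × EuclideanSpace ℝ (Fin n) => Φ q.1 q.2) Ω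

namespace JointlySmooth

variable {Φ Ψ : P → EuclideanSpace ℝ (Fin n) → ℝ}

lemma const (c : ℝ) : JointlySmooth (fun (_ : P) (_ : EuclideanSpace ℝ (Fin n)) => c) Ω :=
  contDiffOn_const

lemma add (hΦ : JointlySmooth Φ Ω) (hΨ : JointlySmooth Ψ Ω) :
    JointlySmooth (fun u y => Φ u y + Ψ u y) Ω := ContDiffOn.add hΦ hΨ

lemma sub (hΦ : JointlySmooth Φ Ω) (hΨ : JointlySmooth Ψ Ω) :
    JointlySmooth (fun u y => Φ u y - Ψ u y) Ω := ContDiffOn.sub hΦ hΨ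

lemma mul (hΦ : JointlySmooth Φ Ω) (hΨ : JointlySmooth Ψ Ω) :
    JointlySmooth (fun u y => Φ u y * Ψ u y) Ω := ContDiffOn.mul hΦ hΨ

lemma sum {ι : Type*} {s : Finset ι} {Φ : ι → P → EuclideanSpace ℝ (Fin n) → ℝ}
    (h : ∀ i ∈ s, JointlySmooth (Φ i) Ω) : JointlySmooth (fun u y => ∑ i ∈ s, Φ i u y) Ω :=
  ContDiffOn.sum h

lemma differentiableAt (hΩ : IsOpen Ω) (hΦ : JointlySmooth Φ Ω) {u : P}
    {y : EuclideanSpace ℝ (Fin n)} (h : (u, y) ∈ Ω) :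
    DifferentiableAt ℝ (fun q : P × EuclideanSpace ℝ (Fin n) => Φ q.1 q.2) (u, y) :=
  (ContDiffOn.contDiffAt hΦ (hΩ.mem_nhds h)).differentiableAt (by simp)

lemma pd_eq (hΩ : IsOpen Ω) (hΦ : JointlySmooth Φ Ω) (k : Fin n) {u : P}
    {y : EuclideanSpace ℝ (Fin n)} (h : (u, y) ∈ Ω) :
    BakryEmery.pd k (Φ u) y =
      fderiv ℝ (fun q : P × EuclideanSpace ℝ (Fin n) => Φ q.1 q.2) (u, y) (0, stdVec k) := by
  have h1 := (hΦ.differentiableAt hΩ h).hasFDerivAt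
  have h2 : HasFDerivAt (fun z : EuclideanSpace ℝ (Fin n) => (u, z))
      (ContinuousLinearMap.inr ℝ P (EuclideanSpace ℝ (Fin n))) y := hasFDerivAt_prodMk_right u y
  have h3 : HasFDerivAt (Φ u) _ y := h1.comp y h2
  unfold BakryEmery.pd
  rw [h3.fderiv]; simp

lemma pd (hΩ : IsOpen Ω) (hΦ : JointlySmooth Φ Ω) (k : Fin n) :
    JointlySmooth (fun u => BakryEmery.pd k (Φ u)) Ω := by
  have h := (ContDiffOn.fderiv_of_isOpen (m := ∞) hΦ hΩ (by simp)).clm_apply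
    (contDiffOn_const (c := ((0 : P), (stdVec k : EuclideanSpace ℝ (Fin n)))))
  exact h.congr fun q hq => hΦ.pd_eq hΩ k hq

/-- The restriction to a fixed parameter. -/
lemma slice (hΦ : JointlySmooth Φ Ω) (u : P) : ContDiffOn ℝ ∞ (Φ u) {y | (u, y) ∈ Ω} := by
  have h : ContDiff ℝ ∞ (fun z : EuclideanSpace ℝ (Fin n) => (u, z)) := by fun_prop
  exact ContDiffOn.comp (g := fun q : P × EuclideanSpace ℝ (Fin n) => Φ q.1 q.2) hΦ
    h.contDiffOn fun _ hy => hy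

end JointlySmooth

/-- `(G_u)` is a smooth family of matrices of semi-Riemannian metrics; `G_u` is defined on the
slice `{y | (u, y) ∈ Ω}` of the open set `Ω`. -/
structure IsMetricFamilyOn (G : P → EuclideanSpace ℝ (Fin n) → Matrix (Fin n) (Fin n) ℝ)
    (Ω : Set (P × EuclideanSpace ℝ (Fin n))) : Prop where
  isOpen : IsOpen Ω
  smooth : ∀ i j, JointlySmooth (fun u y => G u y i j) Ω
  symm : ∀ q ∈ Ω, ∀ i j, G q.1 q.2 i j = G q.1 q.2 j i
  det_ne : ∀ q ∈ Ω, (G q.1 q.2).det ≠ 0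

variable {G : P → EuclideanSpace ℝ (Fin n) → Matrix (Fin n) (Fin n) ℝ}
  {F : P → EuclideanSpace ℝ (Fin n) → ℝ}

/-- The trace `tr_G (Ric + Hess F - dF ⊗ dF)` in coordinates. -/
def scalarCoord (G : EuclideanSpace ℝ (Fin n) → Matrix (Fin n) (Fin n) ℝ)
    (F : EuclideanSpace ℝ (Fin n) → ℝ) (y : EuclideanSpace ℝ (Fin n)) : ℝ :=
  ∑ i, ∑ j, (G y)⁻¹ i j * (ricciCoord G y i j + hessCoord G F y i j - pd i F y * pd j F y)

/-- The Lagrangian density `√|det G| tr_G (Ric + Hess F - dF ⊗ dF)` in coordinates. -/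
def lagrangian (G : EuclideanSpace ℝ (Fin n) → Matrix (Fin n) (Fin n) ℝ)
    (F : EuclideanSpace ℝ (Fin n) → ℝ) (y : EuclideanSpace ℝ (Fin n)) : ℝ :=
  dens (G y) * scalarCoord G F y

namespace IsMetricFamilyOn

lemma slice (hG : IsMetricFamilyOn G Ω) (u : P) : IsMetricOn (G u) {y | (u, y) ∈ Ω} where
  isOpen := hG.isOpen.preimage (by fun_prop)
  smooth i j := (hG.smooth i j).slice u
  symm y hy := hG.symm (u, y) hy
  det_ne y hy := hG.det_ne (u, y) hy

variable (hG : IsMetricFamilyOn G Ω)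
include hG

lemma inv (i j : Fin n) : JointlySmooth (fun u y => (G u y)⁻¹ i j) Ω := fun q hq =>
  (contDiffAt_inv_apply (A := fun q : P × EuclideanSpace ℝ (Fin n) => G q.1 q.2)
    (fun a b => (hG.smooth a b).contDiffAt (hG.isOpen.mem_nhds hq))
    (hG.det_ne q hq) i j).contDiffWithinAt

lemma dens : JointlySmooth (fun u y => dens (G u y)) Ω := fun q hq =>
  (contDiffAt_dens (A := fun q : P × EuclideanSpace ℝ (Fin n) => G q.1 q.2)
    (fun a b => (hG.smooth a b).contDiffAt (hG.isOpen.mem_nhds hq))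
    (hG.det_ne q hq)).contDiffWithinAt

lemma densInv (i j : Fin n) : JointlySmooth (fun u y => densInv (G u y) i j) Ω :=
  hG.dens.mul (hG.inv i j)

lemma christoffel (k i j : Fin n) : JointlySmooth (fun u => christoffel (G u) k i j) Ω := by
  unfold BakryEmery.christoffel
  refine (JointlySmooth.const _).mul (JointlySmooth.sum fun l _ => (hG.inv k l).mul ?_)
  exact (((hG.smooth j l).pd hG.isOpen i).add ((hG.smooth i l).pd hG.isOpen j)).sub
    ((hG.smooth i j).pd hG.isOpen l)

lemma ricciCoord (i j : Fin n) : JointlySmooth (fun u y => ricciCoord (G u) y i j) Ω := by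
  unfold BakryEmery.ricciCoord
  have hc := hG.christoffel
  refine (JointlySmooth.sum fun k _ => ?_).add
    (JointlySmooth.sum fun k _ => JointlySmooth.sum fun l _ => ?_)
  · exact ((hc k i j).pd hG.isOpen k).sub ((hc k i k).pd hG.isOpen j)
  · exact ((hc k k l).mul (hc l i j)).sub ((hc k j l).mul (hc l i k))

lemma hessCoord (hF : JointlySmooth F Ω) (i j : Fin n) :
    JointlySmooth (fun u y => hessCoord (G u) (F u) y i j) Ω := by
  unfold BakryEmery.hessCoord
  exact ((hF.pd hG.isOpen j).pd hG.isOpen i).sub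
    (JointlySmooth.sum fun k _ => (hG.christoffel k i j).mul (hF.pd hG.isOpen k))

lemma scalarCoord (hF : JointlySmooth F Ω) :
    JointlySmooth (fun u => scalarCoord (G u) (F u)) Ω := by
  unfold BakryEmery.scalarCoord
  exact JointlySmooth.sum fun i _ => JointlySmooth.sum fun j _ => (hG.inv i j).mul
    (((hG.ricciCoord i j).add (hG.hessCoord hF i j)).sub
      ((hF.pd hG.isOpen i).mul (hF.pd hG.isOpen j)))

lemma lagrangian (hF : JointlySmooth F Ω) :
    JointlySmooth (fun u => lagrangian (G u) (F u)) Ω := by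
  unfold BakryEmery.lagrangian
  exact hG.dens.mul (hG.scalarCoord hF)

end IsMetricFamilyOn
end Families

/-! ### The first variation of the Lagrangian -/

section FirstVariation

variable {n : ℕ} {Ω : Set (ℝ × EuclideanSpace ℝ (Fin n))} {y : EuclideanSpace ℝ (Fin n)}

/-- The derivative of `Φ_t(y)` in `t` at `t = 0`. -/
def variation (Φ : ℝ → EuclideanSpace ℝ (Fin n) → ℝ) (y : EuclideanSpace ℝ (Fin n)) : ℝ :=
  deriv (fun t => Φ t y) 0

namespace JointlySmooth

variable {Φ : ℝ → EuclideanSpace ℝ (Fin n) → ℝ}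

lemma hasDerivAt_fderiv (hΩ : IsOpen Ω) (hΦ : JointlySmooth Φ Ω) (h : ((0 : ℝ), y) ∈ Ω) :
    HasDerivAt (fun t => Φ t y)
      (fderiv ℝ (fun q : ℝ × EuclideanSpace ℝ (Fin n) => Φ q.1 q.2) (0, y) (1, 0)) 0 := by
  have h1 := (hΦ.differentiableAt hΩ h).hasFDerivAt
  have h2 : HasDerivAt (fun t : ℝ => (t, y)) ((1 : ℝ), (0 : EuclideanSpace ℝ (Fin n))) 0 :=
    (hasDerivAt_id (0 : ℝ)).prodMk (hasDerivAt_const _ _)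
  exact h1.comp_hasDerivAt (0 : ℝ) h2

lemma hasDerivAt (hΩ : IsOpen Ω) (hΦ : JointlySmooth Φ Ω) (h : ((0 : ℝ), y) ∈ Ω) :
    HasDerivAt (fun t => Φ t y) (variation Φ y) 0 :=
  (hΦ.hasDerivAt_fderiv hΩ h).differentiableAt.hasDerivAt

lemma contDiffOn_variation (hΩ : IsOpen Ω) (hΦ : JointlySmooth Φ Ω) :
    ContDiffOn ℝ ∞ (variation Φ) {y | ((0 : ℝ), y) ∈ Ω} := by
  have h := (ContDiffOn.fderiv_of_isOpen (m := ∞) hΦ hΩ (by simp)).clm_apply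
    (contDiffOn_const (c := ((1 : ℝ), (0 : EuclideanSpace ℝ (Fin n)))))
  have h2 : ContDiff ℝ ∞ (fun z : EuclideanSpace ℝ (Fin n) => ((0 : ℝ), z)) := by fun_prop
  exact (ContDiffOn.comp h h2.contDiffOn fun _ hy => hy).congr fun y hy =>
    (hΦ.hasDerivAt_fderiv hΩ hy).deriv

/-- The derivatives in `t` and in the coordinates commute. -/
lemma variation_pd (hΩ : IsOpen Ω) (hΦ : JointlySmooth Φ Ω) (k : Fin n)
    (h : ((0 : ℝ), y) ∈ Ω) :
    variation (fun t => BakryEmery.pd k (Φ t)) y = BakryEmery.pd k (variation Φ) y := by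
  set Ψ := fun q : ℝ × EuclideanSpace ℝ (Fin n) => Φ q.1 q.2
  have hc : ContDiffAt ℝ ∞ Ψ (0, y) := ContDiffOn.contDiffAt hΦ (hΩ.mem_nhds h)
  have hs := (hc.of_le (m := 2) (by norm_cast)).isSymmSndFDerivAt (by simp)
  have hd : DifferentiableAt ℝ (fderiv ℝ Ψ) (0, y) :=
    (hc.fderiv_right (m := 1) (by norm_cast)).differentiableAt (by norm_num)
  have e1 : variation (fun t => BakryEmery.pd k (Φ t)) y
      = fderiv ℝ (fderiv ℝ Ψ) (0, y) (1, 0) (0, stdVec k) := by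
    have h1 := ((hΦ.pd hΩ k).hasDerivAt_fderiv hΩ h).deriv
    have h2 : (fun q : ℝ × EuclideanSpace ℝ (Fin n) => BakryEmery.pd k (Φ q.1) q.2)
        =ᶠ[𝓝 (0, y)] fun q => fderiv ℝ Ψ q (0, stdVec k) := by
      filter_upwards [hΩ.mem_nhds h] with q hq using hΦ.pd_eq hΩ k hq
    unfold variation
    rw [h1, h2.fderiv_eq, fderiv_clm_apply hd (differentiableAt_const _)]
    simp
  have e2 : BakryEmery.pd k (variation Φ) y
      = fderiv ℝ (fderiv ℝ Ψ) (0, y) (0, stdVec k) (1, 0) := by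
    have hmem : ∀ᶠ z in 𝓝 y, ((0 : ℝ), z) ∈ Ω :=
      (hΩ.preimage (f := fun z : EuclideanSpace ℝ (Fin n) => ((0 : ℝ), z))
        (by fun_prop)).mem_nhds h
    have h2 : variation Φ =ᶠ[𝓝 y] fun z => fderiv ℝ Ψ (0, z) (1, 0) := by
      filter_upwards [hmem] with z hz using (hΦ.hasDerivAt_fderiv hΩ hz).deriv
    rw [pd_congr k h2]
    have h3 : HasFDerivAt (fun z : EuclideanSpace ℝ (Fin n) => ((0 : ℝ), z))
        (ContinuousLinearMap.inr ℝ ℝ (EuclideanSpace ℝ (Fin n))) y :=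
      hasFDerivAt_prodMk_right 0 y
    have h4 : HasFDerivAt (fun z => fderiv ℝ Ψ (0, z)) _ y := hd.hasFDerivAt.comp y h3
    unfold BakryEmery.pd
    rw [fderiv_clm_apply h4.differentiableAt (differentiableAt_const _), h4.fderiv]
    simp
  rw [e1, e2]; exact hs _ _

end JointlySmooth

/-- The derivative `√|det A| (tr (A⁻¹ S) A⁻¹ / 2 - A⁻¹ S A⁻¹)` of `√|det A| A⁻¹` in the direction
`S`. -/
def densInvVar (A S : Matrix (Fin n) (Fin n) ℝ) (i j : Fin n) : ℝ :=
  dens A * ((A⁻¹ * S).trace / 2 * A⁻¹ i j - (A⁻¹ * S * A⁻¹) i j)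

lemma hasDerivAt_densInv {A S : Matrix (Fin n) (Fin n) ℝ} (h0 : A.det ≠ 0) (i j : Fin n) :
    HasDerivAt (fun t : ℝ => densInv (A + t • S) i j) (densInvVar A S i j) 0 := by
  have h : ∀ a b, HasFDerivAt (fun t : ℝ => (A + t • S) a b)
      (ContinuousLinearMap.toSpanSingleton ℝ (S a b)) 0 := fun a b => by
    have : HasDerivAt (fun t : ℝ => A a b + t * S a b) (S a b) 0 := by
      simpa using ((hasDerivAt_id (0 : ℝ)).mul_const (S a b)).const_add (A a b)
    exact this.hasFDerivAt
  have hA : A + (0 : ℝ) • S = A := by simp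
  have h1 := (hasFDerivAt_dens h (by rwa [hA])).hasDerivAt
  have h2 := (hasFDerivAt_inv_apply h (by rwa [hA]) i j).hasDerivAt
  rw [hA] at h1 h2
  unfold densInv
  refine (h1.mul h2).congr_deriv ?_
  simp only [hA, neg_apply, sum_apply, smul_apply, smul_eq_mul, densInvVar,
    ContinuousLinearMap.toSpanSingleton_apply, one_mul]
  have e1 : ∑ i, ∑ j, A⁻¹ j i * S i j = (A⁻¹ * S).trace := by
    rw [Finset.sum_comm]; rfl
  have e2 : ∑ a, ∑ b, A⁻¹ i a * A⁻¹ b j * S a b = (A⁻¹ * S * A⁻¹) i j := by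
    simp only [Matrix.mul_apply, Finset.sum_mul]
    rw [Finset.sum_comm]
    exact Finset.sum_congr rfl fun _ _ => Finset.sum_congr rfl fun _ _ => by ring
  rw [e1, e2]; ring

/-- The vector field whose divergence is the difference between the first variation of the
Lagrangian and its Euler-Lagrange expression. -/
def boundaryField (G : ℝ → EuclideanSpace ℝ (Fin n) → Matrix (Fin n) (Fin n) ℝ)
    (F : ℝ → EuclideanSpace ℝ (Fin n) → ℝ) (k : Fin n) (y : EuclideanSpace ℝ (Fin n)) : ℝ :=
  (∑ i, ∑ j, (densInv (G 0 y) i j * variation (fun t => christoffel (G t) k i j) y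
      - densInv (G 0 y) i k * variation (fun t => christoffel (G t) j i j) y))
    + (variation (fun t z => ∑ j, densInv (G t z) k j * pd j (F t) z) y
      - 2 * (variation F y * ∑ j, densInv (G 0 y) k j * pd j (F 0) y))

/-- The Euler-Lagrange expression of the Lagrangian at `y`, paired with the value `(S, h)` at `y` of
a variation of `(G, F)`. -/
def eulerLagrange (G : EuclideanSpace ℝ (Fin n) → Matrix (Fin n) (Fin n) ℝ)
    (F : EuclideanSpace ℝ (Fin n) → ℝ) (S : Matrix (Fin n) (Fin n) ℝ) (h : ℝ)
    (y : EuclideanSpace ℝ (Fin n)) : ℝ :=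
  (∑ i, ∑ j, densInvVar (G y) S i j * (ricciCoord G y i j - pd i F y * pd j F y))
    + 2 * h * ∑ i, ∑ j, densInv (G y) i j * hessCoord G F y i j

variable {G : ℝ → EuclideanSpace ℝ (Fin n) → Matrix (Fin n) (Fin n) ℝ}
  {F : ℝ → EuclideanSpace ℝ (Fin n) → ℝ}

/-- The Hessian term of the Lagrangian written as a divergence. -/
lemma lagrangian_eq {G : EuclideanSpace ℝ (Fin n) → Matrix (Fin n) (Fin n) ℝ}
    {F : EuclideanSpace ℝ (Fin n) → ℝ} {U : Set (EuclideanSpace ℝ (Fin n))}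
    (hG : IsMetricOn G U) (hy : y ∈ U) (hF : ContDiffOn ℝ ∞ F U) :
    lagrangian G F y = (∑ i, ∑ j, densInv (G y) i j * ricciCoord G y i j)
      + ∑ i, pd i (fun z => ∑ j, densInv (G z) i j * pd j F z) y
      - ∑ i, ∑ j, densInv (G y) i j * (pd i F y * pd j F y) := by
  rw [← hG.sum_densInv_hessCoord hy hF]
  simp only [lagrangian, scalarCoord, densInv, Finset.mul_sum, ← Finset.sum_add_distrib,
    ← Finset.sum_sub_distrib]
  exact Finset.sum_congr rfl fun _ _ => Finset.sum_congr rfl fun _ _ => by ring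

/-- The first variation of the coordinate expression of the Ricci tensor. -/
lemma IsMetricFamilyOn.hasDerivAt_ricciCoord (hG : IsMetricFamilyOn G Ω)
    (hy : ((0 : ℝ), y) ∈ Ω) (i j : Fin n) :
    HasDerivAt (fun t => BakryEmery.ricciCoord (G t) y i j)
      (ricciLin (BakryEmery.christoffel (G 0))
        (fun k i j => variation (fun t => BakryEmery.christoffel (G t) k i j)) y i j) 0 := by
  have hΩ := hG.isOpen
  have hc := fun k i j => (hG.christoffel k i j).hasDerivAt hΩ hy
  have hp := fun l k i j => ((hG.christoffel k i j).pd hΩ l).hasDerivAt hΩ hy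
  simp only [fun l k i j => (hG.christoffel k i j).variation_pd hΩ l hy] at hp
  unfold BakryEmery.ricciCoord ricciLin
  exact (HasDerivAt.fun_sum fun k _ => (hp k k i j).sub (hp j k i k)).add
    (HasDerivAt.fun_sum fun k _ => HasDerivAt.fun_sum fun l _ =>
      ((hc k k l).mul (hc l i j)).sub ((hc k j l).mul (hc l i k)))

/-- The first variation of the Lagrangian is its Euler-Lagrange expression plus a divergence. -/
lemma IsMetricFamilyOn.hasDerivAt_lagrangian (hG : IsMetricFamilyOn G Ω)
    (hF : JointlySmooth F Ω) (hy : ((0 : ℝ), y) ∈ Ω)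
    {S : Matrix (Fin n) (Fin n) ℝ} (hS : ∀ t, G t y = G 0 y + t • S) :
    HasDerivAt (fun t => BakryEmery.lagrangian (G t) (F t) y)
      (eulerLagrange (G 0) (F 0) S (variation F y) y
        + ∑ k, BakryEmery.pd k (boundaryField G F k) y) 0 := by
  have hΩ := hG.isOpen
  have hG0 := hG.slice 0
  have hy0 : y ∈ {y | ((0 : ℝ), y) ∈ Ω} := hy
  have hev : ∀ᶠ t : ℝ in 𝓝 0, (t, y) ∈ Ω :=
    (hΩ.preimage (f := fun t : ℝ => (t, y)) (by fun_prop)).mem_nhds hy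
  -- derivatives of the constituents
  have hg : ∀ i j, HasDerivAt (fun t => BakryEmery.densInv (G t y) i j)
      (densInvVar (G 0 y) S i j) 0 := by
    intro i j
    have := hasDerivAt_densInv (S := S) (hG.det_ne _ hy) i j
    simpa only [← hS] using this
  have hR := hG.hasDerivAt_ricciCoord hy
  have hX : ∀ i, JointlySmooth
      (fun t z => ∑ j, BakryEmery.densInv (G t z) i j * BakryEmery.pd j (F t) z) Ω := fun i =>
    JointlySmooth.sum fun j _ => (hG.densInv i j).mul (hF.pd hΩ j)
  have hX' := fun i => ((hX i).pd hΩ i).hasDerivAt hΩ hy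
  simp only [fun i => (hX i).variation_pd hΩ i hy] at hX'
  have hP := fun i => (hF.pd hΩ i).hasDerivAt hΩ hy
  simp only [fun i => hF.variation_pd hΩ i hy] at hP
  have h1 : HasDerivAt (fun t => (∑ i, ∑ j, BakryEmery.densInv (G t y) i j *
          BakryEmery.ricciCoord (G t) y i j)
        + ∑ i, BakryEmery.pd i (fun z => ∑ j, BakryEmery.densInv (G t z) i j *
          BakryEmery.pd j (F t) z) y
        - ∑ i, ∑ j, BakryEmery.densInv (G t y) i j *
          (BakryEmery.pd i (F t) y * BakryEmery.pd j (F t) y)) _ 0 :=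
    ((HasDerivAt.fun_sum fun i _ => HasDerivAt.fun_sum fun j _ => (hg i j).mul (hR i j)).add
      (HasDerivAt.fun_sum fun i _ => hX' i)).sub
      (HasDerivAt.fun_sum fun i _ => HasDerivAt.fun_sum fun j _ =>
        (hg i j).mul ((hP i).mul (hP j)))
  refine (h1.congr_of_eventuallyEq ?_).congr_deriv ?_
  · filter_upwards [hev] with t ht
    exact lagrangian_eq (hG.slice t) ht (hF.slice t)
  -- the divergence terms
  have hC : ∀ k i j, DifferentiableAt ℝ
      (variation fun t => BakryEmery.christoffel (G t) k i j) y := fun k i j =>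
    (((hG.christoffel k i j).contDiffOn_variation hΩ).contDiffAt
      (hG0.mem_nhds hy0)).differentiableAt (by simp)
  have hCs : ∀ k i j, variation (fun t => BakryEmery.christoffel (G t) k i j) y
      = variation (fun t => BakryEmery.christoffel (G t) k j i) y := by
    intro k i j
    refine Filter.EventuallyEq.deriv_eq ?_
    filter_upwards [hev] with t ht using (hG.slice t).christoffel_symm ht k i j
  have hpal := hG0.sum_densInv_ricciLin hy0 hC hCs
  have hdg : ∀ i j, DifferentiableAt ℝ (fun z => BakryEmery.densInv (G 0 z) i j) y := fun i j =>
    (hG0.contDiffAt_densInv hy0 i j).differentiableAt (by simp)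
  have hdX : ∀ k, DifferentiableAt ℝ
      (fun z => ∑ j, BakryEmery.densInv (G 0 z) k j * BakryEmery.pd j (F 0) z) y := fun k =>
    (((hX k).slice 0).contDiffAt (hG0.mem_nhds hy0)).differentiableAt (by simp)
  have hdvX : ∀ k, DifferentiableAt ℝ (variation fun t z => ∑ j, BakryEmery.densInv (G t z) k j *
      BakryEmery.pd j (F t) z) y := fun k =>
    (((hX k).contDiffOn_variation hΩ).contDiffAt (hG0.mem_nhds hy0)).differentiableAt (by simp)
  have hdF : DifferentiableAt ℝ (variation F) y :=
    ((hF.contDiffOn_variation hΩ).contDiffAt (hG0.mem_nhds hy0)).differentiableAt (by simp)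
  have hdiv : ∀ k, BakryEmery.pd k (boundaryField G F k) y =
      BakryEmery.pd k (fun z => ∑ i, ∑ j, (BakryEmery.densInv (G 0 z) i j *
          variation (fun t => BakryEmery.christoffel (G t) k i j) z
        - BakryEmery.densInv (G 0 z) i k *
          variation (fun t => BakryEmery.christoffel (G t) j i j) z)) y
      + (BakryEmery.pd k (variation fun t z => ∑ j, BakryEmery.densInv (G t z) k j *
          BakryEmery.pd j (F t) z) y
      - 2 * (BakryEmery.pd k (variation F) y *
          (∑ j, BakryEmery.densInv (G 0 y) k j * BakryEmery.pd j (F 0) y)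
        + variation F y * BakryEmery.pd k (fun z => ∑ j, BakryEmery.densInv (G 0 z) k j *
          BakryEmery.pd j (F 0) z) y)) := by
    intro k
    unfold boundaryField
    rw [pd_add k, pd_sub k (hdvX k), pd_const_mul, pd_mul k hdF (hdX k)]
    · exact hdF.fun_mul (hdX k)
    · exact (hdF.fun_mul (hdX k)).const_mul 2
    · exact DifferentiableAt.fun_sum fun i _ => DifferentiableAt.fun_sum fun j _ =>
        ((hdg i j).fun_mul (hC k i j)).fun_sub ((hdg i k).fun_mul (hC j i j))
    · exact (hdvX k).fun_sub ((hdF.fun_mul (hdX k)).const_mul 2)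
  have hL := hG0.sum_densInv_hessCoord hy0 (hF.slice 0)
  rw [Finset.sum_congr rfl fun k _ => hdiv k, Finset.sum_add_distrib, ← hpal, eulerLagrange, hL]
  have hsym : ∑ i, ∑ j, BakryEmery.densInv (G 0 y) i j *
        (BakryEmery.pd i (F 0) y * BakryEmery.pd j (variation F) y)
      = ∑ i, ∑ j, BakryEmery.densInv (G 0 y) i j *
        (BakryEmery.pd i (variation F) y * BakryEmery.pd j (F 0) y) := by
    rw [Finset.sum_comm]
    refine Finset.sum_congr rfl fun i _ => Finset.sum_congr rfl fun j _ => ?_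
    rw [hG0.densInv_symm hy0 j i]; ring
  have hsym' : ∑ i, ∑ j, BakryEmery.densInv (G 0 y) i j *
        (BakryEmery.pd i (variation F) y * BakryEmery.pd j (F 0) y)
      = ∑ i, BakryEmery.pd i (variation F) y *
        ∑ j, BakryEmery.densInv (G 0 y) i j * BakryEmery.pd j (F 0) y := by
    simp_rw [Finset.mul_sum]
    exact Finset.sum_congr rfl fun i _ => Finset.sum_congr rfl fun j _ => by ring
  simp only [mul_add, mul_sub, Finset.sum_add_distrib, Finset.sum_sub_distrib, hsym, hsym',
    ← Finset.mul_sum]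
  ring

end FirstVariation

/-! ### Integrals depending on parameters, and the divergence theorem -/

section Integrals

variable {n : ℕ} {P : Type*} [NormedAddCommGroup P] [NormedSpace ℝ P]

/-- Near the parameter `0`, a family that is smooth on a neighbourhood of `{0} × C` is integrable
over measurable subsets of the compact set `C`, and the integral can be differentiated under the
integral sign. -/
lemma JointlySmooth.hasFDerivAt_integral {Ω : Set (P × EuclideanSpace ℝ (Fin n))}
    {Φ : P → EuclideanSpace ℝ (Fin n) → ℝ} (hΩ : IsOpen Ω) (hΦ : JointlySmooth Φ Ω)
    {C B : Set (EuclideanSpace ℝ (Fin n))} (hC : IsCompact C) (hCΩ : ∀ y ∈ C, ((0 : P), y) ∈ Ω)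
    (hB : MeasurableSet B) (hBC : B ⊆ C) :
    (∀ᶠ u in 𝓝 (0 : P), IntegrableOn (Φ u) B) ∧
      HasFDerivAt (fun u => ∫ y in B, Φ u y)
        (∫ y in B, fderiv ℝ (fun u => Φ u y) 0) 0 := by
  set Ψ := fun q : P × EuclideanSpace ℝ (Fin n) => Φ q.1 q.2 with hΨ
  have hsm : ContDiffOn ℝ ∞ Ψ Ω := hΦ
  have hcont : ContinuousOn (fun q => fderiv ℝ Ψ q) Ω :=
    hsm.continuousOn_fderiv_of_isOpen hΩ (by norm_cast)
  -- a bound for the derivative near `{0} × C`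
  have hc0 : ContinuousOn (fun y => ‖fderiv ℝ Ψ (0, y)‖) C :=
    (hcont.norm.comp (by fun_prop : Continuous fun y : EuclideanSpace ℝ (Fin n) =>
      ((0 : P), y)).continuousOn hCΩ)
  obtain ⟨c, hc⟩ := (hC.bddAbove_image hc0)
  have hopen : IsOpen (Ω ∩ (fun q => ‖fderiv ℝ Ψ q‖) ⁻¹' Iio (c + 1)) :=
    hcont.norm.isOpen_inter_preimage hΩ isOpen_Iio
  have hsub : ({(0 : P)} : Set P) ×ˢ C ⊆ Ω ∩ (fun q => ‖fderiv ℝ Ψ q‖) ⁻¹' Iio (c + 1) := by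
    rintro ⟨u, y⟩ ⟨hu, hy⟩
    obtain rfl : u = 0 := hu
    refine ⟨hCΩ y hy, ?_⟩
    have : ‖fderiv ℝ Ψ (0, y)‖ ≤ c := hc ⟨y, hy, rfl⟩
    simp only [mem_preimage, mem_Iio]; linarith
  obtain ⟨V, W, hV, -, h0V, hCW, hVW⟩ :=
    generalized_tube_lemma isCompact_singleton hC hopen hsub
  obtain ⟨ε, hε, hball⟩ := Metric.isOpen_iff.mp hV 0 (h0V rfl)
  have hin : ∀ u ∈ Metric.ball (0 : P) ε, ∀ y ∈ C, (u, y) ∈ Ω ∧ ‖fderiv ℝ Ψ (u, y)‖ ≤ c + 1 :=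
    fun u hu y hy => by
      have := hVW (mk_mem_prod (hball hu) (hCW hy))
      exact ⟨this.1, (le_of_lt this.2)⟩
  have hint : ∀ u ∈ Metric.ball (0 : P) ε, IntegrableOn (Φ u) B := by
    intro u hu
    have : ContinuousOn (Φ u) C := (hΦ.slice u).continuousOn.mono fun y hy => (hin u hu y hy).1
    exact (this.integrableOn_compact hC).mono_set hBC
  have hball0 : Metric.ball (0 : P) ε ∈ 𝓝 (0 : P) := Metric.ball_mem_nhds 0 hε
  refine ⟨Filter.mem_of_superset hball0 hint, ?_⟩
  have hder : ∀ u ∈ Metric.ball (0 : P) ε, ∀ y ∈ C, HasFDerivAt (fun u => Φ u y)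
      ((fderiv ℝ Ψ (u, y)).comp (ContinuousLinearMap.inl ℝ P (EuclideanSpace ℝ (Fin n)))) u := by
    intro u hu y hy
    have h1 : HasFDerivAt Ψ (fderiv ℝ Ψ (u, y)) (u, y) :=
      (hΦ.differentiableAt hΩ (hin u hu y hy).1).hasFDerivAt
    have h2 := hasFDerivAt_prodMk_left (𝕜 := ℝ) u y
    exact h1.comp u h2
  refine hasFDerivAt_integral_of_dominated_of_fderiv_le (μ := volume.restrict B)
    (F := Φ) (F' := fun u y => fderiv ℝ (fun u => Φ u y) u) (bound := fun _ => c + 1)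
    hball0 ?_ (hint 0 (Metric.mem_ball_self hε)) ?_ ?_ ?_ ?_
  · filter_upwards [hball0] with u hu using (hint u hu).aestronglyMeasurable
  · have h1 : ContinuousOn (fun y => (fderiv ℝ Ψ (0, y)).comp
        (ContinuousLinearMap.inl ℝ P (EuclideanSpace ℝ (Fin n)))) B := by
      have h2 : ContinuousOn (fun y => fderiv ℝ Ψ (0, y)) B :=
        hcont.comp (by fun_prop : Continuous fun y : EuclideanSpace ℝ (Fin n) =>
          ((0 : P), y)).continuousOn fun y hy => hCΩ y (hBC hy)
      exact h2.clm_comp continuousOn_const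
    refine (h1.aestronglyMeasurable hB).congr ?_
    filter_upwards [ae_restrict_mem hB] with y hy
    exact ((hder 0 (Metric.mem_ball_self hε) y (hBC hy)).fderiv).symm
  · filter_upwards [ae_restrict_mem hB] with y hy u hu
    rw [(hder u hu y (hBC hy)).fderiv]
    refine (ContinuousLinearMap.opNorm_comp_le _ _).trans ?_
    have h1 := (hin u hu y (hBC hy)).2
    have h2 := ContinuousLinearMap.norm_inl_le_one ℝ P (EuclideanSpace ℝ (Fin n))
    calc _ ≤ ‖fderiv ℝ Ψ (u, y)‖ * 1 := by gcongr
      _ ≤ c + 1 := by linarith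
  · exact (integrableOn_const_iff (C := c + 1)).mpr
      (Or.inr ((measure_mono hBC).trans_lt hC.measure_lt_top))
  · filter_upwards [ae_restrict_mem hB] with y hy u hu
    exact (hder u hu y (hBC hy)).differentiableAt.hasFDerivAt

/-- A partial derivative of a smooth function with compact support integrates to zero. -/
lemma integral_pd_eq_zero {U C : Set (EuclideanSpace ℝ (Fin n))} (hU : IsOpen U)
    {V : EuclideanSpace ℝ (Fin n) → ℝ} (hV : ContDiffOn ℝ ∞ V U) (hC : IsCompact C)
    (hCU : C ⊆ U) (h0 : ∀ y ∈ U \ C, V y = 0) (k : Fin n) :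
    ∫ y in C, pd k V y = 0 := by
  classical
  set W : EuclideanSpace ℝ (Fin n) → ℝ := C.indicator V with hW
  have hWV : ∀ y ∈ U, W =ᶠ[𝓝 y] V := by
    intro y hy
    filter_upwards [hU.mem_nhds hy] with z hz
    by_cases hzC : z ∈ C
    · simp [hW, hzC]
    · simp [hW, hzC, h0 z ⟨hz, hzC⟩]
  have hWsm : ContDiff ℝ ∞ W := by
    rw [contDiff_iff_contDiffAt]
    intro y
    by_cases hy : y ∈ C
    · exact (hV.contDiffAt (hU.mem_nhds (hCU hy))).congr_of_eventuallyEq (hWV y (hCU hy))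
    · refine contDiffAt_const (c := (0 : ℝ)) |>.congr_of_eventuallyEq ?_
      filter_upwards [hC.isClosed.isOpen_compl.mem_nhds hy] with z hz
      exact indicator_of_notMem hz V
  have hsupp : HasCompactSupport W := HasCompactSupport.intro hC fun y hy =>
    indicator_of_notMem hy V
  have hpd : ∀ y ∉ C, pd k W y = 0 := by
    intro y hy
    have : W =ᶠ[𝓝 y] fun _ => 0 := by
      filter_upwards [hC.isClosed.isOpen_compl.mem_nhds hy] with z hz
      exact indicator_of_notMem hz V
    rw [pd_congr k this]; simp [pd]
  have e1 : ∫ y in C, pd k V y = ∫ y, pd k W y := by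
    rw [← setIntegral_eq_integral_of_forall_compl_eq_zero (s := C) hpd]
    exact setIntegral_congr_fun hC.measurableSet fun y hy => (pd_congr k (hWV y (hCU hy))).symm
  rw [e1]
  have hdW : Continuous fun y => fderiv ℝ W y (stdVec k) :=
    (hWsm.continuous_fderiv (by simp)).clm_apply continuous_const
  have hi1 : Integrable fun y => fderiv ℝ W y (stdVec k) :=
    hdW.integrable_of_hasCompactSupport (HasCompactSupport.intro hC hpd)
  have hi2 : Integrable W := hWsm.continuous.integrable_of_hasCompactSupport hsupp
  have := integral_mul_fderiv_eq_neg_fderiv_mul_of_integrable (μ := volume) (𝕜 := ℝ)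
    (f := fun _ : EuclideanSpace ℝ (Fin n) => (1 : ℝ)) (g := W) (v := stdVec k)
    (by simp) (by simpa using hi1) (by simpa using hi2)
    (fun x _ => differentiableAt_const _)
    (fun x _ => (hWsm.differentiable (by simp)).differentiableAt)
  simpa [pd] using this

end Integrals

/-! ### Curvature of a connection and changes of coordinates -/

section Abstract

variable {E : Type*} [NormedAddCommGroup E] [NormedSpace ℝ E]

/-- `Γ` is the Levi-Civita connection at `x` of the metric `b` (Koszul's formula). -/
def IsLeviCivitaAt (b : E → E →L[ℝ] E →L[ℝ] ℝ) (Γ : E →L[ℝ] E →L[ℝ] E) (x : E) : Prop :=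
  ∀ u v w, 2 * b x (Γ u v) w =
    fderiv ℝ b x u v w + fderiv ℝ b x v u w - fderiv ℝ b x w u v

/-- The curvature `R(w, u) v` at `x` of the connection `d + Γ`. -/
def curv (Γ : E → E →L[ℝ] E →L[ℝ] E) (x w u v : E) : E :=
  fderiv ℝ Γ x w u v - fderiv ℝ Γ x u w v + Γ x w (Γ x u v) - Γ x u (Γ x w v)

/-- The transformation law of Christoffel symbols, deduced from Koszul's formula. -/
lemma IsLeviCivitaAt.transform {b h : E → E →L[ℝ] E →L[ℝ] ℝ} {Γ Γ' : E →L[ℝ] E →L[ℝ] E}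
    {τ : E → E} {y : E} (hΓ : IsLeviCivitaAt b Γ (τ y)) (hΓ' : IsLeviCivitaAt h Γ' y)
    (hb : DifferentiableAt ℝ b (τ y)) (hh : DifferentiableAt ℝ h y)
    (hτ : ContDiffAt ℝ 2 τ y) (hbs : ∀ u v, b (τ y) u v = b (τ y) v u)
    (heq : ∀ᶠ z in 𝓝 y, ∀ u v, h z u v = b (τ z) (fderiv ℝ τ z u) (fderiv ℝ τ z v))
    (hnd : ∀ v, (∀ w, b (τ y) v (fderiv ℝ τ y w) = 0) → v = 0) (u v : E) :
    fderiv ℝ τ y (Γ' u v) =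
      Γ (fderiv ℝ τ y u) (fderiv ℝ τ y v) + fderiv ℝ (fderiv ℝ τ) y u v := by
  have hT : HasFDerivAt (fderiv ℝ τ) (fderiv ℝ (fderiv ℝ τ) y) y :=
    ((hτ.fderiv_right (m := 1) (by norm_num)).differentiableAt (by norm_num)).hasFDerivAt
  have hτ1 : HasFDerivAt τ (fderiv ℝ τ y) y := (hτ.differentiableAt (by norm_num)).hasFDerivAt
  have hsym := hτ.isSymmSndFDerivAt (by simp)
  have hD : ∀ w u v, fderiv ℝ h y w u v =
      fderiv ℝ b (τ y) (fderiv ℝ τ y w) (fderiv ℝ τ y u) (fderiv ℝ τ y v)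
      + b (τ y) (fderiv ℝ (fderiv ℝ τ) y w u) (fderiv ℝ τ y v)
      + b (τ y) (fderiv ℝ τ y u) (fderiv ℝ (fderiv ℝ τ) y w v) := by
    intro w u v
    have h1 : HasFDerivAt (fun z => h z u v) _ y :=
      (hh.hasFDerivAt.clm_apply (hasFDerivAt_const u y)).clm_apply (hasFDerivAt_const v y)
    have hbτ : HasFDerivAt (fun z => b (τ z)) _ y :=
      HasFDerivAt.comp (g := b) y hb.hasFDerivAt hτ1
    have h2 : HasFDerivAt (fun z => b (τ z) (fderiv ℝ τ z u) (fderiv ℝ τ z v)) _ y :=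
      (hbτ.clm_apply (hT.clm_apply (hasFDerivAt_const u y))).clm_apply
        (hT.clm_apply (hasFDerivAt_const v y))
    have h3 := (h2.congr_of_eventuallyEq (heq.mono fun z hz => hz u v)).unique h1
    have h4 := congrArg (fun L : E →L[ℝ] ℝ => L w) h3
    simp at h4
    linarith
  rw [← sub_eq_zero]
  refine hnd _ fun w => ?_
  have k1 := hΓ (fderiv ℝ τ y u) (fderiv ℝ τ y v) (fderiv ℝ τ y w)
  have k2 := hΓ' u v w
  rw [hD, hD, hD, heq.self_of_nhds] at k2
  rw [hsym.eq v u, hsym.eq w u, hsym.eq w v] at k2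
  rw [hbs (fderiv ℝ τ y v) (fderiv ℝ (fderiv ℝ τ) y u w),
    hbs (fderiv ℝ τ y u) (fderiv ℝ (fderiv ℝ τ) y v w)] at k2
  simp only [map_sub, map_add, sub_apply, add_apply]
  linarith

/-- The curvature is a tensor: it is compatible with changes of coordinates. -/
lemma curv_transform {Γ Γ' : E → E →L[ℝ] E →L[ℝ] E} {τ : E → E} {y : E}
    (hΓ : DifferentiableAt ℝ Γ (τ y)) (hΓ' : DifferentiableAt ℝ Γ' y)
    (hτ : ContDiffAt ℝ 3 τ y)
    (heq : ∀ᶠ z in 𝓝 y, ∀ u v, fderiv ℝ τ z (Γ' z u v) =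
      Γ (τ z) (fderiv ℝ τ z u) (fderiv ℝ τ z v) + fderiv ℝ (fderiv ℝ τ) z u v) (w u v : E) :
    fderiv ℝ τ y (curv Γ' y w u v) =
      curv Γ (τ y) (fderiv ℝ τ y w) (fderiv ℝ τ y u) (fderiv ℝ τ y v) := by
  have hc1 : ContDiffAt ℝ 2 (fderiv ℝ τ) y := hτ.fderiv_right (by norm_num)
  have hT : HasFDerivAt (fderiv ℝ τ) (fderiv ℝ (fderiv ℝ τ) y) y :=
    (hc1.differentiableAt (by norm_num)).hasFDerivAt
  have hT2 : HasFDerivAt (fderiv ℝ (fderiv ℝ τ)) (fderiv ℝ (fderiv ℝ (fderiv ℝ τ)) y) y :=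
    ((hc1.fderiv_right (m := 1) (by norm_num)).differentiableAt (by norm_num)).hasFDerivAt
  have hτ1 : HasFDerivAt τ (fderiv ℝ τ y) y := (hτ.differentiableAt (by norm_num)).hasFDerivAt
  have hsym := (hτ.of_le (m := 2) (by norm_cast)).isSymmSndFDerivAt (by simp)
  have hsym2 := hc1.isSymmSndFDerivAt (by simp)
  -- differentiate the transformation law of the Christoffel symbols in the direction `w`
  have hD : ∀ w u v, fderiv ℝ (fderiv ℝ τ) y w (Γ' y u v)
      + fderiv ℝ τ y (fderiv ℝ Γ' y w u v) =
      fderiv ℝ Γ (τ y) (fderiv ℝ τ y w) (fderiv ℝ τ y u) (fderiv ℝ τ y v)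
      + Γ (τ y) (fderiv ℝ (fderiv ℝ τ) y w u) (fderiv ℝ τ y v)
      + Γ (τ y) (fderiv ℝ τ y u) (fderiv ℝ (fderiv ℝ τ) y w v)
      + fderiv ℝ (fderiv ℝ (fderiv ℝ τ)) y w u v := by
    intro w u v
    have hu := hasFDerivAt_const (𝕜 := ℝ) u y
    have hv := hasFDerivAt_const (𝕜 := ℝ) v y
    have hl : HasFDerivAt (fun z => fderiv ℝ τ z (Γ' z u v)) _ y :=
      hT.clm_apply ((hΓ'.hasFDerivAt.clm_apply hu).clm_apply hv)
    have hΓτ : HasFDerivAt (fun z => Γ (τ z)) _ y :=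
      HasFDerivAt.comp (g := Γ) y hΓ.hasFDerivAt hτ1
    have hr : HasFDerivAt (fun z => Γ (τ z) (fderiv ℝ τ z u) (fderiv ℝ τ z v)
        + fderiv ℝ (fderiv ℝ τ) z u v) _ y :=
      ((hΓτ.clm_apply (hT.clm_apply hu)).clm_apply (hT.clm_apply hv)).add
        ((hT2.clm_apply hu).clm_apply hv)
    have h3 := (hr.congr_of_eventuallyEq (heq.mono fun z hz => hz u v)).unique hl
    have h4 := congrArg (fun L : E →L[ℝ] E => L w) h3
    simp at h4
    rw [add_comm, ← h4]; abel
  have h1 := hD w u v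
  have h2 := hD u w v
  have e0 := heq.self_of_nhds
  have ew := e0 w (Γ' y u v)
  have eu := e0 u (Γ' y w v)
  rw [e0 u v] at ew
  rw [e0 w v] at eu
  simp only [map_add] at ew eu
  rw [hsym.eq u w, hsym2.eq u w] at h2
  simp only [curv, map_sub, map_add, ew, eu]
  rw [← eq_sub_iff_add_eq'] at h1 h2
  rw [h1, h2]
  abel

/-- The Ricci tensor `Ric(u, v) = tr (w ↦ R(w, u) v)` of the connection `d + Γ`. -/
def ricciForm (Γ : E → E →L[ℝ] E →L[ℝ] E) (x : E) : E →ₗ[ℝ] E →ₗ[ℝ] ℝ :=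
  LinearMap.mk₂ ℝ (fun u v => LinearMap.trace ℝ E
      { toFun := fun w => curv Γ x w u v
        map_add' := fun a b => by simp [curv]; abel
        map_smul' := fun a b => by simp [curv, smul_sub, smul_add] })
    (fun a b c => by
      rw [← map_add]; congr 1; ext w; simp [curv]; abel)
    (fun a b c => by
      rw [← map_smul]; congr 1; ext w; simp [curv, smul_sub, smul_add])
    (fun a b c => by
      rw [← map_add]; congr 1; ext w; simp [curv]; abel)
    (fun a b c => by
      rw [← map_smul]; congr 1; ext w; simp [curv, smul_sub, smul_add])

lemma ricciForm_transform {Γ Γ' : E → E →L[ℝ] E →L[ℝ] E} {x y : E} (T : E ≃ₗ[ℝ] E)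
    (h : ∀ w u v, T (curv Γ' y w u v) = curv Γ x (T w) (T u) (T v)) (u v : E) :
    ricciForm Γ' y u v = ricciForm Γ x (T u) (T v) := by
  unfold ricciForm
  simp only [LinearMap.mk₂_apply]
  rw [← LinearMap.trace_conj' _ T]
  congr 1
  ext w
  simp [LinearEquiv.conj_apply, h]

end Abstract

/-! ### Coordinate expressions are independent of the coordinates -/

section Pullback

variable {n : ℕ}

/-- The bilinear form `dx^i ⊗ dx^j` on `ℝⁿ`. -/
def elemBil (i j : Fin n) : EuclideanSpace ℝ (Fin n) →L[ℝ] EuclideanSpace ℝ (Fin n) →L[ℝ] ℝ :=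
  (EuclideanSpace.proj i : EuclideanSpace ℝ (Fin n) →L[ℝ] ℝ).smulRight
    (EuclideanSpace.proj j : EuclideanSpace ℝ (Fin n) →L[ℝ] ℝ)

/-- The bilinear map `dx^i ⊗ dx^j ⊗ ∂_k` on `ℝⁿ`. -/
def elemBilVec (k i j : Fin n) : EuclideanSpace ℝ (Fin n) →L[ℝ]
    EuclideanSpace ℝ (Fin n) →L[ℝ] EuclideanSpace ℝ (Fin n) :=
  (EuclideanSpace.proj i : EuclideanSpace ℝ (Fin n) →L[ℝ] ℝ).smulRight
    ((EuclideanSpace.proj j : EuclideanSpace ℝ (Fin n) →L[ℝ] ℝ).smulRight (stdVec k))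

@[simp] lemma elemBil_apply (i j : Fin n) (u v : EuclideanSpace ℝ (Fin n)) :
    elemBil i j u v = u i * v j := by simp [elemBil]

@[simp] lemma elemBilVec_apply (k i j : Fin n) (u v : EuclideanSpace ℝ (Fin n)) :
    elemBilVec k i j u v = (u i * v j) • stdVec k := by simp [elemBilVec, mul_smul]

/-- The bilinear form `∑ A_ij dx^i ⊗ dx^j` on `ℝⁿ`. -/
def bil (A : Matrix (Fin n) (Fin n) ℝ) :
    EuclideanSpace ℝ (Fin n) →L[ℝ] EuclideanSpace ℝ (Fin n) →L[ℝ] ℝ :=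
  ∑ p : Fin n × Fin n, A p.1 p.2 • elemBil p.1 p.2

/-- The bilinear map `∑ c^k_ij dx^i ⊗ dx^j ⊗ ∂_k` on `ℝⁿ`. -/
def bilVec (c : Fin n → Fin n → Fin n → ℝ) : EuclideanSpace ℝ (Fin n) →L[ℝ]
    EuclideanSpace ℝ (Fin n) →L[ℝ] EuclideanSpace ℝ (Fin n) :=
  ∑ p : Fin n × Fin n × Fin n, c p.1 p.2.1 p.2.2 • elemBilVec p.1 p.2.1 p.2.2

lemma bil_apply (A : Matrix (Fin n) (Fin n) ℝ) (u v : EuclideanSpace ℝ (Fin n)) :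
    bil A u v = ∑ i, ∑ j, A i j * (u i * v j) := by
  simp [bil, sum_apply, Fintype.sum_prod_type]

lemma bilVec_apply (c : Fin n → Fin n → Fin n → ℝ) (u v : EuclideanSpace ℝ (Fin n))
    (k : Fin n) : bilVec c u v k = ∑ i, ∑ j, c k i j * (u i * v j) := by
  simp [bilVec, sum_apply, Finset.sum_apply, Fintype.sum_prod_type]

lemma bil_eq_matrix (A : Matrix (Fin n) (Fin n) ℝ) (u v : EuclideanSpace ℝ (Fin n)) :
    bil A u v = dotProduct (u : Fin n → ℝ) (A.mulVec v) := by
  simp only [bil_apply, dotProduct, Matrix.mulVec, Finset.mul_sum]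
  exact Finset.sum_congr rfl fun _ _ => Finset.sum_congr rfl fun _ _ => by ring

lemma bil_stdVec (A : Matrix (Fin n) (Fin n) ℝ) (i j : Fin n) :
    bil A (stdVec i) (stdVec j) = A i j := by
  simp [bil_apply]

lemma bilVec_stdVec (c : Fin n → Fin n → Fin n → ℝ) (k i j : Fin n) :
    bilVec c (stdVec i) (stdVec j) k = c k i j := by
  simp [bilVec_apply]

variable {U V : Set (EuclideanSpace ℝ (Fin n))}
  {G H : EuclideanSpace ℝ (Fin n) → Matrix (Fin n) (Fin n) ℝ}
  {τ : EuclideanSpace ℝ (Fin n) → EuclideanSpace ℝ (Fin n)} {y : EuclideanSpace ℝ (Fin n)}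
  {F : EuclideanSpace ℝ (Fin n) → ℝ}

/-- The Christoffel symbols as a bilinear map. -/
def connForm (G : EuclideanSpace ℝ (Fin n) → Matrix (Fin n) (Fin n) ℝ)
    (y : EuclideanSpace ℝ (Fin n)) : EuclideanSpace ℝ (Fin n) →L[ℝ]
    EuclideanSpace ℝ (Fin n) →L[ℝ] EuclideanSpace ℝ (Fin n) :=
  bilVec fun k i j => christoffel G k i j y

/-- The derivative of `F` in the direction `w` is `∑ w^m ∂_m F`. -/
lemma fderiv_eq_sum_pd (w : EuclideanSpace ℝ (Fin n)) :
    fderiv ℝ F y w = ∑ m, w m * pd m F y := by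
  conv_lhs => rw [vec_eq_sum w]
  simp [pd]

lemma hasFDerivAt_sum_smul {ι Y : Type*} [Fintype ι] [NormedAddCommGroup Y] [NormedSpace ℝ Y]
    {a : ι → EuclideanSpace ℝ (Fin n) → ℝ} (L : ι → Y)
    (h : ∀ i, DifferentiableAt ℝ (a i) y) : HasFDerivAt (fun z => ∑ i, a i z • L i)
      (∑ i, (fderiv ℝ (a i) y).smulRight (L i)) y :=
  HasFDerivAt.fun_sum fun i _ => (h i).hasFDerivAt.smul_const (L i)

lemma fderiv_sum_smul {ι Y : Type*} [Fintype ι] [NormedAddCommGroup Y] [NormedSpace ℝ Y]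
    {a : ι → EuclideanSpace ℝ (Fin n) → ℝ} (L : ι → Y)
    (h : ∀ i, DifferentiableAt ℝ (a i) y) (w : EuclideanSpace ℝ (Fin n)) :
    fderiv ℝ (fun z => ∑ i, a i z • L i) y w = ∑ i, (∑ m, w m * pd m (a i) y) • L i := by
  rw [(hasFDerivAt_sum_smul L h).fderiv]
  simp [sum_apply, fderiv_eq_sum_pd]

lemma differentiableAt_bil (h : ∀ i j, DifferentiableAt ℝ (fun z => G z i j) y) :
    DifferentiableAt ℝ (fun z => bil (G z)) y :=
  (hasFDerivAt_sum_smul (fun p : Fin n × Fin n => elemBil p.1 p.2)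
    fun p => h p.1 p.2).differentiableAt

lemma fderiv_bil (h : ∀ i j, DifferentiableAt ℝ (fun z => G z i j) y)
    (w : EuclideanSpace ℝ (Fin n)) :
    fderiv ℝ (fun z => bil (G z)) y w =
      bil fun i j => ∑ m, w m * pd m (fun z => G z i j) y :=
  fderiv_sum_smul (fun p : Fin n × Fin n => elemBil p.1 p.2) (fun p => h p.1 p.2) w

lemma IsMetricOn.differentiableAt_christoffel (hG : IsMetricOn G U) (hy : y ∈ U) (k i j : Fin n) :
    DifferentiableAt ℝ (christoffel G k i j) y :=
  ((hG.contDiffOn_christoffel k i j).contDiffAt (hG.mem_nhds hy)).differentiableAt (by simp)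

lemma IsMetricOn.differentiableAt_connForm (hG : IsMetricOn G U) (hy : y ∈ U) :
    DifferentiableAt ℝ (connForm G) y :=
  (hasFDerivAt_sum_smul (fun p : Fin n × Fin n × Fin n => elemBilVec p.1 p.2.1 p.2.2)
    fun p => hG.differentiableAt_christoffel hy p.1 p.2.1 p.2.2).differentiableAt

lemma IsMetricOn.fderiv_connForm (hG : IsMetricOn G U) (hy : y ∈ U)
    (w : EuclideanSpace ℝ (Fin n)) : fderiv ℝ (connForm G) y w =
      bilVec fun k i j => ∑ m, w m * pd m (christoffel G k i j) y :=
  fderiv_sum_smul (fun p : Fin n × Fin n × Fin n => elemBilVec p.1 p.2.1 p.2.2)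
    (fun p => hG.differentiableAt_christoffel hy p.1 p.2.1 p.2.2) w

/-- The Christoffel symbols satisfy Koszul's formula. -/
lemma IsMetricOn.isLeviCivitaAt (hG : IsMetricOn G U) (hy : y ∈ U) :
    IsLeviCivitaAt (fun z => bil (G z)) (connForm G y) y := by
  intro u v w
  have hL : ∀ u v w : EuclideanSpace ℝ (Fin n), fderiv ℝ (fun z => bil (G z)) y u v w
      = ∑ i, ∑ j, ∑ m, u m * pd m (fun z => G z i j) y * (v i * w j) := by
    intro u v w
    rw [fderiv_bil (hG.differentiableAt hy)]
    refine (bil_apply _ v w).trans ?_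
    simp only [Finset.sum_mul]
  rw [hL, hL, hL]
  have h0 : bil (G y) (connForm G y u v) w = ∑ l, ∑ i, ∑ j,
      (∑ m, G y l m * christoffel G m i j y) * (u i * v j * w l) := by
    simp only [bil_apply, connForm, bilVec_apply, Finset.sum_mul, Finset.mul_sum]
    rw [Finset.sum_comm]
    refine Finset.sum_congr rfl fun l _ => ?_
    rw [Finset.sum_comm]
    refine Finset.sum_congr rfl fun i _ => ?_
    rw [Finset.sum_comm]
    refine Finset.sum_congr rfl fun j _ => Finset.sum_congr rfl fun m _ => ?_
    rw [hG.symm y hy m l]; ring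
  rw [h0]
  simp_rw [hG.lower_christoffel hy]
  have e1 : ∑ i, ∑ j, ∑ m, u m * pd m (fun z => G z i j) y * (v i * w j)
      = ∑ l, ∑ i, ∑ j, pd i (fun z => G z j l) y * (u i * v j * w l) := by
    rw [Finset.sum_comm]
    refine Finset.sum_congr rfl fun l _ => ?_
    rw [Finset.sum_comm]
    exact Finset.sum_congr rfl fun _ _ => Finset.sum_congr rfl fun _ _ => by ring
  have e2 : ∑ i, ∑ j, ∑ m, v m * pd m (fun z => G z i j) y * (u i * w j)
      = ∑ l, ∑ i, ∑ j, pd j (fun z => G z i l) y * (u i * v j * w l) := by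
    rw [Finset.sum_comm]
    exact Finset.sum_congr rfl fun _ _ => Finset.sum_congr rfl fun _ _ =>
      Finset.sum_congr rfl fun _ _ => by ring
  have e3 : ∑ i, ∑ j, ∑ m, w m * pd m (fun z => G z i j) y * (u i * v j)
      = ∑ l, ∑ i, ∑ j, pd l (fun z => G z i j) y * (u i * v j * w l) := by
    simp_rw [Finset.sum_comm (γ := Fin n)
      (f := fun j m => w m * pd m (fun z => G z _ j) y * (u _ * v j))]
    rw [Finset.sum_comm]
    exact Finset.sum_congr rfl fun _ _ => Finset.sum_congr rfl fun _ _ =>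
      Finset.sum_congr rfl fun _ _ => by ring
  rw [e1, e2, e3, Finset.mul_sum, ← Finset.sum_add_distrib, ← Finset.sum_sub_distrib]
  refine Finset.sum_congr rfl fun l _ => ?_
  rw [Finset.mul_sum, ← Finset.sum_add_distrib, ← Finset.sum_sub_distrib]
  refine Finset.sum_congr rfl fun i _ => ?_
  rw [Finset.mul_sum, ← Finset.sum_add_distrib, ← Finset.sum_sub_distrib]
  exact Finset.sum_congr rfl fun j _ => by ring

/-- The Jacobian matrix `∂τ^a/∂x^i`. -/
def jacobian (τ : EuclideanSpace ℝ (Fin n) → EuclideanSpace ℝ (Fin n))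
    (y : EuclideanSpace ℝ (Fin n)) : Matrix (Fin n) (Fin n) ℝ :=
  fun a i => fderiv ℝ τ y (stdVec i) a

lemma fderiv_eq_jacobian (v : EuclideanSpace ℝ (Fin n)) :
    (fderiv ℝ τ y v : Fin n → ℝ) = (jacobian τ y).mulVec v := by
  conv_lhs => rw [vec_eq_sum v]
  ext a
  simp [jacobian, Matrix.mulVec, dotProduct, mul_comm]

/-- `H` is the pullback to `U` by the map `τ : U → V` of the metric `G` on `V`. -/
structure IsPullback (τ : EuclideanSpace ℝ (Fin n) → EuclideanSpace ℝ (Fin n))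
    (H G : EuclideanSpace ℝ (Fin n) → Matrix (Fin n) (Fin n) ℝ)
    (U V : Set (EuclideanSpace ℝ (Fin n))) : Prop where
  source : IsMetricOn H U
  target : IsMetricOn G V
  smooth : ContDiffOn ℝ ∞ τ U
  mapsTo : MapsTo τ U V
  eq : ∀ z ∈ U, H z = (jacobian τ z).transpose * G (τ z) * jacobian τ z

lemma bil_pullback {A J : Matrix (Fin n) (Fin n) ℝ} {T : EuclideanSpace ℝ (Fin n) →
    EuclideanSpace ℝ (Fin n)} (hT : ∀ v, (T v : Fin n → ℝ) = J.mulVec v)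
    (u v : EuclideanSpace ℝ (Fin n)) : bil (J.transpose * A * J) u v = bil A (T u) (T v) := by
  rw [bil_eq_matrix, bil_eq_matrix, hT, hT, ← Matrix.mulVec_mulVec, ← Matrix.mulVec_mulVec,
    Matrix.dotProduct_mulVec, Matrix.vecMul_transpose]

namespace IsPullback

variable (h : IsPullback τ H G U V) (hy : y ∈ U)
include h hy

lemma contDiffAt : ContDiffAt ℝ ∞ τ y := h.smooth.contDiffAt (h.source.mem_nhds hy)

lemma det_jacobian_ne : (jacobian τ y).det ≠ 0 := by
  intro h0
  apply h.source.det_ne y hy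
  rw [h.eq y hy, Matrix.det_mul, h0, mul_zero]

/-- The derivative of a change of coordinates as a linear equivalence. -/
lemma exists_equiv : ∃ T : EuclideanSpace ℝ (Fin n) ≃ₗ[ℝ] EuclideanSpace ℝ (Fin n),
    ∀ v, T v = fderiv ℝ τ y v := by
  have hinj : Function.Injective (fderiv ℝ τ y).toLinearMap := by
    rw [← LinearMap.ker_eq_bot, LinearMap.ker_eq_bot']
    intro v hv
    have h1 : (jacobian τ y).mulVec v = 0 := by
      rw [← fderiv_eq_jacobian]
      have hv' : fderiv ℝ τ y v = 0 := hv
      rw [hv']; rfl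
    have h2 := Matrix.eq_zero_of_mulVec_eq_zero (h.det_jacobian_ne hy) h1
    ext i; exact congrFun h2 i
  exact ⟨LinearEquiv.ofInjectiveEndo _ hinj, fun v => rfl⟩

/-- The transformation law of Christoffel symbols. -/
lemma connForm_transform (u v : EuclideanSpace ℝ (Fin n)) :
    fderiv ℝ τ y (connForm H y u v) =
      connForm G (τ y) (fderiv ℝ τ y u) (fderiv ℝ τ y v) + fderiv ℝ (fderiv ℝ τ) y u v := by
  refine IsLeviCivitaAt.transform (h.target.isLeviCivitaAt (h.mapsTo hy))
    (h.source.isLeviCivitaAt hy)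
    (differentiableAt_bil (h.target.differentiableAt (h.mapsTo hy)))
    (differentiableAt_bil (h.source.differentiableAt hy))
    ((h.contDiffAt hy).of_le (by norm_cast)) ?_ ?_ ?_ u v
  · intro u v
    rw [bil_eq_matrix, bil_eq_matrix, Matrix.dotProduct_mulVec, ← Matrix.mulVec_transpose,
      h.target.transpose_eq (h.mapsTo hy), dotProduct_comm]
  · filter_upwards [h.source.mem_nhds hy] with z hz u v
    rw [h.eq z hz, bil_pullback fderiv_eq_jacobian]
  · intro v hv
    obtain ⟨T, hT⟩ := h.exists_equiv hy
    have h1 : ∀ w : Fin n → ℝ, dotProduct (Matrix.vecMul v (G (τ y))) w = 0 := by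
      intro w
      have := hv (T.symm (WithLp.toLp 2 w))
      rw [← hT, T.apply_symm_apply, bil_eq_matrix, Matrix.dotProduct_mulVec] at this
      exact this
    have h2 : Matrix.vecMul v (G (τ y)) = 0 := dotProduct_eq_zero _ h1
    have h3 := Matrix.eq_zero_of_vecMul_eq_zero (h.target.det_ne _ (h.mapsTo hy)) h2
    ext i; exact congrFun h3 i

lemma curv_connForm (w u v : EuclideanSpace ℝ (Fin n)) :
    fderiv ℝ τ y (curv (connForm H) y w u v) =
      curv (connForm G) (τ y) (fderiv ℝ τ y w) (fderiv ℝ τ y u) (fderiv ℝ τ y v) :=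
  curv_transform (h.target.differentiableAt_connForm (h.mapsTo hy))
    (h.source.differentiableAt_connForm hy) ((h.contDiffAt hy).of_le (by norm_cast))
    (by filter_upwards [h.source.mem_nhds hy] with z hz using h.connForm_transform hz) w u v

end IsPullback

/-- The coordinate expression of the Ricci tensor is the trace of the curvature. -/
lemma IsMetricOn.ricciForm_stdVec (hG : IsMetricOn G U) (hy : y ∈ U) (i j : Fin n) :
    ricciForm (connForm G) y (stdVec j) (stdVec i) = ricciCoord G y i j := by
  unfold ricciForm
  rw [LinearMap.mk₂_apply,
    LinearMap.trace_eq_matrix_trace ℝ (EuclideanSpace.basisFun (Fin n) ℝ).toBasis]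
  simp only [Matrix.trace, Matrix.diag, LinearMap.toMatrix_apply]
  have hD : ∀ a b c k, fderiv ℝ (connForm G) y (stdVec a) (stdVec b) (stdVec c) k
      = pd a (christoffel G k b c) y := by
    intro a b c k
    rw [hG.fderiv_connForm hy, bilVec_stdVec]
    simp
  have hQ : ∀ a b c k, connForm G y (stdVec a) (connForm G y (stdVec b) (stdVec c)) k
      = ∑ l, christoffel G k a l y * christoffel G l b c y := by
    intro a b c k
    conv_lhs => rw [connForm, bilVec_apply]
    simp [bilVec_stdVec]
  have hb : ∀ k, (EuclideanSpace.basisFun (Fin n) ℝ).toBasis k = stdVec k := fun k => by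
    simp [stdVec]
  have hs : ∀ k, pd j (christoffel G k k i) y = pd j (christoffel G k i k) y := fun k =>
    pd_congr j (by
      filter_upwards [hG.mem_nhds hy] with z hz using hG.christoffel_symm hz k k i)
  have hterm : ∀ k, ((EuclideanSpace.basisFun (Fin n) ℝ).toBasis.repr
      (curv (connForm G) y (stdVec k) (stdVec j) (stdVec i))) k
      = pd k (christoffel G k j i) y - pd j (christoffel G k k i) y
        + ∑ l, christoffel G k k l y * christoffel G l j i y
        - ∑ l, christoffel G k j l y * christoffel G l k i y := by
    intro k
    rw [← hD, ← hD, ← hQ, ← hQ]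
    rfl
  have hs' : ∀ k, pd k (christoffel G k j i) y = pd k (christoffel G k i j) y := fun k =>
    pd_congr k (by
      filter_upwards [hG.mem_nhds hy] with z hz using hG.christoffel_symm hz k j i)
  simp only [LinearMap.coe_mk, AddHom.coe_mk, hb, hterm, hs, hs', ricciCoord]
  rw [← Finset.sum_add_distrib]
  refine Finset.sum_congr rfl fun k _ => ?_
  rw [Finset.sum_sub_distrib, add_sub_assoc]
  congr 2
  · exact Finset.sum_congr rfl fun l _ => by rw [hG.christoffel_symm hy l j i]
  · exact Finset.sum_congr rfl fun l _ => by rw [hG.christoffel_symm hy l k i]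

/-- A bilinear form on `ℝⁿ` in terms of its matrix. -/
lemma bilinear_transform {β β' : EuclideanSpace ℝ (Fin n) →ₗ[ℝ] EuclideanSpace ℝ (Fin n) →ₗ[ℝ] ℝ}
    {A B J : Matrix (Fin n) (Fin n) ℝ}
    {T : EuclideanSpace ℝ (Fin n) → EuclideanSpace ℝ (Fin n)}
    (hT : ∀ v, (T v : Fin n → ℝ) = J.mulVec v)
    (hβ' : ∀ i j, β' (stdVec i) (stdVec j) = B i j) (hβ : ∀ i j, β (stdVec i) (stdVec j) = A i j)
    (h : ∀ u v, β' u v = β (T u) (T v)) : B = J.transpose * A * J := by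
  have hbil : ∀ u v, β u v = bil A u v := by
    intro u v
    rw [bil_apply]
    conv_lhs => rw [vec_eq_sum u, vec_eq_sum v]
    simp only [map_sum, LinearMap.sum_apply, map_smul, LinearMap.smul_apply, hβ, smul_eq_mul,
      Finset.mul_sum]
    rw [Finset.sum_comm]
    exact Finset.sum_congr rfl fun _ _ => Finset.sum_congr rfl fun _ _ => by ring
  ext i j
  rw [← hβ', h, hbil, ← bil_pullback hT, bil_stdVec]

namespace IsPullback

variable (h : IsPullback τ H G U V) (hy : y ∈ U)
include h hy

/-- The coordinate expression of the Ricci tensor transforms as a tensor. -/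
lemma ricciCoord_eq : ricciCoord H y =
    (jacobian τ y).transpose * ricciCoord G (τ y) * jacobian τ y := by
  obtain ⟨T, hT⟩ := h.exists_equiv hy
  refine bilinear_transform (β := (ricciForm (connForm G) (τ y)).flip)
    (β' := (ricciForm (connForm H) y).flip) fderiv_eq_jacobian
    (fun i j => h.source.ricciForm_stdVec hy i j)
    (fun i j => h.target.ricciForm_stdVec (h.mapsTo hy) i j) fun u v => ?_
  simp only [LinearMap.flip_apply, ← hT]
  exact ricciForm_transform T (fun w u v => by simpa only [hT] using h.curv_connForm hy w u v) v u

lemma pd_comp (hF : DifferentiableAt ℝ F (τ y)) (i : Fin n) :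
    pd i (F ∘ τ) y = ∑ a, pd a F (τ y) * jacobian τ y a i := by
  unfold pd
  rw [fderiv_comp y hF ((h.contDiffAt hy).differentiableAt (by simp))]
  change fderiv ℝ F (τ y) (fderiv ℝ τ y (stdVec i)) = _
  rw [fderiv_eq_sum_pd]
  exact Finset.sum_congr rfl fun a _ => mul_comm _ _

omit h hy in
lemma hessCoord_eq_fderiv (hF : ContDiffAt ℝ 2 F y) (i j : Fin n) :
    hessCoord H F y i j = fderiv ℝ (fderiv ℝ F) y (stdVec i) (stdVec j)
      - fderiv ℝ F y (connForm H y (stdVec i) (stdVec j)) := by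
  have hd : DifferentiableAt ℝ (fderiv ℝ F) y :=
    (hF.fderiv_right (m := 1) (by norm_num)).differentiableAt (by norm_num)
  unfold hessCoord
  congr 1
  · change fderiv ℝ (fun z => fderiv ℝ F z (stdVec j)) y (stdVec i) = _
    rw [fderiv_clm_apply hd (differentiableAt_const _)]
    simp
  · rw [fderiv_eq_sum_pd]
    simp [connForm, bilVec_stdVec]

/-- The coordinate expression of the Hessian transforms as a tensor. -/
lemma hessCoord_eq (hF : ContDiffOn ℝ ∞ F V) : hessCoord H (F ∘ τ) y =
    (jacobian τ y).transpose * hessCoord G F (τ y) * jacobian τ y := by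
  have hτ := (h.contDiffAt hy).of_le (m := 2) (by norm_cast)
  have hF2 : ∀ z ∈ V, ContDiffAt ℝ 2 F z := fun z hz =>
    (hF.contDiffAt (h.target.mem_nhds hz)).of_le (by norm_cast)
  have hFy := hF2 _ (h.mapsTo hy)
  let β (G : EuclideanSpace ℝ (Fin n) → Matrix (Fin n) (Fin n) ℝ)
      (F : EuclideanSpace ℝ (Fin n) → ℝ) (y : EuclideanSpace ℝ (Fin n)) :
      EuclideanSpace ℝ (Fin n) →ₗ[ℝ] EuclideanSpace ℝ (Fin n) →ₗ[ℝ] ℝ :=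
    LinearMap.mk₂ ℝ (fun u v => fderiv ℝ (fderiv ℝ F) y u v - fderiv ℝ F y (connForm G y u v))
      (fun a b c => by simp; ring) (fun a b c => by simp; ring) (fun a b c => by simp; ring)
      (fun a b c => by simp; ring)
  refine bilinear_transform (β := β G F (τ y)) (β' := β H (F ∘ τ) y) fderiv_eq_jacobian
    (fun i j => (hessCoord_eq_fderiv (hFy.comp y hτ) i j).symm)
    (fun i j => (hessCoord_eq_fderiv hFy i j).symm) fun u v => ?_
  simp only [β, LinearMap.mk₂_apply]
  have hT : HasFDerivAt (fderiv ℝ τ) (fderiv ℝ (fderiv ℝ τ) y) y :=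
    ((hτ.fderiv_right (m := 1) (by norm_num)).differentiableAt (by norm_num)).hasFDerivAt
  have hτ1 : HasFDerivAt τ (fderiv ℝ τ y) y := (hτ.differentiableAt (by norm_num)).hasFDerivAt
  have hdF : HasFDerivAt (fderiv ℝ F) (fderiv ℝ (fderiv ℝ F) (τ y)) (τ y) :=
    ((hFy.fderiv_right (m := 1) (by norm_num)).differentiableAt (by norm_num)).hasFDerivAt
  have hFτ : HasFDerivAt (fun z => fderiv ℝ F (τ z)) _ y :=
    HasFDerivAt.comp (g := fderiv ℝ F) y hdF hτ1
  have e1 : fderiv ℝ (F ∘ τ) =ᶠ[𝓝 y] fun z => (fderiv ℝ F (τ z)).comp (fderiv ℝ τ z) := by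
    filter_upwards [h.source.mem_nhds hy] with z hz
    exact fderiv_comp z ((hF2 _ (h.mapsTo hz)).differentiableAt (by norm_num))
      ((h.contDiffAt hz).differentiableAt (by simp))
  have e2 := e1.self_of_nhds
  rw [e1.fderiv_eq, e2, (hFτ.clm_comp hT).fderiv]
  simp [h.connForm_transform hy]
  ring

/-- The trace with respect to the metric is independent of the coordinates. -/
lemma trace_eq (A : Matrix (Fin n) (Fin n) ℝ) :
    ∑ i, ∑ j, (H y)⁻¹ i j * ((jacobian τ y).transpose * A * jacobian τ y) i j
      = ∑ a, ∑ b, (G (τ y))⁻¹ a b * A a b := by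
  have key : ∀ X Y : Matrix (Fin n) (Fin n) ℝ,
      ∑ i, ∑ j, X i j * Y i j = (X * Y.transpose).trace := fun X Y => rfl
  have hJ : IsUnit (jacobian τ y).det := isUnit_iff_ne_zero.mpr (h.det_jacobian_ne hy)
  have hJt : IsUnit (jacobian τ y).transpose.det := by rwa [Matrix.det_transpose]
  rw [key, key, h.eq y hy, Matrix.mul_inv_rev, Matrix.mul_inv_rev, Matrix.transpose_mul,
    Matrix.transpose_mul, Matrix.transpose_transpose, mul_assoc, mul_assoc,
    Matrix.nonsing_inv_mul_cancel_left _ _ hJt, Matrix.trace_mul_comm, mul_assoc, mul_assoc,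
    Matrix.mul_nonsing_inv _ hJ, mul_one]

lemma scalarCoord_eq (hF : ContDiffOn ℝ ∞ F V) :
    scalarCoord H (F ∘ τ) y = scalarCoord G F (τ y) := by
  have hd : DifferentiableAt ℝ F (τ y) :=
    (hF.contDiffAt (h.target.mem_nhds (h.mapsTo hy))).differentiableAt (by simp)
  unfold scalarCoord
  rw [← h.trace_eq hy (fun a b => ricciCoord G (τ y) a b + hessCoord G F (τ y) a b
    - pd a F (τ y) * pd b F (τ y))]
  have e : (fun a b => ricciCoord G (τ y) a b + hessCoord G F (τ y) a b
      - pd a F (τ y) * pd b F (τ y) : Matrix (Fin n) (Fin n) ℝ) = ricciCoord G (τ y)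
        + hessCoord G F (τ y) - Matrix.vecMulVec (fun a => pd a F (τ y)) fun b => pd b F (τ y) :=
    rfl
  have e2 : Matrix.vecMulVec (fun a => pd a (F ∘ τ) y) (fun b => pd b (F ∘ τ) y)
      = (jacobian τ y).transpose * Matrix.vecMulVec (fun a => pd a F (τ y))
        (fun b => pd b F (τ y)) * jacobian τ y := by
    rw [Matrix.mul_vecMulVec, Matrix.vecMulVec_mul]
    congr 1
    · ext i
      rw [h.pd_comp hy hd]
      simp [Matrix.mulVec, dotProduct, mul_comm]
    · ext i
      rw [h.pd_comp hy hd]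
      simp [Matrix.vecMul, dotProduct]
  have e3 : ∀ i j, ricciCoord H y i j + hessCoord H (F ∘ τ) y i j
      - pd i (F ∘ τ) y * pd j (F ∘ τ) y = ((jacobian τ y).transpose * (ricciCoord G (τ y)
        + hessCoord G F (τ y) - Matrix.vecMulVec (fun a => pd a F (τ y)) fun b => pd b F (τ y))
        * jacobian τ y) i j := by
    intro i j
    rw [mul_sub, sub_mul, mul_add, add_mul, ← h.ricciCoord_eq hy, ← h.hessCoord_eq hy hF, ← e2]
    rfl
  rw [e]
  simp_rw [e3]

end IsPullback
end Pullback

/-! ### Tensor fields in charts -/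

section Charts

variable {n : ℕ} {M : Type*} [TopologicalSpace M] [ChartedSpace (EuclideanSpace ℝ (Fin n)) M]

/-- The derivative at `y` of the inverse of the preferred chart at `p`, as a map of `ℝⁿ`. -/
def chartSymmDeriv (p : M) (y : EuclideanSpace ℝ (Fin n)) :
    EuclideanSpace ℝ (Fin n) →L[ℝ] EuclideanSpace ℝ (Fin n) :=
  mfderiv 𝓘(ℝ, EuclideanSpace ℝ (Fin n)) (𝓡 n) (extChartAt (𝓡 n) p).symm y

/-- A tensor field as a function with values in a fixed space; this uses that each tangent space
is the model space. -/
def CovTensor.toFun (B : CovTensor n M) (x : M) :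
    EuclideanSpace ℝ (Fin n) →L[ℝ] EuclideanSpace ℝ (Fin n) →L[ℝ] ℝ := B x

lemma comp_apply (B : CovTensor n M) (p : M) (y : EuclideanSpace ℝ (Fin n)) (i j : Fin n) :
    comp B p y i j = B.toFun ((extChartAt (𝓡 n) p).symm y) (chartSymmDeriv p y (stdVec i))
      (chartSymmDeriv p y (stdVec j)) := rfl

/-- The coordinate change from the chart at `p` to the chart at `q`. -/
def transition (p q : M) (y : EuclideanSpace ℝ (Fin n)) : EuclideanSpace ℝ (Fin n) :=
  extChartAt (𝓡 n) q ((extChartAt (𝓡 n) p).symm y)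

/-- The image in the chart at `p` of the intersection of the domains of the charts at `p`, `q`. -/
def overlap (p q : M) : Set (EuclideanSpace ℝ (Fin n)) :=
  (extChartAt (𝓡 n) p).target ∩ (extChartAt (𝓡 n) p).symm ⁻¹' (extChartAt (𝓡 n) q).source

variable {p q : M} {y : EuclideanSpace ℝ (Fin n)}

lemma isOpen_overlap (p q : M) : IsOpen (overlap p q : Set (EuclideanSpace ℝ (Fin n))) :=
  (continuousOn_extChartAt_symm p).isOpen_inter_preimage (isOpen_extChartAt_target p)
    (isOpen_extChartAt_source q)

lemma transition_mem_target (hy : y ∈ overlap p q) :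
    transition p q y ∈ (extChartAt (𝓡 n) q).target :=
  (extChartAt (𝓡 n) q).map_source hy.2

lemma symm_transition (hy : y ∈ overlap p q) :
    (extChartAt (𝓡 n) q).symm (transition p q y) = (extChartAt (𝓡 n) p).symm y :=
  (extChartAt (𝓡 n) q).left_inv hy.2

variable [IsManifold (𝓡 n) ∞ M]

lemma contDiffOn_transition (p q : M) :
    ContDiffOn ℝ ∞ (transition p q : EuclideanSpace ℝ (Fin n) → _) (overlap p q) := by
  have h := contDiffOn_ext_coord_change (I := 𝓡 n) (n := ∞) q p
  refine h.mono fun y hy => ?_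
  rw [PartialEquiv.trans_source]
  exact ⟨hy.1, hy.2⟩

lemma differentiableAt_transition (hy : y ∈ overlap p q) :
    DifferentiableAt ℝ (transition p q : EuclideanSpace ℝ (Fin n) → _) y :=
  ((contDiffOn_transition p q).contDiffAt ((isOpen_overlap p q).mem_nhds hy)).differentiableAt
    (by simp)

lemma mdifferentiableAt_chartSymm (hy : y ∈ (extChartAt (𝓡 n) p).target) :
    MDifferentiableAt 𝓘(ℝ, EuclideanSpace ℝ (Fin n)) (𝓡 n) (extChartAt (𝓡 n) p).symm y :=
  ((contMDiffOn_extChartAt_symm (n := ∞) p).contMDiffAt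
    ((isOpen_extChartAt_target p).mem_nhds hy)).mdifferentiableAt (by simp)

lemma chartSymmDeriv_eq (hy : y ∈ overlap p q) :
    chartSymmDeriv p y = (chartSymmDeriv q (transition p q y)).comp
      (fderiv ℝ (transition p q) y) := by
  have h1 : (extChartAt (𝓡 n) p).symm =ᶠ[𝓝 y]
      (extChartAt (𝓡 n) q).symm ∘ transition p q := by
    filter_upwards [(isOpen_overlap p q).mem_nhds hy] with z hz
    exact (symm_transition hz).symm
  have h2 := mfderiv_comp (I := 𝓘(ℝ, EuclideanSpace ℝ (Fin n)))
    (I' := 𝓘(ℝ, EuclideanSpace ℝ (Fin n))) (I'' := 𝓡 n) y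
    (mdifferentiableAt_chartSymm (transition_mem_target hy))
    (differentiableAt_transition hy).mdifferentiableAt
  rw [mfderiv_eq_fderiv] at h2
  have h3 := h1.mfderiv_eq (I := 𝓘(ℝ, EuclideanSpace ℝ (Fin n))) (I' := 𝓡 n)
  exact h3.trans h2

/-- The transformation law of the components of a tensor field. -/
lemma comp_transition (B : CovTensor n M) (hy : y ∈ overlap p q) :
    comp B p y = (jacobian (transition p q) y).transpose * comp B q (transition p q y)
      * jacobian (transition p q) y := by
  set T := fderiv ℝ (transition p q : EuclideanSpace ℝ (Fin n) → _) y with hT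
  set D := chartSymmDeriv q (transition p q y) with hD
  set b := B.toFun ((extChartAt (𝓡 n) p).symm y)
  have h1 : ∀ i j, comp B p y i j = b (D (T (stdVec i))) (D (T (stdVec j))) := by
    intro i j
    rw [comp_apply, chartSymmDeriv_eq hy]; rfl
  have h2 : ∀ a c, comp B q (transition p q y) a c = b (D (stdVec a)) (D (stdVec c)) := by
    intro a c
    rw [comp_apply, symm_transition hy]
  have h3 : ∀ i, T (stdVec i) = ∑ a, jacobian (transition p q) y a i • stdVec a := fun i =>
    vec_eq_sum _
  ext i j
  rw [h1, h3, h3]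
  simp only [map_sum, map_smul, sum_apply, smul_apply, smul_eq_mul, Matrix.mul_apply,
    Matrix.transpose_apply, h2, Finset.sum_mul, Finset.mul_sum]
  exact Finset.sum_congr rfl fun _ _ => Finset.sum_congr rfl fun _ _ => by ring

/-- The derivative of the chart at `p` inverts `chartSymmDeriv`. -/
lemma mfderiv_chart_comp (hy : y ∈ (extChartAt (𝓡 n) p).target)
    (v : EuclideanSpace ℝ (Fin n)) :
    mfderiv (𝓡 n) 𝓘(ℝ, EuclideanSpace ℝ (Fin n)) (extChartAt (𝓡 n) p)
      ((extChartAt (𝓡 n) p).symm y) (chartSymmDeriv p y v) = v := by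
  have h1 : (extChartAt (𝓡 n) p) ∘ (extChartAt (𝓡 n) p).symm =ᶠ[𝓝 y] id := by
    filter_upwards [(isOpen_extChartAt_target (I := 𝓡 n) p).mem_nhds hy] with z hz
    exact (extChartAt (𝓡 n) p).right_inv hz
  have hx : (extChartAt (𝓡 n) p).symm y ∈ (chartAt (EuclideanSpace ℝ (Fin n)) p).source := by
    rw [← extChartAt_source (𝓡 n)]; exact (extChartAt (𝓡 n) p).map_target hy
  have hd : MDifferentiableAt (𝓡 n) 𝓘(ℝ, EuclideanSpace ℝ (Fin n)) (extChartAt (𝓡 n) p)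
      ((extChartAt (𝓡 n) p).symm y) :=
    ((contMDiffAt_extChartAt' (n := ∞) hx)).mdifferentiableAt (by simp)
  have h2 := mfderiv_comp (I := 𝓘(ℝ, EuclideanSpace ℝ (Fin n)))
    (I' := 𝓡 n) (I'' := 𝓘(ℝ, EuclideanSpace ℝ (Fin n))) y hd (mdifferentiableAt_chartSymm hy)
  have h3 := h1.mfderiv_eq (I := 𝓘(ℝ, EuclideanSpace ℝ (Fin n)))
    (I' := 𝓘(ℝ, EuclideanSpace ℝ (Fin n)))
  rw [mfderiv_id] at h3
  have h4 := h2.symm.trans h3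
  exact congrArg (fun L : EuclideanSpace ℝ (Fin n) →L[ℝ] EuclideanSpace ℝ (Fin n) => L v) h4

lemma chartSymmDeriv_bijective (hy : y ∈ (extChartAt (𝓡 n) p).target) :
    Function.Bijective (chartSymmDeriv p y) := by
  have hinj : Function.Injective (chartSymmDeriv p y).toLinearMap :=
    Function.LeftInverse.injective (g := fun v => mfderiv (𝓡 n) 𝓘(ℝ, EuclideanSpace ℝ (Fin n))
      (extChartAt (𝓡 n) p) ((extChartAt (𝓡 n) p).symm y) v) (mfderiv_chart_comp hy)
  exact ⟨hinj, LinearMap.injective_iff_surjective.mp hinj⟩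

open Bundle in
/-- The components of a tensor field are those of its expression in the trivialization over the
chart. -/
lemma comp_eq_trivialization (B : CovTensor n M) (hy : y ∈ (extChartAt (𝓡 n) p).target)
    (i j : Fin n) : comp B p y i j =
      ((trivializationAt (EuclideanSpace ℝ (Fin n) →L[ℝ] EuclideanSpace ℝ (Fin n) →L[ℝ] ℝ)
        (fun x : M => TangentSpace (𝓡 n) x →L[ℝ] TangentSpace (𝓡 n) x →L[ℝ] ℝ) p)
        (TotalSpace.mk' (EuclideanSpace ℝ (Fin n) →L[ℝ] EuclideanSpace ℝ (Fin n) →L[ℝ] ℝ)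
          (E := fun x : M => TangentSpace (𝓡 n) x →L[ℝ] TangentSpace (𝓡 n) x →L[ℝ] ℝ)
          ((extChartAt (𝓡 n) p).symm y) (B ((extChartAt (𝓡 n) p).symm y)))).2
        (stdVec i) (stdVec j) := by
  have hx : (extChartAt (𝓡 n) p).symm y ∈ (chartAt (EuclideanSpace ℝ (Fin n)) p).source := by
    rw [← extChartAt_source (𝓡 n)]; exact (extChartAt (𝓡 n) p).map_target hy
  set x := (extChartAt (𝓡 n) p).symm y with hxdef
  have hb : x ∈ (trivializationAt (EuclideanSpace ℝ (Fin n)) (TangentSpace (𝓡 n)) p).baseSet := by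
    simpa using hx
  have hD : ∀ v, (trivializationAt (EuclideanSpace ℝ (Fin n)) (TangentSpace (𝓡 n)) p).symm x v
      = chartSymmDeriv p y v := by
    intro v
    rw [← Trivialization.symmL_apply (R := ℝ) _ hb, TangentBundle.symmL_trivializationAt hx]
    have : extChartAt (𝓡 n) p x = y := (extChartAt (𝓡 n) p).right_inv hy
    have hgen : ∀ z, z = y → (mfderivWithin 𝓘(ℝ, EuclideanSpace ℝ (Fin n)) (𝓡 n)
        (extChartAt (𝓡 n) p).symm (range (𝓡 n)) z :
          EuclideanSpace ℝ (Fin n) →L[ℝ] EuclideanSpace ℝ (Fin n)) v = chartSymmDeriv p y v := by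
      rintro z rfl
      simp only [ModelWithCorners.range_eq_univ, mfderivWithin_univ]
      rfl
    exact hgen _ this
  rw [hom_trivializationAt_apply]
  have h := inCoordinates_apply_eq₂ (𝕜 := ℝ) (F₁ := EuclideanSpace ℝ (Fin n))
    (F₂ := EuclideanSpace ℝ (Fin n)) (F₃ := ℝ) (E₁ := TangentSpace (𝓡 n) (M := M))
    (E₂ := TangentSpace (𝓡 n) (M := M)) (E₃ := Bundle.Trivial M ℝ) (x₀ := p) (x := x)
    (ϕ := B x) (v := stdVec i) (w := stdVec j) hb hb (by simp)
  refine Eq.trans ?_ h.symm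
  rw [hD, hD]
  simp
  rfl

end Charts

/-! ### Curvature and Hessian in charts -/

section Charts

variable {n : ℕ} {M : Type*} [TopologicalSpace M] [ChartedSpace (EuclideanSpace ℝ (Fin n)) M]
  [IsManifold (𝓡 n) ∞ M] {p q : M} {y : EuclideanSpace ℝ (Fin n)} {g s : CovTensor n M}
  {f : M → ℝ}

omit [IsManifold (𝓡 n) ∞ M] in
lemma symm_mem_chart_source (hy : y ∈ (extChartAt (𝓡 n) p).target) :
    (extChartAt (𝓡 n) p).symm y ∈ (chartAt (EuclideanSpace ℝ (Fin n)) p).source := by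
  rw [← extChartAt_source (𝓡 n)]; exact (extChartAt (𝓡 n) p).map_target hy

/-- The components of a smooth tensor field are smooth. -/
lemma IsSmoothSymmetric.contDiffOn_comp (hs : IsSmoothSymmetric s) (p : M) (i j : Fin n) :
    ContDiffOn ℝ ∞ (fun y => comp s p y i j) (extChartAt (𝓡 n) p).target := by
  set e := trivializationAt (EuclideanSpace ℝ (Fin n) →L[ℝ] EuclideanSpace ℝ (Fin n) →L[ℝ] ℝ)
    (fun x : M => TangentSpace (𝓡 n) x →L[ℝ] TangentSpace (𝓡 n) x →L[ℝ] ℝ) p with he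
  have h1 := (e.contMDiffOn_section_baseSet_iff (IB := 𝓡 n) (n := ∞) (s := s)).mp
    hs.smooth.contMDiffOn
  have hmaps : MapsTo (extChartAt (𝓡 n) p).symm (extChartAt (𝓡 n) p).target e.baseSet := by
    intro y hy
    have := symm_mem_chart_source hy
    simpa [he, hom_trivializationAt_baseSet] using this
  have h2 := (h1.comp (contMDiffOn_extChartAt_symm (n := ∞) p) hmaps).contDiffOn
  refine ((h2.clm_apply (contDiffOn_const (c := (stdVec i : EuclideanSpace ℝ (Fin n))))).clm_apply
    (contDiffOn_const (c := (stdVec j : EuclideanSpace ℝ (Fin n))))).congr fun y hy => ?_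
  exact comp_eq_trivialization s hy i j

omit [IsManifold (𝓡 n) ∞ M] in
lemma IsSmoothSymmetric.comp_symm [IsManifold (𝓡 n) ∞ M] (hs : IsSmoothSymmetric s) (p : M)
    (y : EuclideanSpace ℝ (Fin n)) (i j : Fin n) : comp s p y i j = comp s p y j i :=
  hs.symm _ _ _

/-- A tensor that vanishes on the coordinate vectors of a chart vanishes. -/
lemma toFun_ext {B B' : CovTensor n M} (hy : y ∈ (extChartAt (𝓡 n) p).target)
    (h : comp B p y = comp B' p y) :
    B.toFun ((extChartAt (𝓡 n) p).symm y) = B'.toFun ((extChartAt (𝓡 n) p).symm y) := by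
  ext u v
  obtain ⟨u, rfl⟩ := (chartSymmDeriv_bijective hy).2 u
  obtain ⟨v, rfl⟩ := (chartSymmDeriv_bijective hy).2 v
  rw [vec_eq_sum u, vec_eq_sum v]
  simp only [map_sum, map_smul, sum_apply, smul_apply, smul_eq_mul]
  simp_rw [← comp_apply, h]

lemma IsSemiRiemannianMetric.det_comp_ne (hg : IsSemiRiemannianMetric g)
    (hy : y ∈ (extChartAt (𝓡 n) p).target) : (comp g p y).det ≠ 0 := by
  intro h0
  obtain ⟨v, hv, hv0⟩ := Matrix.exists_mulVec_eq_zero_iff.mpr h0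
  apply hv
  set D := chartSymmDeriv p y
  have hw : D (WithLp.toLp 2 v) = 0 := by
    refine hg.nondegenerate ((extChartAt (𝓡 n) p).symm y) (D (WithLp.toLp 2 v)) fun w => ?_
    refine (hg.symm _ _ _).trans ?_
    obtain ⟨w, rfl⟩ := (chartSymmDeriv_bijective hy).2 w
    change g.toFun _ (D w) (D (WithLp.toLp 2 v)) = 0
    rw [vec_eq_sum w, vec_eq_sum (WithLp.toLp 2 v)]
    simp only [map_sum, map_smul, sum_apply, smul_apply, smul_eq_mul]
    simp_rw [Finset.mul_sum]
    rw [Finset.sum_comm]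
    refine Finset.sum_eq_zero fun i _ => ?_
    have h1 := congrFun hv0 i
    simp only [Matrix.mulVec, dotProduct, Pi.zero_apply] at h1
    simp_rw [mul_left_comm _ (w i), ← Finset.mul_sum]
    have h2 : ∑ j, v j * g.toFun ((extChartAt (𝓡 n) p).symm y) (D (stdVec i)) (D (stdVec j)) = 0 := by
      rw [← h1]
      exact Finset.sum_congr rfl fun j _ => mul_comm _ _
    rw [h2, mul_zero]
  have h3 : (WithLp.toLp 2 v : EuclideanSpace ℝ (Fin n)) = 0 :=
    (chartSymmDeriv_bijective hy).1 (by rw [map_zero]; exact hw)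
  ext i; exact congrArg (fun u : EuclideanSpace ℝ (Fin n) => u i) h3

/-- The points of the chart at `p` at which `g` is nondegenerate. -/
def nondegSet (g : CovTensor n M) (p : M) : Set (EuclideanSpace ℝ (Fin n)) :=
  {y ∈ (extChartAt (𝓡 n) p).target | (comp g p y).det ≠ 0}

lemma IsSmoothSymmetric.isMetricOn (hs : IsSmoothSymmetric s) (p : M) {U : Set _}
    (hU : IsOpen U) (hUt : U ⊆ (extChartAt (𝓡 n) p).target) :
    IsMetricOn (comp s p) (U ∩ nondegSet s p) where
  isOpen := by
    have hc : ContinuousOn (fun y => (comp s p y).det) (extChartAt (𝓡 n) p).target := fun y hy =>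
      (contDiffAt_det (m := ∞) fun i j => (hs.contDiffOn_comp p i j).contDiffAt
        ((isOpen_extChartAt_target p).mem_nhds hy)).continuousAt.continuousWithinAt
    exact hU.inter (hc.isOpen_inter_preimage (isOpen_extChartAt_target p) isOpen_ne)
  smooth i j := (hs.contDiffOn_comp p i j).mono fun y hy => hUt hy.1
  symm y _ i j := hs.comp_symm p y i j
  det_ne y hy := hy.2.2

/-- The components of `g` in two charts are related by a change of coordinates. -/
lemma IsSmoothSymmetric.isPullback (hs : IsSmoothSymmetric s) (p q : M) :
    IsPullback (transition p q) (comp s p) (comp s q) (overlap p q ∩ nondegSet s p)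
      ((extChartAt (𝓡 n) q).target ∩ nondegSet s q) where
  source := hs.isMetricOn p (isOpen_overlap p q) inter_subset_left
  target := hs.isMetricOn q (isOpen_extChartAt_target q) subset_rfl
  smooth := (contDiffOn_transition p q).mono inter_subset_left
  mapsTo y hy := by
    refine ⟨transition_mem_target hy.1, transition_mem_target hy.1, fun h0 => hy.2.2 ?_⟩
    rw [comp_transition s hy.1, Matrix.det_mul, Matrix.det_mul, h0]; simp
  eq y hy := comp_transition s hy.1

omit [IsManifold (𝓡 n) ∞ M] in
lemma mem_overlap_self [IsManifold (𝓡 n) ∞ M] (hy : y ∈ (extChartAt (𝓡 n) p).target) :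
    y ∈ overlap p ((extChartAt (𝓡 n) p).symm y) :=
  ⟨hy, mem_extChartAt_source _⟩

/-- The differential of `f` on a coordinate vector is a partial derivative. -/
lemma mfderiv_comp_chartSymm (hf : ContMDiff (𝓡 n) 𝓘(ℝ, ℝ) ∞ f)
    (hy : y ∈ (extChartAt (𝓡 n) p).target) (i : Fin n) :
    mvfderiv (𝓡 n) f ((extChartAt (𝓡 n) p).symm y) (chartSymmDeriv p y (stdVec i)) =
      pd i (f ∘ (extChartAt (𝓡 n) p).symm) y := by
  have h := mfderiv_comp (I := 𝓘(ℝ, EuclideanSpace ℝ (Fin n)))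
    (I' := 𝓡 n) (I'' := 𝓘(ℝ, ℝ)) y (hf.mdifferentiable (by simp) _)
    (mdifferentiableAt_chartSymm (p := p) hy)
  rw [mfderiv_eq_fderiv] at h
  exact (congrArg (fun L : EuclideanSpace ℝ (Fin n) →L[ℝ] ℝ => L (stdVec i)) h).symm

lemma comp_dfTensorDf (hf : ContMDiff (𝓡 n) 𝓘(ℝ, ℝ) ∞ f)
    (hy : y ∈ (extChartAt (𝓡 n) p).target) (i j : Fin n) :
    comp (dfTensorDf n f) p y i j = pd i (f ∘ (extChartAt (𝓡 n) p).symm) y *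
      pd j (f ∘ (extChartAt (𝓡 n) p).symm) y := by
  rw [← mfderiv_comp_chartSymm hf hy, ← mfderiv_comp_chartSymm hf hy]
  rfl

lemma contDiffOn_comp_chartSymm (hf : ContMDiff (𝓡 n) 𝓘(ℝ, ℝ) ∞ f) (p : M) :
    ContDiffOn ℝ ∞ (f ∘ (extChartAt (𝓡 n) p).symm) (extChartAt (𝓡 n) p).target :=
  (hf.comp_contMDiffOn (contMDiffOn_extChartAt_symm (n := ∞) p)).contDiffOn

/-- The derivative of the preferred chart at `p`, as a map of `ℝⁿ`. -/
def chartDeriv (p x : M) : EuclideanSpace ℝ (Fin n) →L[ℝ] EuclideanSpace ℝ (Fin n) :=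
  mfderiv (𝓡 n) 𝓘(ℝ, EuclideanSpace ℝ (Fin n)) (extChartAt (𝓡 n) p) x

/-- `dx^i` at `p` as a linear form on `ℝⁿ`. -/
def coordFormModel (p : M) (i : Fin n) : EuclideanSpace ℝ (Fin n) →L[ℝ] ℝ := coordForm p i

omit [IsManifold (𝓡 n) ∞ M] in
lemma coordFormModel_apply (p : M) (i : Fin n) (v : EuclideanSpace ℝ (Fin n)) :
    coordFormModel p i v = chartDeriv p p v i := by
  have hd : MDifferentiableAt (𝓡 n) 𝓘(ℝ, EuclideanSpace ℝ (Fin n)) (extChartAt (𝓡 n) p) p :=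
    (contMDiffAt_extChartAt (n := ∞)).mdifferentiableAt (by simp)
  have h := mfderiv_comp (I := 𝓡 n) (I' := 𝓘(ℝ, EuclideanSpace ℝ (Fin n))) (I'' := 𝓘(ℝ, ℝ)) p
    ((EuclideanSpace.proj i : EuclideanSpace ℝ (Fin n) →L[ℝ] ℝ).differentiableAt.mdifferentiableAt
      (x := extChartAt (𝓡 n) p p)) hd
  rw [mfderiv_eq_fderiv, ContinuousLinearMap.fderiv] at h
  exact congrArg (fun L : EuclideanSpace ℝ (Fin n) →L[ℝ] ℝ => L v) h

/-- The forms `dx^i` at `p` are dual to the coordinate vectors of the same chart. -/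
lemma comp_ofComp (B : CovTensor n M) (p : M) (a : Matrix (Fin n) (Fin n) ℝ)
    (h : B p = ofComp p a) : comp B p (extChartAt (𝓡 n) p p) = a := by
  have h1 : (extChartAt (𝓡 n) p).symm (extChartAt (𝓡 n) p p) = p := extChartAt_to_inv p
  have hD : ∀ k i, coordFormModel p k (chartSymmDeriv p (extChartAt (𝓡 n) p p) (stdVec i))
      = (stdVec i : EuclideanSpace ℝ (Fin n)) k := by
    intro k i
    have h2 : chartDeriv p ((extChartAt (𝓡 n) p).symm (extChartAt (𝓡 n) p p))
        (chartSymmDeriv p (extChartAt (𝓡 n) p p) (stdVec i)) = stdVec i :=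
      mfderiv_chart_comp (mem_extChartAt_target (I := 𝓡 n) p) _
    rw [h1] at h2
    rw [coordFormModel_apply, h2]
  have h4 : B.toFun p = ∑ k, ∑ l, a k l • (coordFormModel p k).smulRight (coordFormModel p l) := h
  ext i j
  rw [comp_apply, h1, h4]
  simp only [sum_apply, smul_apply,
    ContinuousLinearMap.smulRight_apply, hD, smul_eq_mul, stdVec_apply]
  simp

lemma comp_ricci (g : CovTensor n M) (p : M) : comp (ricci g) p (extChartAt (𝓡 n) p p) =
    ricciCoord (comp g p) (extChartAt (𝓡 n) p p) := comp_ofComp _ p _ rfl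

lemma comp_hessian (g : CovTensor n M) (f : M → ℝ) (p : M) :
    comp (hessian g f) p (extChartAt (𝓡 n) p p) =
      hessCoord (comp g p) (f ∘ (extChartAt (𝓡 n) p).symm) (extChartAt (𝓡 n) p p) :=
  comp_ofComp _ p _ rfl

lemma bakryEmeryScalar_self (g : CovTensor n M) (hf : ContMDiff (𝓡 n) 𝓘(ℝ, ℝ) ∞ f) (p : M) :
    bakryEmeryScalar g f p =
      scalarCoord (comp g p) (f ∘ (extChartAt (𝓡 n) p).symm) (extChartAt (𝓡 n) p p) := by
  unfold bakryEmeryScalar traceOf scalarCoord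
  refine Finset.sum_congr rfl fun i _ => Finset.sum_congr rfl fun j _ => ?_
  congr 1
  rw [← comp_ricci, ← comp_hessian, ← comp_dfTensorDf hf (mem_extChartAt_target (I := 𝓡 n) p)]
  have : bakryEmeryRicci 1 g f = ricci g + hessian g f - dfTensorDf n f := by
    unfold bakryEmeryRicci; rw [div_one, one_smul]
  rw [this]
  rfl

lemma hessCoord_congr {G : EuclideanSpace ℝ (Fin n) → Matrix (Fin n) (Fin n) ℝ}
    {F F' : EuclideanSpace ℝ (Fin n) → ℝ} (h : F =ᶠ[𝓝 y] F') :
    hessCoord G F y = hessCoord G F' y := by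
  ext i j
  simp only [hessCoord, pd_congr i (pd_eventuallyEq j h), pd_congr _ h]

lemma scalarCoord_congr {G : EuclideanSpace ℝ (Fin n) → Matrix (Fin n) (Fin n) ℝ}
    {F F' : EuclideanSpace ℝ (Fin n) → ℝ} (h : F =ᶠ[𝓝 y] F') :
    scalarCoord G F y = scalarCoord G F' y := by
  simp only [scalarCoord, hessCoord_congr h, pd_congr _ h]

omit [IsManifold (𝓡 n) ∞ M] in
lemma comp_chartSymm_eventuallyEq [IsManifold (𝓡 n) ∞ M] (f : M → ℝ) (hy : y ∈ overlap p q) :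
    (f ∘ (extChartAt (𝓡 n) q).symm) ∘ transition p q =ᶠ[𝓝 y] f ∘ (extChartAt (𝓡 n) p).symm := by
  filter_upwards [(isOpen_overlap p q).mem_nhds hy] with z hz
  exact congrArg f (symm_transition hz)

/-- `R_(g,f)` in terms of the components in an arbitrary chart. -/
lemma bakryEmeryScalar_eq (hs : IsSmoothSymmetric g) (hf : ContMDiff (𝓡 n) 𝓘(ℝ, ℝ) ∞ f)
    (hy : y ∈ nondegSet g p) : bakryEmeryScalar g f ((extChartAt (𝓡 n) p).symm y) =
      scalarCoord (comp g p) (f ∘ (extChartAt (𝓡 n) p).symm) y := by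
  set x := (extChartAt (𝓡 n) p).symm y with hx
  have ho : y ∈ overlap p x := mem_overlap_self hy.1
  rw [bakryEmeryScalar_self g hf x,
    ← scalarCoord_congr (comp_chartSymm_eventuallyEq f ho),
    (hs.isPullback p x).scalarCoord_eq ⟨ho, hy⟩
      ((contDiffOn_comp_chartSymm hf x).mono inter_subset_left)]
  rfl

/-- The equation `Ric = df ⊗ df` in an arbitrary chart. -/
lemma ricciCoord_eq_of_ricci_eq (hg : IsSemiRiemannianMetric g)
    (hf : ContMDiff (𝓡 n) 𝓘(ℝ, ℝ) ∞ f) (h : ricci g = dfTensorDf n f)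
    (hy : y ∈ (extChartAt (𝓡 n) p).target) (i j : Fin n) :
    ricciCoord (comp g p) y i j = pd i (f ∘ (extChartAt (𝓡 n) p).symm) y *
      pd j (f ∘ (extChartAt (𝓡 n) p).symm) y := by
  set x := (extChartAt (𝓡 n) p).symm y with hx
  have ho : y ∈ overlap p x := mem_overlap_self hy
  rw [← comp_dfTensorDf hf hy, comp_transition _ ho,
    (hg.isPullback p x).ricciCoord_eq ⟨ho, hy, hg.det_comp_ne hy⟩]
  rw [show transition p x y = extChartAt (𝓡 n) x x from rfl, ← comp_ricci, h]

/-- The equation `Δf = 0` in an arbitrary chart. -/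
lemma sum_inv_hessCoord_eq_zero (hg : IsSemiRiemannianMetric g)
    (hf : ContMDiff (𝓡 n) 𝓘(ℝ, ℝ) ∞ f) (h : ∀ p, laplacian g f p = 0)
    (hy : y ∈ (extChartAt (𝓡 n) p).target) :
    ∑ i, ∑ j, (comp g p y)⁻¹ i j *
      hessCoord (comp g p) (f ∘ (extChartAt (𝓡 n) p).symm) y i j = 0 := by
  set x := (extChartAt (𝓡 n) p).symm y with hx
  have ho : y ∈ overlap p x := mem_overlap_self hy
  have hm : y ∈ overlap p x ∩ nondegSet g p := ⟨ho, hy, hg.det_comp_ne hy⟩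
  rw [← hessCoord_congr (comp_chartSymm_eventuallyEq f ho),
    (hg.isPullback p x).hessCoord_eq hm
      ((contDiffOn_comp_chartSymm hf x).mono inter_subset_left),
    (hg.isPullback p x).trace_eq hm, ← h x]
  unfold laplacian traceOf
  rw [comp_hessian]
  rfl

/-- A tensor field is smooth on the domain of a chart if its components are. -/
lemma contMDiffOn_of_trivialization (s : CovTensor n M) (p : M)
    (h : ContMDiffOn (𝓡 n) 𝓘(ℝ, EuclideanSpace ℝ (Fin n) →L[ℝ] EuclideanSpace ℝ (Fin n) →L[ℝ] ℝ) ∞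
      (fun x => (trivializationAt (EuclideanSpace ℝ (Fin n) →L[ℝ] EuclideanSpace ℝ (Fin n) →L[ℝ] ℝ)
        (fun x : M => TangentSpace (𝓡 n) x →L[ℝ] TangentSpace (𝓡 n) x →L[ℝ] ℝ) p
        (Bundle.TotalSpace.mk' (EuclideanSpace ℝ (Fin n) →L[ℝ] EuclideanSpace ℝ (Fin n) →L[ℝ] ℝ)
        (E := fun x : M => TangentSpace (𝓡 n) x →L[ℝ] TangentSpace (𝓡 n) x →L[ℝ] ℝ) x (s x))).2)
      (extChartAt (𝓡 n) p).source) :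
    ContMDiffOn (𝓡 n)
      ((𝓡 n).prod 𝓘(ℝ, EuclideanSpace ℝ (Fin n) →L[ℝ] EuclideanSpace ℝ (Fin n) →L[ℝ] ℝ)) ∞
      (fun x => Bundle.TotalSpace.mk'
        (EuclideanSpace ℝ (Fin n) →L[ℝ] EuclideanSpace ℝ (Fin n) →L[ℝ] ℝ)
        (E := fun x : M => TangentSpace (𝓡 n) x →L[ℝ] TangentSpace (𝓡 n) x →L[ℝ] ℝ) x (s x))
      (extChartAt (𝓡 n) p).source := by
  have h1 := Bundle.Trivialization.contMDiffOn_section_baseSet_iff (IB := 𝓡 n) (n := ∞)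
    (F := EuclideanSpace ℝ (Fin n) →L[ℝ] EuclideanSpace ℝ (Fin n) →L[ℝ] ℝ) (s := s)
    (trivializationAt (EuclideanSpace ℝ (Fin n) →L[ℝ] EuclideanSpace ℝ (Fin n) →L[ℝ] ℝ)
      (fun x : M => TangentSpace (𝓡 n) x →L[ℝ] TangentSpace (𝓡 n) x →L[ℝ] ℝ) p)
  rw [show (trivializationAt (EuclideanSpace ℝ (Fin n) →L[ℝ] EuclideanSpace ℝ (Fin n) →L[ℝ] ℝ)
    (fun x : M => TangentSpace (𝓡 n) x →L[ℝ] TangentSpace (𝓡 n) x →L[ℝ] ℝ) p).baseSet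
      = (extChartAt (𝓡 n) p).source by
        rw [extChartAt_source]; simp [hom_trivializationAt_baseSet]] at h1
  exact h1.mpr h

omit [IsManifold (𝓡 n) ∞ M] in
lemma CovTensor.zero_smul_apply (s : CovTensor n M) (x : M) : (0 : ℝ) • s x = 0 :=
  ContinuousLinearMap.ext fun v => zero_smul ℝ (s x v)

/-- Tensor fields with prescribed components, cut off by a function supported in a chart. -/
lemma exists_tensor (p : M) {A : Matrix (Fin n) (Fin n) ℝ} (hA : ∀ i j, A i j = A j i)
    {ψ : M → ℝ} (hψ : ContMDiff (𝓡 n) 𝓘(ℝ, ℝ) ∞ ψ)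
    (hsupp : tsupport ψ ⊆ (extChartAt (𝓡 n) p).source) :
    ∃ s : CovTensor n M, IsSmoothSymmetric s ∧ (∀ x, ψ x = 0 → s x = 0) ∧
      ∀ y ∈ (extChartAt (𝓡 n) p).target, comp s p y = ψ ((extChartAt (𝓡 n) p).symm y) • A := by
  set e := trivializationAt (EuclideanSpace ℝ (Fin n) →L[ℝ] EuclideanSpace ℝ (Fin n) →L[ℝ] ℝ)
    (fun x : M => TangentSpace (𝓡 n) x →L[ℝ] TangentSpace (𝓡 n) x →L[ℝ] ℝ) p with he
  have hbase : e.baseSet = (extChartAt (𝓡 n) p).source := by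
    rw [extChartAt_source]
    simp [he, hom_trivializationAt_baseSet]
  -- the tensor field with components `A` on the domain of the chart
  set s₀ : CovTensor n M := fun x => e.symm x (bil A) with hs₀
  have hsm₀ := contMDiffOn_of_trivialization s₀ p
    ((contMDiffOn_const (c := bil A)).congr fun x hx =>
      congrArg Prod.snd (e.apply_mk_symm (hbase ▸ hx) (bil A)))
  have hcomp₀ : ∀ y ∈ (extChartAt (𝓡 n) p).target, comp s₀ p y = A := by
    intro y hy
    ext i j
    rw [comp_eq_trivialization s₀ hy]
    have hx : (extChartAt (𝓡 n) p).symm y ∈ e.baseSet := by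
      rw [hbase]; exact (extChartAt (𝓡 n) p).map_target hy
    have := congrArg Prod.snd (e.apply_mk_symm hx (bil A))
    refine Eq.trans ?_ (bil_stdVec A i j)
    exact congrArg (fun L : EuclideanSpace ℝ (Fin n) →L[ℝ] EuclideanSpace ℝ (Fin n) →L[ℝ] ℝ =>
      L (stdVec i) (stdVec j)) this
  refine ⟨fun x => ψ x • s₀ x, ⟨?_, ?_⟩, ?_, ?_⟩
  · intro x v w
    by_cases hx : x ∈ (extChartAt (𝓡 n) p).source
    · set y := extChartAt (𝓡 n) p x with hy
      have hyt : y ∈ (extChartAt (𝓡 n) p).target := (extChartAt (𝓡 n) p).map_source hx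
      have hxy : (extChartAt (𝓡 n) p).symm y = x := (extChartAt (𝓡 n) p).left_inv hx
      have h1 : s₀.toFun x = CovTensor.toFun (fun x => (s₀.toFun x).flip) x := by
        rw [← hxy]
        refine toFun_ext hyt ?_
        ext i j
        have h2 : comp (fun x => (s₀.toFun x).flip) p y i j = comp s₀ p y j i := rfl
        rw [h2, hcomp₀ y hyt, hA]
      have h3 := congrArg (fun L : EuclideanSpace ℝ (Fin n) →L[ℝ] EuclideanSpace ℝ (Fin n) →L[ℝ] ℝ
        => L v w) h1
      have h4 : s₀ x v w = s₀ x w v := h3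
      simp [h4]
    · have : ψ x = 0 := image_eq_zero_of_notMem_tsupport fun h => hx (hsupp h)
      simp [this]
  · exact ContMDiffOn.smul_section_of_tsupport (s := s₀) hψ.contMDiffOn
      (isOpen_extChartAt_source p) hsupp hsm₀
  · intro x hx
    simp only [hx]
    exact CovTensor.zero_smul_apply s₀ x
  · intro y hy
    conv_rhs => rw [← hcomp₀ y hy]
    rfl

end Charts

/-! ### The volume measure in charts -/

section Volume

variable {n : ℕ} {M : Type*} [TopologicalSpace M] [ChartedSpace (EuclideanSpace ℝ (Fin n)) M]
  {p q : M} {y : EuclideanSpace ℝ (Fin n)} {g : CovTensor n M} {B : Set M}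

/-- The image of `B` in the preferred chart at `p`. -/
def coordSet (p : M) (B : Set M) : Set (EuclideanSpace ℝ (Fin n)) :=
  (extChartAt (𝓡 n) p).target ∩ (extChartAt (𝓡 n) p).symm ⁻¹' B

lemma isCompact_coordSet (hB : IsCompact B) (hBs : B ⊆ (extChartAt (𝓡 n) p).source) :
    IsCompact (coordSet p B : Set (EuclideanSpace ℝ (Fin n))) := by
  have : (coordSet p B : Set (EuclideanSpace ℝ (Fin n))) = extChartAt (𝓡 n) p '' B :=
    ((extChartAt (𝓡 n) p).image_eq_target_inter_inv_preimage hBs).symm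
  rw [this]
  exact hB.image_of_continuousOn ((continuousOn_extChartAt p).mono hBs)

lemma det_fderiv (τ : EuclideanSpace ℝ (Fin n) → EuclideanSpace ℝ (Fin n)) :
    (fderiv ℝ τ y).det = (jacobian τ y).det := by
  rw [ContinuousLinearMap.det,
    ← LinearMap.det_toMatrix (EuclideanSpace.basisFun (Fin n) ℝ).toBasis]
  congr 1

/-- The transformation law of the volume density. -/
lemma dens_comp_transition [IsManifold (𝓡 n) ∞ M] (hy : y ∈ overlap p q) :
    dens (comp g p y) =
      |(fderiv ℝ (transition p q) y).det| * dens (comp g q (transition p q y)) := by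
  rw [comp_transition g hy, det_fderiv, dens, dens, Matrix.det_mul, Matrix.det_mul,
    Matrix.det_transpose, mul_comm, ← mul_assoc, abs_mul, Real.sqrt_mul (abs_nonneg _), abs_mul,
    Real.sqrt_mul_self (abs_nonneg _)]

variable [MeasurableSpace M] [BorelSpace M]

lemma aemeasurable_chartSymm (g : CovTensor n M) (p : M) :
    AEMeasurable (extChartAt (𝓡 n) p).symm
      (((volume : Measure (EuclideanSpace ℝ (Fin n))).restrict
        (extChartAt (𝓡 n) p).target).withDensity (fun y => ENNReal.ofReal (dens (comp g p y)))) :=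
  ((continuousOn_extChartAt_symm p).aemeasurable
    (isOpen_extChartAt_target p).measurableSet).mono_ac (withDensity_absolutelyContinuous _ _)

lemma measurableSet_coordSet (hB : MeasurableSet B) :
    MeasurableSet (coordSet p B : Set (EuclideanSpace ℝ (Fin n))) := by
  have h1 := (continuousOn_extChartAt_symm (I := 𝓡 n) p).domRestrict.measurable hB
  have h2 := (isOpen_extChartAt_target (I := 𝓡 n) p).measurableSet.subtype_image h1
  convert h2 using 1
  ext z
  simp only [coordSet, mem_inter_iff, mem_preimage, mem_image, Subtype.exists]
  exact ⟨fun h => ⟨z, h.1, h.2, rfl⟩, by rintro ⟨a, ha, hb, rfl⟩; exact ⟨ha, hb⟩⟩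

/-- The part of `chartVolume g p` in `B`, with the domain of the integration made explicit. -/
lemma chartVolume_restrict (g : CovTensor n M) (p : M) (hB : MeasurableSet B) :
    (chartVolume g p).restrict B = Measure.map (extChartAt (𝓡 n) p).symm
      (((volume : Measure (EuclideanSpace ℝ (Fin n))).restrict (coordSet p B)).withDensity
        fun y => ENNReal.ofReal (dens (comp g p y))) := by
  have hsets : MeasurableSet (coordSet p B : Set (EuclideanSpace ℝ (Fin n))) :=
    measurableSet_coordSet hB
  have ht := (isOpen_extChartAt_target (I := 𝓡 n) p).measurableSet
  have hae := aemeasurable_chartSymm g p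
  have hae' : AEMeasurable (extChartAt (𝓡 n) p).symm
      (((volume : Measure (EuclideanSpace ℝ (Fin n))).restrict (coordSet p B)).withDensity
        fun y => ENNReal.ofReal (dens (comp g p y))) :=
    ((continuousOn_extChartAt_symm p).mono inter_subset_left |>.aemeasurable hsets).mono_ac
      (withDensity_absolutelyContinuous _ _)
  ext B' hB'
  rw [Measure.restrict_apply hB', Measure.map_apply_of_aemeasurable hae' hB']
  unfold chartVolume
  have h1 := Measure.map_apply_of_aemeasurable hae (hB'.inter hB)
  refine h1.trans ?_
  rw [withDensity_apply', withDensity_apply', Measure.restrict_restrict' ht,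
    Measure.restrict_restrict' hsets]
  congr 2
  ext z
  simp only [coordSet, mem_inter_iff, mem_preimage]
  tauto

lemma chartVolume_apply (g : CovTensor n M) (p : M) (hB : MeasurableSet B) :
    chartVolume g p B = ∫⁻ y in coordSet p B, ENNReal.ofReal (dens (comp g p y)) := by
  have h := Measure.map_apply_of_aemeasurable (aemeasurable_chartSymm g p) hB
  refine h.trans ?_
  rw [withDensity_apply', Measure.restrict_restrict'
    (isOpen_extChartAt_target (I := 𝓡 n) p).measurableSet, inter_comm]
  rfl

variable [IsManifold (𝓡 n) ∞ M]

/-- The chart volumes agree on overlaps, by the change of variables formula. -/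
lemma chartVolume_apply_eq (hB : MeasurableSet B) (hp : B ⊆ (extChartAt (𝓡 n) p).source)
    (hq : B ⊆ (extChartAt (𝓡 n) q).source) : chartVolume g p B = chartVolume g q B := by
  rw [chartVolume_apply g p hB, chartVolume_apply g q hB]
  have hsub : coordSet p B ⊆ (overlap p q : Set (EuclideanSpace ℝ (Fin n))) :=
    fun y hy => ⟨hy.1, hq hy.2⟩
  have himg : transition p q '' coordSet p B = (coordSet q B : Set (EuclideanSpace ℝ (Fin n))) := by
    ext z
    constructor
    · rintro ⟨y, hy, rfl⟩
      refine ⟨transition_mem_target (hsub hy), ?_⟩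
      rw [mem_preimage, symm_transition (hsub hy)]
      exact hy.2
    · rintro ⟨hz, hzB⟩
      refine ⟨transition q p z, ⟨transition_mem_target ⟨hz, hp hzB⟩, ?_⟩, ?_⟩
      · rw [mem_preimage, symm_transition ⟨hz, hp hzB⟩]; exact hzB
      · unfold transition
        rw [(extChartAt (𝓡 n) p).left_inv (hp hzB), (extChartAt (𝓡 n) q).right_inv hz]
  have hinj : InjOn (transition p q) (coordSet p B : Set (EuclideanSpace ℝ (Fin n))) := by
    intro y hy z hz hyz
    have h1 := congrArg (extChartAt (𝓡 n) q).symm hyz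
    rw [symm_transition (hsub hy), symm_transition (hsub hz)] at h1
    exact (extChartAt (𝓡 n) p).symm.injOn hy.1 hz.1 h1
  have hmeas : MeasurableSet (coordSet p B : Set (EuclideanSpace ℝ (Fin n))) :=
    measurableSet_coordSet hB
  rw [← himg, lintegral_image_eq_lintegral_abs_det_fderiv_mul volume hmeas
    (fun y hy => (differentiableAt_transition (hsub hy)).hasFDerivAt.hasFDerivWithinAt) hinj]
  refine setLIntegral_congr_fun hmeas fun y hy => ?_
  rw [dens_comp_transition (hsub hy), ENNReal.ofReal_mul (abs_nonneg _)]

variable [SecondCountableTopology M]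

/-- The volume measure restricts to the chart volumes. -/
lemma volumeMeasure_apply (hB : MeasurableSet B) (hp : B ⊆ (extChartAt (𝓡 n) p).source) :
    volumeMeasure g B = chartVolume g p B := by
  refine le_antisymm ?_ (Measure.le_iff'.mp (le_iSup (fun q => chartVolume g q) p) B)
  obtain ⟨c, hc, hcov⟩ := TopologicalSpace.countable_cover_nhds
    (fun x : M => extChartAt_source_mem_nhds (I := 𝓡 n) x)
  have hne : c.Nonempty := by
    have hpc : p ∈ ⋃ x ∈ c, (extChartAt (𝓡 n) x).source := by rw [hcov]; trivial
    obtain ⟨x, hx, -⟩ := mem_iUnion₂.mp hpc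
    exact ⟨x, hx⟩
  obtain ⟨a, rfl⟩ := hc.exists_eq_range hne
  rw [biUnion_range] at hcov
  -- A measure that agrees with each `chartVolume g q` on the domain of the chart at `q`.
  let D : ℕ → Set M := disjointed fun k => (extChartAt (𝓡 n) (a k)).source
  have hDm : ∀ k, MeasurableSet (D k) := fun k => MeasurableSet.disjointed
    (fun k => (isOpen_extChartAt_source (I := 𝓡 n) (a k)).measurableSet) k
  have hDs : ∀ k, D k ⊆ (extChartAt (𝓡 n) (a k)).source := fun k => disjointed_subset _ k
  have hDu : ⋃ k, D k = univ := by rw [iUnion_disjointed, hcov]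
  let ν : Measure M := Measure.sum fun k => (chartVolume g (a k)).restrict (D k)
  have hν : ∀ (q : M) (B' : Set M), MeasurableSet B' → B' ⊆ (extChartAt (𝓡 n) q).source →
      ν B' = chartVolume g q B' := by
    intro q B' hB' hq
    rw [Measure.sum_apply _ hB']
    have h1 : ∀ k, (chartVolume g (a k)).restrict (D k) B' = chartVolume g q (B' ∩ D k) := by
      intro k
      rw [Measure.restrict_apply hB']
      exact chartVolume_apply_eq (hB'.inter (hDm k)) (inter_subset_right.trans (hDs k))
        (inter_subset_left.trans hq)
    simp_rw [h1]
    rw [← measure_iUnion (fun i j hij => ((disjoint_disjointed _ hij).mono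
      inter_subset_right inter_subset_right)) (fun k => hB'.inter (hDm k)), ← inter_iUnion, hDu,
      inter_univ]
  have hle : volumeMeasure g ≤ ν := by
    refine iSup_le fun q => Measure.le_iff.mpr fun B' hB' => ?_
    have h1 : chartVolume g q B' = chartVolume g q (B' ∩ (extChartAt (𝓡 n) q).source) := by
      rw [chartVolume_apply g q hB', chartVolume_apply g q
        (hB'.inter (isOpen_extChartAt_source q).measurableSet)]
      congr 2
      ext z
      simp only [coordSet, mem_inter_iff, mem_preimage]
      exact ⟨fun h => ⟨h.1, h.2, (extChartAt (𝓡 n) q).map_target h.1⟩, fun h => ⟨h.1, h.2.1⟩⟩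
    rw [h1, ← hν q _ (hB'.inter (isOpen_extChartAt_source q).measurableSet) inter_subset_right]
    exact measure_mono inter_subset_left
  rw [← hν p B hB hp]
  exact Measure.le_iff'.mp hle B

lemma volumeMeasure_restrict (hB : MeasurableSet B) (hp : B ⊆ (extChartAt (𝓡 n) p).source) :
    (volumeMeasure g).restrict B = (chartVolume g p).restrict B := by
  ext B' hB'
  rw [Measure.restrict_apply hB', Measure.restrict_apply hB']
  exact volumeMeasure_apply (hB'.inter hB) (inter_subset_right.trans hp)

variable {R : M → ℝ}

/-- Integrals over subsets of the domain of a chart are computed in the chart. -/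
lemma setIntegral_volumeMeasure (hg : IsSmoothSymmetric g) (hB : MeasurableSet B)
    (hp : B ⊆ (extChartAt (𝓡 n) p).source)
    (hR : ContinuousOn (R ∘ (extChartAt (𝓡 n) p).symm) (coordSet p B)) :
    (IntegrableOn R B (volumeMeasure g) ↔ IntegrableOn
      (fun y => dens (comp g p y) * R ((extChartAt (𝓡 n) p).symm y)) (coordSet p B)) ∧
    ∫ x in B, R x ∂(volumeMeasure g) =
      ∫ y in coordSet p B, dens (comp g p y) * R ((extChartAt (𝓡 n) p).symm y) := by
  have hsets : MeasurableSet (coordSet p B : Set (EuclideanSpace ℝ (Fin n))) :=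
    measurableSet_coordSet hB
  have hRB : ContinuousOn R B := by
    refine (hR.comp ((continuousOn_extChartAt p).mono hp) fun x hx => ?_).congr fun x hx => ?_
    · refine ⟨(extChartAt (𝓡 n) p).map_source (hp hx), ?_⟩
      rw [mem_preimage, (extChartAt (𝓡 n) p).left_inv (hp hx)]
      exact hx
    · simp only [Function.comp_apply]
      rw [(extChartAt (𝓡 n) p).left_inv (hp hx)]
  have hae : AEMeasurable (extChartAt (𝓡 n) p).symm
      (((volume : Measure (EuclideanSpace ℝ (Fin n))).restrict (coordSet p B)).withDensity
        fun y => ENNReal.ofReal (dens (comp g p y))) :=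
    ((continuousOn_extChartAt_symm p).mono inter_subset_left |>.aemeasurable hsets).mono_ac
      (withDensity_absolutelyContinuous _ _)
  have hdens : ContinuousOn (fun y => dens (comp g p y)) (coordSet p B) := by
    have h1 : ContinuousOn (fun y => (comp g p y).det) (coordSet p B) := fun y hy =>
      (contDiffAt_det (m := ∞) fun i j => (hg.contDiffOn_comp p i j).contDiffAt
        ((isOpen_extChartAt_target p).mem_nhds hy.1)).continuousAt.continuousWithinAt
    exact (continuous_abs.comp_continuousOn h1).sqrt
  have hof : AEMeasurable (fun y => ENNReal.ofReal (dens (comp g p y)))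
      ((volume : Measure (EuclideanSpace ℝ (Fin n))).restrict (coordSet p B)) :=
    (hdens.aemeasurable hsets).ennreal_ofReal
  have hsm : AEStronglyMeasurable R ((volumeMeasure g).restrict B) :=
    hRB.aestronglyMeasurable hB
  have hres := (volumeMeasure_restrict (g := g) hB hp).trans (chartVolume_restrict g p hB)
  rw [hres] at hsm
  have htop : ∀ᵐ y ∂((volume : Measure (EuclideanSpace ℝ (Fin n))).restrict (coordSet p B)),
      ENNReal.ofReal (dens (comp g p y)) < ⊤ := ae_of_all _ fun y => ENNReal.ofReal_lt_top
  have hto : ∀ y, (ENNReal.ofReal (dens (comp g p y))).toReal = dens (comp g p y) :=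
    fun y => ENNReal.toReal_ofReal (Real.sqrt_nonneg _)
  constructor
  · rw [IntegrableOn, IntegrableOn, hres, integrable_map_measure hsm hae,
      integrable_withDensity_iff_integrable_smul₀' hof htop]
    simp only [hto, smul_eq_mul, Function.comp_apply]
  · rw [hres, integral_map hae hsm, integral_withDensity_eq_integral_toReal_smul₀ hof htop]
    simp only [hto, smul_eq_mul]

end Volume

/-! ### Variations of the metric and the function -/

section Variations

variable {n : ℕ} {M : Type*} [TopologicalSpace M] [ChartedSpace (EuclideanSpace ℝ (Fin n)) M]
  {p : M} {y : EuclideanSpace ℝ (Fin n)} {P : Type*} [NormedAddCommGroup P] [NormedSpace ℝ P]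

lemma CovTensor.add_zero (g : CovTensor n M) : g + 0 = g := funext fun x => _root_.add_zero (g x)

lemma CovTensor.add_left_comm (a b c : CovTensor n M) : a + (b + c) = b + (a + c) :=
  funext fun x => _root_.add_left_comm (a x) (b x) (c x)

lemma comp_add (g s : CovTensor n M) : comp (g + s) p y = comp g p y + comp s p y := rfl

lemma comp_smul (c : ℝ) (s : CovTensor n M) : comp (c • s) p y = c • comp s p y := rfl

lemma comp_zero : comp (0 : CovTensor n M) p y = 0 := rfl

lemma comp_sum {ι : Type*} (T : Finset ι) (s : ι → CovTensor n M) :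
    comp (∑ j ∈ T, s j) p y = ∑ j ∈ T, comp (s j) p y := by
  classical
  induction T using Finset.induction_on with
  | empty => simp [comp_zero]
  | insert a T ha ih => rw [Finset.sum_insert ha, Finset.sum_insert ha, comp_add, ih]

variable [IsManifold (𝓡 n) ∞ M]

lemma IsSmoothSymmetric.add {g s : CovTensor n M} (hg : IsSmoothSymmetric g)
    (hs : IsSmoothSymmetric s) : IsSmoothSymmetric (g + s) where
  symm x v w := congrArg₂ (· + ·) (hg.symm x v w) (hs.symm x v w)
  smooth := hg.smooth.add_section hs.smooth

lemma IsSmoothSymmetric.smul {s : CovTensor n M} (hs : IsSmoothSymmetric s) {c : M → ℝ}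
    (hc : ContMDiff (𝓡 n) 𝓘(ℝ, ℝ) ∞ c) : IsSmoothSymmetric (fun x => c x • s x) where
  symm x v w := congrArg (c x * ·) (hs.symm x v w)
  smooth := hc.smul_section hs.smooth

lemma IsSmoothSymmetric.add_sum {ι : Type*} (T : Finset ι) {g : CovTensor n M}
    {s : ι → CovTensor n M} (hg : IsSmoothSymmetric g) (hs : ∀ j, IsSmoothSymmetric (s j)) :
    IsSmoothSymmetric (g + ∑ j ∈ T, s j) := by
  classical
  induction T using Finset.induction_on with
  | empty => rwa [Finset.sum_empty, CovTensor.add_zero]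
  | insert a T ha ih =>
    rw [Finset.sum_insert ha, CovTensor.add_left_comm]
    exact (hs a).add ih

/-- A family of pairs `(g_u, f_u)` with parameter `u`, smooth in charts jointly with the
coordinates. Only `g_0` is required to be nondegenerate: `g_u` may degenerate for large `u`. -/
structure IsSmoothVariation (g : P → CovTensor n M) (f : P → M → ℝ) : Prop where
  metric : IsSemiRiemannianMetric (g 0)
  smoothSymmetric : ∀ u, IsSmoothSymmetric (g u)
  contMDiff : ∀ u, ContMDiff (𝓡 n) 𝓘(ℝ, ℝ) ∞ (f u)
  comp : ∀ p i j, JointlySmooth (fun u y => comp (g u) p y i j)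
    (univ ×ˢ (extChartAt (𝓡 n) p).target)
  fn : ∀ p, JointlySmooth (fun u => f u ∘ (extChartAt (𝓡 n) p).symm)
    (univ ×ˢ (extChartAt (𝓡 n) p).target)

/-- Linear variations. -/
lemma isSmoothVariation_add_sum {ι : Type*} [Fintype ι] (ℓ : ι → P →L[ℝ] ℝ)
    {g : CovTensor n M} (hg : IsSemiRiemannianMetric g) {s : ι → CovTensor n M}
    (hs : ∀ j, IsSmoothSymmetric (s j)) {f : M → ℝ} (hf : ContMDiff (𝓡 n) 𝓘(ℝ, ℝ) ∞ f)
    {h : ι → M → ℝ} (hh : ∀ j, ContMDiff (𝓡 n) 𝓘(ℝ, ℝ) ∞ (h j)) :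
    IsSmoothVariation (fun u => g + ∑ j, ℓ j u • s j) (fun u => f + ∑ j, ℓ j u • h j) where
  metric := by
    have h0 : ∀ j, ℓ j (0 : P) • s j = 0 := fun j => by
      rw [map_zero]
      exact funext fun x => (s j).zero_smul_apply x
    rwa [Finset.sum_congr rfl fun j _ => h0 j, Finset.sum_const_zero, CovTensor.add_zero]
  smoothSymmetric u := hg.toIsSmoothSymmetric.add_sum _ fun j => (hs j).smul contMDiff_const
  contMDiff u := by
    have h1 : ContMDiff (𝓡 n) 𝓘(ℝ, ℝ) ∞ (fun x => f x + ∑ j, ℓ j u * h j x) :=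
      hf.add (contMDiff_finsetSum fun j _ => contMDiff_const.mul (hh j))
    refine h1.congr fun x => ?_
    simp
  comp p i j := by
    have hsnd : MapsTo (Prod.snd : P × EuclideanSpace ℝ (Fin n) → _)
        (univ ×ˢ (extChartAt (𝓡 n) p).target) (extChartAt (𝓡 n) p).target := fun q hq => hq.2
    have h1 : JointlySmooth (fun u y => comp g p y i j + ∑ k, ℓ k u * comp (s k) p y i j)
        (univ ×ˢ (extChartAt (𝓡 n) p).target) := by
      refine ContDiffOn.add ((hg.contDiffOn_comp p i j).comp contDiffOn_snd hsnd)
        (ContDiffOn.sum fun k _ => ContDiffOn.mul ?_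
          (((hs k).contDiffOn_comp p i j).comp contDiffOn_snd hsnd))
      exact ((ℓ k).contDiff.comp contDiff_fst).contDiffOn
    refine h1.congr fun q _ => ?_
    simp only [comp_add, comp_sum, comp_smul, Matrix.add_apply, Matrix.sum_apply,
      Matrix.smul_apply, smul_eq_mul]
  fn p := by
    have hsnd : MapsTo (Prod.snd : P × EuclideanSpace ℝ (Fin n) → _)
        (univ ×ˢ (extChartAt (𝓡 n) p).target) (extChartAt (𝓡 n) p).target := fun q hq => hq.2
    have h1 : JointlySmooth (fun u y => f ((extChartAt (𝓡 n) p).symm y)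
        + ∑ k, ℓ k u * h k ((extChartAt (𝓡 n) p).symm y))
        (univ ×ˢ (extChartAt (𝓡 n) p).target) := by
      refine ContDiffOn.add ((contDiffOn_comp_chartSymm hf p).comp contDiffOn_snd hsnd)
        (ContDiffOn.sum fun k _ => ContDiffOn.mul ?_
          ((contDiffOn_comp_chartSymm (hh k) p).comp contDiffOn_snd hsnd))
      exact ((ℓ k).contDiff.comp contDiff_fst).contDiffOn
    refine h1.congr fun q _ => ?_
    simp

/-- The parameters `u` and points of the chart at `p` at which `g_u` is nondegenerate. -/
def regularSet (g : P → CovTensor n M) (p : M) : Set (P × EuclideanSpace ℝ (Fin n)) :=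
  {q | q.2 ∈ nondegSet (g q.1) p}

namespace IsSmoothVariation

variable {g : P → CovTensor n M} {f : P → M → ℝ} (hv : IsSmoothVariation g f)
include hv

lemma isMetricFamilyOn (p : M) : IsMetricFamilyOn (fun u => BakryEmery.comp (g u) p)
    (regularSet g p) where
  isOpen := by
    have ho : IsOpen ((univ : Set P) ×ˢ (extChartAt (𝓡 n) p).target) :=
      isOpen_univ.prod (isOpen_extChartAt_target p)
    have hc : ContinuousOn (fun q : P × EuclideanSpace ℝ (Fin n) =>
        (BakryEmery.comp (g q.1) p q.2).det) (univ ×ˢ (extChartAt (𝓡 n) p).target) := fun q hq =>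
      (contDiffAt_det (m := ∞) fun i j => ContDiffOn.contDiffAt (hv.comp p i j)
        (ho.mem_nhds hq)).continuousAt.continuousWithinAt
    convert hc.isOpen_inter_preimage ho (isOpen_ne (x := (0 : ℝ))) using 1
    ext q
    simp [regularSet, nondegSet]
  smooth i j := ContDiffOn.mono (hv.comp p i j) fun _ hq => ⟨trivial, hq.1⟩
  symm q _ i j := (hv.smoothSymmetric q.1).comp_symm p q.2 i j
  det_ne q hq := hq.2

lemma jointlySmooth_fn (p : M) :
    JointlySmooth (fun u => f u ∘ (extChartAt (𝓡 n) p).symm) (regularSet g p) :=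
  ContDiffOn.mono (hv.fn p) fun _ hq => ⟨trivial, hq.1⟩

lemma zero_mem_regularSet (hy : y ∈ (extChartAt (𝓡 n) p).target) :
    ((0 : P), y) ∈ regularSet g p := ⟨hy, hv.metric.det_comp_ne hy⟩

variable [MeasurableSpace M] [BorelSpace M] [SecondCountableTopology M] {B C : Set M}

/-- The action over a subset of a chart is the integral of the Lagrangian in coordinates. -/
lemma action_eq {u : P} (hB : MeasurableSet B) (hp : B ⊆ (extChartAt (𝓡 n) p).source)
    (hu : ∀ y ∈ (coordSet p B : Set (EuclideanSpace ℝ (Fin n))), (u, y) ∈ regularSet g p) :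
    (IntegrableOn (bakryEmeryScalar (g u) (f u)) B (volumeMeasure (g u)) ↔ IntegrableOn
      (lagrangian (BakryEmery.comp (g u) p) (f u ∘ (extChartAt (𝓡 n) p).symm)) (coordSet p B)) ∧
    action B (g u) (f u) = ∫ y in coordSet p B,
      lagrangian (BakryEmery.comp (g u) p) (f u ∘ (extChartAt (𝓡 n) p).symm) y := by
  have hR : ∀ y ∈ (coordSet p B : Set (EuclideanSpace ℝ (Fin n))),
      bakryEmeryScalar (g u) (f u) ((extChartAt (𝓡 n) p).symm y) =
        scalarCoord (BakryEmery.comp (g u) p) (f u ∘ (extChartAt (𝓡 n) p).symm) y := fun y hy =>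
    bakryEmeryScalar_eq (hv.smoothSymmetric u) (hv.contMDiff u) (hu y hy)
  have hc := (((hv.isMetricFamilyOn p).scalarCoord (hv.jointlySmooth_fn p)).slice
    u).continuousOn.mono hu
  have hset : MeasurableSet (coordSet p B : Set (EuclideanSpace ℝ (Fin n))) :=
    measurableSet_coordSet hB
  obtain ⟨h1, h2⟩ := setIntegral_volumeMeasure (hv.smoothSymmetric u) hB hp (hc.congr hR)
  have hEq : EqOn (fun y => dens (BakryEmery.comp (g u) p y) *
      bakryEmeryScalar (g u) (f u) ((extChartAt (𝓡 n) p).symm y))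
      (lagrangian (BakryEmery.comp (g u) p) (f u ∘ (extChartAt (𝓡 n) p).symm)) (coordSet p B) :=
    fun y hy => by simp only [lagrangian, hR y hy]
  exact ⟨h1.trans (integrableOn_congr_fun hEq hset),
    h2.trans (setIntegral_congr_fun hset hEq)⟩

omit [MeasurableSpace M] [BorelSpace M] [SecondCountableTopology M] in
lemma eventually_mem_regularSet (hC : IsCompact C) (hp : C ⊆ (extChartAt (𝓡 n) p).source) :
    ∀ᶠ u in 𝓝 (0 : P), ∀ y ∈ (coordSet p C : Set (EuclideanSpace ℝ (Fin n))),
      (u, y) ∈ regularSet g p :=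
  (isCompact_coordSet hC hp).eventually_forall_of_forall_eventually fun _ hy =>
    (hv.isMetricFamilyOn p).isOpen.mem_nhds (hv.zero_mem_regularSet hy.1)

/-- The action over a measurable subset of a compact subset of a chart is differentiable. -/
lemma hasFDerivAt_action (hB : MeasurableSet B) (hBC : B ⊆ C) (hC : IsCompact C)
    (hp : C ⊆ (extChartAt (𝓡 n) p).source) :
    (∀ᶠ u in 𝓝 (0 : P), IntegrableOn (bakryEmeryScalar (g u) (f u)) B (volumeMeasure (g u))) ∧
    HasFDerivAt (fun u => action B (g u) (f u)) (∫ y in coordSet p B, fderiv ℝ (fun u =>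
      lagrangian (BakryEmery.comp (g u) p) (f u ∘ (extChartAt (𝓡 n) p).symm) y) 0) 0 := by
  have hsub : coordSet p B ⊆ (coordSet p C : Set (EuclideanSpace ℝ (Fin n))) :=
    inter_subset_inter_right _ (preimage_mono hBC)
  obtain ⟨h1, h2⟩ := ((hv.isMetricFamilyOn p).lagrangian
    (hv.jointlySmooth_fn p)).hasFDerivAt_integral (hv.isMetricFamilyOn p).isOpen
    (isCompact_coordSet hC hp) (fun y hy => hv.zero_mem_regularSet hy.1)
    (measurableSet_coordSet hB) hsub
  have hev := hv.eventually_mem_regularSet hC hp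
  constructor
  · filter_upwards [h1, hev] with u hu hu'
    exact (hv.action_eq hB (hBC.trans hp) fun y hy => hu' y (hsub hy)).1.mpr hu
  · refine h2.congr_of_eventuallyEq ?_
    filter_upwards [hev] with u hu'
    exact (hv.action_eq hB (hBC.trans hp) fun y hy => hu' y (hsub hy)).2

/-- The action over a compact set is differentiable. The integrability is needed for the additivity
of the action in the domain, by which the claim is reduced to subsets of charts. -/
lemma differentiableAt_action [T2Space M] {K : Set M} (hK : IsCompact K) {B : Set M}
    (hB : MeasurableSet B) (hBK : B ⊆ K) :
    (∀ᶠ u in 𝓝 (0 : P), IntegrableOn (bakryEmeryScalar (g u) (f u)) B (volumeMeasure (g u))) ∧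
    DifferentiableAt ℝ (fun u => action B (g u) (f u)) 0 := by
  have hloc : LocallyCompactSpace M := Manifold.locallyCompact_of_finiteDimensional (𝓡 n)
  suffices h : ∃ A, MeasurableSet A ∧ K ⊆ A ∧ ∀ B, MeasurableSet B → B ⊆ A →
      (∀ᶠ u in 𝓝 (0 : P), IntegrableOn (bakryEmeryScalar (g u) (f u)) B (volumeMeasure (g u))) ∧
      DifferentiableAt ℝ (fun u => action B (g u) (f u)) 0 by
    obtain ⟨A, -, hKA, h⟩ := h
    exact h B hB (hBK.trans hKA)
  refine hK.induction_on (p := fun K => ∃ A, MeasurableSet A ∧ K ⊆ A ∧ ∀ B, MeasurableSet B →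
    B ⊆ A → (∀ᶠ u in 𝓝 (0 : P), IntegrableOn (bakryEmeryScalar (g u) (f u)) B
      (volumeMeasure (g u))) ∧ DifferentiableAt ℝ (fun u => action B (g u) (f u)) 0) ?_ ?_ ?_ ?_
  · refine ⟨∅, MeasurableSet.empty, subset_rfl, fun B _ hB => ?_⟩
    obtain rfl := subset_empty_iff.mp hB
    simp [action]
  · rintro s t hst ⟨A, hA, htA, h⟩
    exact ⟨A, hA, hst.trans htA, h⟩
  · rintro s t ⟨A₁, hm₁, hs, h₁⟩ ⟨A₂, hm₂, ht, h₂⟩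
    refine ⟨A₁ ∪ A₂, hm₁.union hm₂, union_subset_union hs ht, fun B hB hBA => ?_⟩
    obtain ⟨i₁, d₁⟩ := h₁ (B ∩ A₁) (hB.inter hm₁) inter_subset_right
    obtain ⟨i₂, d₂⟩ := h₂ (B \ A₁) (hB.diff hm₁) fun x hx => (hBA hx.1).resolve_left hx.2
    refine ⟨?_, (d₁.add d₂).congr_of_eventuallyEq ?_⟩
    · filter_upwards [i₁, i₂] with u hu₁ hu₂
      rw [← inter_union_sdiff B A₁]
      exact hu₁.union hu₂
    · filter_upwards [i₁, i₂] with u hu₁ hu₂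
      exact (integral_inter_add_sdiff₀ hm₁.nullMeasurableSet
        (by rw [← inter_union_sdiff B A₁]; exact hu₁.union hu₂)).symm
  · intro x _
    obtain ⟨C, hC, hCx, hCs⟩ := exists_compact_subset (isOpen_extChartAt_source (I := 𝓡 n) x)
      (mem_extChartAt_source (I := 𝓡 n) x)
    refine ⟨C, mem_nhdsWithin_of_mem_nhds (mem_interior_iff_mem_nhds.mp hCx), C,
      hC.measurableSet, subset_rfl, fun B hB hBC => ?_⟩
    obtain ⟨h1, h2⟩ := hv.hasFDerivAt_action hB hBC hC hCs
    exact ⟨h1, h2.differentiableAt⟩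

end IsSmoothVariation

end Variations

/-! ### Variations supported in a chart -/

section Local

variable {n : ℕ} {y : EuclideanSpace ℝ (Fin n)}
  {A A' : EuclideanSpace ℝ (Fin n) → Matrix (Fin n) (Fin n) ℝ}

lemma christoffel_congr (h : A =ᶠ[𝓝 y] A') (k i j : Fin n) :
    christoffel A k i j y = christoffel A' k i j y := by
  have h1 : ∀ a b, (fun z => A z a b) =ᶠ[𝓝 y] fun z => A' z a b := fun a b =>
    h.mono fun z hz => by simp only [hz]
  simp only [christoffel, h.eq_of_nhds, pd_congr _ (h1 _ _)]

lemma christoffel_eventuallyEq (h : A =ᶠ[𝓝 y] A') (k i j : Fin n) :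
    christoffel A k i j =ᶠ[𝓝 y] christoffel A' k i j :=
  h.eventuallyEq_nhds.mono fun _ hz => christoffel_congr hz k i j

lemma scalarCoord_congr_metric (h : A =ᶠ[𝓝 y] A') (F : EuclideanSpace ℝ (Fin n) → ℝ) :
    scalarCoord A F y = scalarCoord A' F y := by
  simp only [scalarCoord, ricciCoord, hessCoord, h.eq_of_nhds, christoffel_congr h,
    pd_congr _ (christoffel_eventuallyEq h _ _ _)]

variable {Ω : Set (ℝ × EuclideanSpace ℝ (Fin n))}
  {G : ℝ → EuclideanSpace ℝ (Fin n) → Matrix (Fin n) (Fin n) ℝ}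
  {F : ℝ → EuclideanSpace ℝ (Fin n) → ℝ}

lemma boundaryField_eq_zero (hG : ∀ᶠ z in 𝓝 y, ∀ t, G t z = G 0 z)
    (hF : ∀ᶠ z in 𝓝 y, ∀ t, F t z = F 0 z) (k : Fin n) : boundaryField G F k y = 0 := by
  have hG' : ∀ t, G t =ᶠ[𝓝 y] G 0 := fun t => hG.mono fun z hz => hz t
  have hF' : ∀ t, F t =ᶠ[𝓝 y] F 0 := fun t => hF.mono fun z hz => hz t
  have h1 : ∀ k i j, variation (fun t => christoffel (G t) k i j) y = 0 := fun k i j => by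
    simp only [variation, christoffel_congr (hG' _), deriv_const]
  have h2 : variation F y = 0 := by
    simp only [variation, (hF' _).eq_of_nhds, deriv_const]
  have h3 : variation (fun t z => ∑ j, densInv (G t z) k j * pd j (F t) z) y = 0 := by
    simp only [variation, (hG' _).eq_of_nhds, pd_congr _ (hF' _), deriv_const]
  simp [boundaryField, h1, h2, h3]

lemma IsMetricFamilyOn.contDiffOn_boundaryField (hG : IsMetricFamilyOn G Ω)
    (hF : JointlySmooth F Ω) (k : Fin n) :
    ContDiffOn ℝ ∞ (boundaryField G F k) {y | ((0 : ℝ), y) ∈ Ω} := by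
  have hΩ := hG.isOpen
  have h1 := fun k i j => (hG.christoffel k i j).contDiffOn_variation hΩ
  have h2 := fun i j => (hG.densInv i j).slice (0 : ℝ)
  have h3 : JointlySmooth (fun t z => ∑ j, BakryEmery.densInv (G t z) k j * BakryEmery.pd j (F t) z)
      Ω := JointlySmooth.sum fun j _ => (hG.densInv k j).mul (hF.pd hΩ j)
  unfold boundaryField
  refine ContDiffOn.add (ContDiffOn.sum fun i _ => ContDiffOn.sum fun j _ =>
    ((h2 i j).mul (h1 k i j)).sub ((h2 i k).mul (h1 j i j))) ?_
  exact (h3.contDiffOn_variation hΩ).sub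
    (contDiffOn_const.mul ((hF.contDiffOn_variation hΩ).mul (h3.slice 0)))

/-- The divergence in the first variation does not contribute to the integral of a compactly
supported variation. -/
lemma IsMetricFamilyOn.integral_variation_lagrangian (hG : IsMetricFamilyOn G Ω)
    (hF : JointlySmooth F Ω) {C : Set (EuclideanSpace ℝ (Fin n))} (hC : IsCompact C)
    (hCΩ : ∀ y ∈ C, ((0 : ℝ), y) ∈ Ω)
    (h0 : ∀ y, ((0 : ℝ), y) ∈ Ω → y ∉ C → ∀ t, G t y = G 0 y ∧ F t y = F 0 y)
    {S : EuclideanSpace ℝ (Fin n) → Matrix (Fin n) (Fin n) ℝ}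
    (hS : ∀ y ∈ C, ∀ t, G t y = G 0 y + t • S y) :
    ∫ y in C, variation (fun t => BakryEmery.lagrangian (G t) (F t)) y =
      ∫ y in C, eulerLagrange (G 0) (F 0) (S y) (variation F y) y := by
  have hΩ := hG.isOpen
  have hU : IsOpen {y | ((0 : ℝ), y) ∈ Ω} := (hG.slice 0).isOpen
  have hV := hG.contDiffOn_boundaryField hF
  have hcL := ((hG.lagrangian hF).contDiffOn_variation hΩ).continuousOn.mono hCΩ
  have hcV : ∀ k, ContinuousOn (BakryEmery.pd k (boundaryField G F k)) C := fun k =>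
    (contDiffOn_pd k hU (hV k)).continuousOn.mono hCΩ
  have hpt : ∀ y ∈ C, eulerLagrange (G 0) (F 0) (S y) (variation F y) y =
      variation (fun t => BakryEmery.lagrangian (G t) (F t)) y
        - ∑ k, BakryEmery.pd k (boundaryField G F k) y := fun y hy => by
    have := (hG.hasDerivAt_lagrangian hF (hCΩ y hy) (hS y hy)).deriv
    exact eq_sub_of_add_eq this.symm
  rw [setIntegral_congr_fun hC.measurableSet hpt, integral_sub
    (hcL.integrableOn_compact hC) (integrable_finsetSum _ fun k _ =>
      (hcV k).integrableOn_compact hC), integral_finsetSum _ fun k _ =>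
      (hcV k).integrableOn_compact hC]
  have hz : ∀ k, ∫ y in C, BakryEmery.pd k (boundaryField G F k) y = 0 := by
    intro k
    refine integral_pd_eq_zero hU (hV k) hC hCΩ (fun y hy => ?_) k
    have hnear : ∀ᶠ z in 𝓝 y, ∀ t, G t z = G 0 z ∧ F t z = F 0 z := by
      filter_upwards [(hU.sdiff hC.isClosed).mem_nhds hy] with z hz using h0 z hz.1 hz.2
    exact boundaryField_eq_zero (hnear.mono fun z hz t => (hz t).1)
      (hnear.mono fun z hz t => (hz t).2) k
  simp [hz]

end Local

section LocalVariation

variable {n : ℕ} {M : Type*} [TopologicalSpace M] [ChartedSpace (EuclideanSpace ℝ (Fin n)) M]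
  [IsManifold (𝓡 n) ∞ M] {p : M} {g g' s : CovTensor n M} {f f' h : M → ℝ} {B : Set M}

lemma bakryEmeryScalar_congr {x : M} (hf : ContMDiff (𝓡 n) 𝓘(ℝ, ℝ) ∞ f)
    (hf' : ContMDiff (𝓡 n) 𝓘(ℝ, ℝ) ∞ f') (hg : ∀ᶠ z in 𝓝 x, g z = g' z)
    (hff : ∀ᶠ z in 𝓝 x, f z = f' z) : bakryEmeryScalar g f x = bakryEmeryScalar g' f' x := by
  have ht : Tendsto (extChartAt (𝓡 n) x).symm (𝓝 (extChartAt (𝓡 n) x x)) (𝓝 x) := by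
    have := (continuousAt_extChartAt_symm (I := 𝓡 n) x).tendsto
    rwa [extChartAt_to_inv] at this
  rw [bakryEmeryScalar_self g hf, bakryEmeryScalar_self g' hf',
    scalarCoord_congr (F := f ∘ _) (F' := f' ∘ (extChartAt (𝓡 n) x).symm) (ht.eventually hff)]
  refine scalarCoord_congr_metric ?_ _
  filter_upwards [ht.eventually hg] with z hz
  ext i j
  simp only [comp, hz]

variable [MeasurableSpace M] [BorelSpace M] [SecondCountableTopology M]

lemma volumeMeasure_restrict_congr (hB : MeasurableSet B) (h : ∀ x ∈ B, g x = g' x) :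
    (volumeMeasure g).restrict B = (volumeMeasure g').restrict B := by
  obtain ⟨c, hc, hcov⟩ := TopologicalSpace.countable_cover_nhds
    (fun x : M => extChartAt_source_mem_nhds (I := 𝓡 n) x)
  have hBu : B = ⋃ x ∈ c, B ∩ (extChartAt (𝓡 n) x).source := by
    rw [← inter_iUnion₂, hcov, inter_univ]
  rw [hBu, Measure.restrict_biUnion_congr hc]
  intro x _
  have hm := hB.inter (isOpen_extChartAt_source (I := 𝓡 n) x).measurableSet
  rw [volumeMeasure_restrict hm inter_subset_right, volumeMeasure_restrict hm inter_subset_right,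
    chartVolume_restrict _ _ hm, chartVolume_restrict _ _ hm]
  congr 1
  refine withDensity_congr_ae ?_
  filter_upwards [ae_restrict_mem (measurableSet_coordSet hm)] with y hy
  have : comp g x y = comp g' x y := by
    ext i j
    simp only [comp, h _ hy.2.1]
  rw [this]

omit [MeasurableSpace M] [BorelSpace M] [SecondCountableTopology M] in
lemma isSmoothVariation_line (hg : IsSemiRiemannianMetric g) (hs : IsSmoothSymmetric s)
    (hf : ContMDiff (𝓡 n) 𝓘(ℝ, ℝ) ∞ f) (hh : ContMDiff (𝓡 n) 𝓘(ℝ, ℝ) ∞ h) :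
    IsSmoothVariation (fun t : ℝ => g + t • s) (fun t : ℝ => f + t • h) := by
  have := isSmoothVariation_add_sum (ι := Unit) (fun _ => ContinuousLinearMap.id ℝ ℝ) hg
    (fun _ => hs) hf (fun _ => hh)
  simpa only [Finset.univ_unique, Finset.sum_singleton, ContinuousLinearMap.id_apply] using this

/-- The first variation of the action in the direction of a variation supported in a chart. -/
lemma hasDerivAt_action_of_chart [T2Space M] (hg : IsSemiRiemannianMetric g)
    (hs : IsSmoothSymmetric s) (hf : ContMDiff (𝓡 n) 𝓘(ℝ, ℝ) ∞ f)
    (hh : ContMDiff (𝓡 n) 𝓘(ℝ, ℝ) ∞ h) {K C : Set M} (hK : IsCompact K) (hC : IsCompact C)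
    (hCK : C ⊆ K) (hCp : C ⊆ (extChartAt (𝓡 n) p).source)
    (h0 : ∀ x, x ∉ C → s x = 0 ∧ h x = 0) :
    HasDerivAt (fun t : ℝ => action K (g + t • s) (f + t • h))
      (∫ y in coordSet p C, eulerLagrange (comp g p) (f ∘ (extChartAt (𝓡 n) p).symm)
        (comp s p y) (h ((extChartAt (𝓡 n) p).symm y)) y) 0 := by
  have hv := isSmoothVariation_line hg hs hf hh
  have hg0 : ∀ x, x ∉ C → ∀ t : ℝ, (g + t • s) x = g x := fun x hx t => by
    have h1 : (g + t • s) x = g x + t • s x := rfl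
    rw [h1, (h0 x hx).1]
    exact ContinuousLinearMap.ext fun v => by simp
  have hf0 : ∀ x, x ∉ C → ∀ t : ℝ, (f + t • h) x = f x := fun x hx t => by
    simp [(h0 x hx).2]
  have hgz : g + (0 : ℝ) • s = g := by
    refine (congrArg (g + ·) (funext fun x => s.zero_smul_apply x)).trans (CovTensor.add_zero g)
  have hfz : f + (0 : ℝ) • h = f := by simp
  -- The integrals over `C` and `K \ C`: the second one is constant.
  obtain ⟨-, hd⟩ := hv.hasFDerivAt_action hC.measurableSet subset_rfl hC hCp
  obtain ⟨hi, -⟩ := hv.differentiableAt_action hK hK.measurableSet subset_rfl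
  have hsplit : (fun t : ℝ => action K (g + t • s) (f + t • h)) =ᶠ[𝓝 0] fun t =>
      action (K \ C) g f + action C (g + t • s) (f + t • h) := by
    filter_upwards [hi] with t ht
    have hmd : MeasurableSet (K \ C) := hK.measurableSet.diff hC.measurableSet
    have e1 : action (K \ C) g f = action (K \ C) (g + t • s) (f + t • h) := by
      unfold action
      rw [volumeMeasure_restrict_congr (g := g + t • s) (g' := g) hmd fun x hx => hg0 x hx.2 t]
      refine setIntegral_congr_fun hmd fun x hx => ?_
      have hnear : ∀ᶠ z in 𝓝 x, z ∉ C := hC.isClosed.isOpen_compl.mem_nhds hx.2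
      exact bakryEmeryScalar_congr hf (hv.contMDiff t) (hnear.mono fun z hz => (hg0 z hz t).symm)
        (hnear.mono fun z hz => (hf0 z hz t).symm)
    rw [e1]
    unfold action
    have := integral_inter_add_sdiff₀ (μ := volumeMeasure (g + t • s))
      (hC.measurableSet.nullMeasurableSet) ht
    rw [inter_eq_self_of_subset_right hCK] at this
    rw [← this, add_comm]
  refine ((hd.hasDerivAt.const_add _).congr_of_eventuallyEq hsplit).congr_deriv ?_
  have hfam := hv.isMetricFamilyOn p
  have hfn := hv.jointlySmooth_fn p
  have hcC := isCompact_coordSet hC hCp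
  have hvar : ∀ y, variation (fun t : ℝ => (f + t • h) ∘ (extChartAt (𝓡 n) p).symm) y
      = h ((extChartAt (𝓡 n) p).symm y) := fun y => by
    have : HasDerivAt (fun t : ℝ => f ((extChartAt (𝓡 n) p).symm y)
        + t * h ((extChartAt (𝓡 n) p).symm y)) (h ((extChartAt (𝓡 n) p).symm y)) 0 := by
      simpa using ((hasDerivAt_id (0 : ℝ)).mul_const
        (h ((extChartAt (𝓡 n) p).symm y))).const_add (f ((extChartAt (𝓡 n) p).symm y))
    exact this.deriv
  have hmain := hfam.integral_variation_lagrangian hfn hcC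
    (fun y hy => hv.zero_mem_regularSet hy.1)
    (S := comp s p) (fun y hy hyC t => ?_) (fun y hy t => ?_)
  · simp only [hvar, hgz, hfz] at hmain
    rw [← hmain]
    have hint : IntegrableOn (fun y => fderiv ℝ (fun t : ℝ => lagrangian (comp (g + t • s) p)
        ((f + t • h) ∘ (extChartAt (𝓡 n) p).symm) y) 0) (coordSet p C) := by
      have hc := ((hfam.lagrangian hfn).contDiffOn_variation hfam.isOpen).continuousOn.mono
        (fun y (hy : y ∈ coordSet p C) => hv.zero_mem_regularSet hy.1)
      have hc2 := (ContinuousLinearMap.toSpanSingletonLIE ℝ ℝ).continuous.comp_continuousOn hc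
      refine (hc2.congr fun y _ => ?_).integrableOn_compact hcC
      exact ContinuousLinearMap.ext_ring (by simp [variation])
    rw [ContinuousLinearMap.integral_apply hint]
    rfl
  · have hnC : (extChartAt (𝓡 n) p).symm y ∉ C := fun hm => hyC ⟨hy.1, hm⟩
    constructor
    · ext i j
      simp only [comp, hg0 _ hnC]
    · simp only [Function.comp_apply, hf0 _ hnC]
  · rw [hgz]; rfl

end LocalVariation

/-! ### The Euler-Lagrange equations -/

section Algebra

variable {n : ℕ} {U : Set (EuclideanSpace ℝ (Fin n))} {y : EuclideanSpace ℝ (Fin n)}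
  {G : EuclideanSpace ℝ (Fin n) → Matrix (Fin n) (Fin n) ℝ} {F : EuclideanSpace ℝ (Fin n) → ℝ}

lemma IsMetricOn.pd_log_dens (hG : IsMetricOn G U) (hy : y ∈ U) (k : Fin n) :
    pd k (fun z => Real.log (dens (G z))) y = ∑ l, christoffel G l k l y := by
  have hd : DifferentiableAt ℝ (fun z => dens (G z)) y :=
    (contDiffAt_dens (hG.contDiffAt hy) (hG.det_ne y hy)).differentiableAt (by simp)
  have hne : dens (G y) ≠ 0 := (dens_pos (hG.det_ne y hy)).ne'
  have h := hG.pd_dens hy k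
  unfold pd at h ⊢
  rw [(hd.hasFDerivAt.log hne).fderiv, smul_apply, h, smul_eq_mul, inv_mul_cancel_left₀ hne]

/-- The Ricci tensor is symmetric, since `Γ^k_ik` is the gradient of `log √|det G|`. -/
lemma IsMetricOn.ricciCoord_symm (hG : IsMetricOn G U) (hy : y ∈ U) (i j : Fin n) :
    ricciCoord G y i j = ricciCoord G y j i := by
  have hs := fun z (hz : z ∈ U) => hG.christoffel_symm hz
  have hd : ∀ k i j, DifferentiableAt ℝ (christoffel G k i j) y := fun k i j =>
    ((hG.contDiffOn_christoffel k i j).contDiffAt (hG.mem_nhds hy)).differentiableAt (by simp)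
  have h1 : ∀ i j, ∑ k, pd j (christoffel G k i k) y =
      pd j (pd i fun z => Real.log (dens (G z))) y := by
    intro i j
    rw [← pd_sum j _ fun k _ => hd k i k]
    refine pd_congr j ?_
    filter_upwards [hG.mem_nhds hy] with z hz using (hG.pd_log_dens hz i).symm
  have h2 : ∑ k, pd j (christoffel G k i k) y = ∑ k, pd i (christoffel G k j k) y := by
    rw [h1, h1]
    refine pd_comm j i ?_
    exact ((contDiffAt_dens (hG.contDiffAt hy) (hG.det_ne y hy)).log
      (dens_pos (hG.det_ne y hy)).ne').of_le (by norm_cast)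
  have h3 : ∀ k, pd k (christoffel G k i j) y = pd k (christoffel G k j i) y := fun k => by
    refine pd_congr k ?_
    filter_upwards [hG.mem_nhds hy] with z hz using hs z hz k i j
  have h4 : ∑ k, ∑ l, christoffel G k j l y * christoffel G l i k y
      = ∑ k, ∑ l, christoffel G k i l y * christoffel G l j k y := by
    rw [Finset.sum_comm]
    exact Finset.sum_congr rfl fun k _ => Finset.sum_congr rfl fun l _ => mul_comm _ _
  unfold ricciCoord
  simp only [Finset.sum_sub_distrib]
  rw [h2, h4, Finset.sum_congr rfl fun k _ => h3 k]
  simp only [hs y hy _ i j]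

/-- If `T` is orthogonal to the derivatives of `√|det A| A⁻¹` in all directions, then `T = 0`. -/
lemma eq_zero_of_sum_densInvVar_eq_zero (hn : 3 ≤ n) {A T : Matrix (Fin n) (Fin n) ℝ}
    (hA : A.transpose = A) (hdet : A.det ≠ 0) (hT : T.transpose = T)
    (h : ∀ S : Matrix (Fin n) (Fin n) ℝ, (∀ i j, S i j = S j i) →
      ∑ i, ∑ j, densInvVar A S i j * T i j = 0) : T = 0 := by
  have hu : IsUnit A.det := isUnit_iff_ne_zero.mpr hdet
  have hd : dens A ≠ 0 := (dens_pos hdet).ne'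
  have hsplit : ∀ S, ∑ i, ∑ j, densInvVar A S i j * T i j = dens A *
      ((A⁻¹ * S).trace / 2 * (∑ i, ∑ j, A⁻¹ i j * T i j)
        - ∑ i, ∑ j, (A⁻¹ * S * A⁻¹) i j * T i j) := by
    intro S
    simp only [densInvVar, mul_sub, sub_mul, Finset.sum_sub_distrib, Finset.mul_sum]
    congr 1 <;> exact Finset.sum_congr rfl fun _ _ => Finset.sum_congr rfl fun _ _ => by ring
  -- The direction `A` shows that the trace of `T` vanishes; this needs `n ≠ 2`.
  have htr : ∑ i, ∑ j, A⁻¹ i j * T i j = 0 := by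
    have h1 := h A fun i j => congrFun (congrFun hA j) i
    rw [hsplit, Matrix.nonsing_inv_mul _ hu, one_mul, Matrix.trace_one, Fintype.card_fin] at h1
    have h2 : ((n : ℝ) / 2 - 1) * (∑ i, ∑ j, A⁻¹ i j * T i j) = 0 := by
      have := (mul_eq_zero.mp h1).resolve_left hd
      linarith
    refine (mul_eq_zero.mp h2).resolve_left ?_
    have : (3 : ℝ) ≤ n := by exact_mod_cast hn
    intro h3
    linarith
  -- The direction `A T A` gives `∑ T_ij² = 0`.
  have hS : ∀ i j, (A * T * A) i j = (A * T * A) j i := by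
    intro i j
    have : (A * T * A).transpose = A * T * A := by
      rw [Matrix.transpose_mul, Matrix.transpose_mul, hA, hT, mul_assoc]
    exact congrFun (congrFun this j) i
  have h1 := h _ hS
  rw [hsplit, htr, mul_zero, zero_sub] at h1
  have h2 := neg_eq_zero.mp ((mul_eq_zero.mp h1).resolve_left hd)
  rw [mul_assoc A T A, Matrix.nonsing_inv_mul_cancel_left _ _ hu,
    Matrix.mul_nonsing_inv_cancel_right _ _ hu] at h2
  ext i j
  have h3 := (Finset.sum_eq_zero_iff_of_nonneg fun i _ =>
    Finset.sum_nonneg fun j _ => mul_self_nonneg (T i j)).mp h2 i (Finset.mem_univ i)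
  have h4 := (Finset.sum_eq_zero_iff_of_nonneg fun j _ => mul_self_nonneg (T i j)).mp h3 j
    (Finset.mem_univ j)
  exact mul_self_eq_zero.mp h4

lemma densInvVar_smul (c : ℝ) (A S : Matrix (Fin n) (Fin n) ℝ) (i j : Fin n) :
    densInvVar A (c • S) i j = c * densInvVar A S i j := by
  simp only [densInvVar, mul_smul_comm, smul_mul_assoc, Matrix.trace_smul, Matrix.smul_apply,
    smul_eq_mul]
  ring

lemma eulerLagrange_smul (c h : ℝ) (S : Matrix (Fin n) (Fin n) ℝ) :
    eulerLagrange G F (c • S) (c * h) y = c * eulerLagrange G F S h y := by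
  simp only [eulerLagrange, densInvVar_smul, mul_assoc, ← Finset.mul_sum]
  ring

lemma IsMetricOn.contDiffOn_eulerLagrange (hG : IsMetricOn G U) (hF : ContDiffOn ℝ ∞ F U)
    (S : Matrix (Fin n) (Fin n) ℝ) (h : ℝ) : ContDiffOn ℝ ∞ (eulerLagrange G F S h) U := by
  have h1 := hG.contDiffOn_christoffel
  have hp := fun k i j l => contDiffOn_pd l hG.isOpen (h1 k i j)
  have hpF := fun i => contDiffOn_pd i hG.isOpen hF
  have hppF := fun i j => contDiffOn_pd j hG.isOpen (hpF i)
  have hd : ContDiffOn ℝ ∞ (fun y => dens (G y)) U := fun y hy =>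
    (contDiffAt_dens (hG.contDiffAt hy) (hG.det_ne y hy)).contDiffWithinAt
  have hi : ∀ i j, ContDiffOn ℝ ∞ (fun y => (G y)⁻¹ i j) U := fun i j y hy =>
    (hG.contDiffAt_inv hy i j).contDiffWithinAt
  unfold eulerLagrange ricciCoord hessCoord densInvVar densInv
  simp only [Matrix.trace, Matrix.diag, Matrix.mul_apply]
  refine ContDiffOn.add (ContDiffOn.sum fun i _ => ContDiffOn.sum fun j _ => ContDiffOn.mul
    (hd.mul (ContDiffOn.sub (ContDiffOn.mul (ContDiffOn.div_const (ContDiffOn.sum fun a _ =>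
      ContDiffOn.sum fun b _ => (hi a b).mul contDiffOn_const) 2) (hi i j))
      (ContDiffOn.sum fun a _ => ContDiffOn.mul (ContDiffOn.sum fun b _ =>
        (hi i b).mul contDiffOn_const) (hi a j))))
    (ContDiffOn.sub (ContDiffOn.add (ContDiffOn.sum fun k _ => (hp k i j k).sub (hp k i k j))
      (ContDiffOn.sum fun k _ => ContDiffOn.sum fun l _ =>
        ((h1 k k l).mul (h1 l i j)).sub ((h1 k j l).mul (h1 l i k))))
      ((hpF i).mul (hpF j))))
    (contDiffOn_const.mul (ContDiffOn.sum fun i _ => ContDiffOn.sum fun j _ => ContDiffOn.mul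
      (hd.mul (hi i j)) ((hppF j i).sub (ContDiffOn.sum fun k _ => (h1 k i j).mul (hpF k)))))

end Algebra

/-! ### Critical pairs -/

section Critical

variable {n : ℕ} {M : Type*} [TopologicalSpace M] [T2Space M] [SecondCountableTopology M]
  [ChartedSpace (EuclideanSpace ℝ (Fin n)) M] [IsManifold (𝓡 n) ∞ M] [MeasurableSpace M]
  [BorelSpace M] {g : CovTensor n M} {f : M → ℝ}

/-- Solutions of the equations are critical: by a partition of unity, a variation is a finite sum
of variations supported in charts. -/
lemma isCritical_of_ricci_eq (hg : IsSemiRiemannianMetric g)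
    (hf : ContMDiff (𝓡 n) 𝓘(ℝ, ℝ) ∞ f) (hR : ricci g = dfTensorDf n f)
    (hL : ∀ p, laplacian g f p = 0) : IsCritical g f := by
  classical
  intro s h hs hh K hK h0
  have hloc : LocallyCompactSpace M := Manifold.locallyCompact_of_finiteDimensional (𝓡 n)
  obtain ⟨χ, hχ⟩ := SmoothPartitionOfUnity.exists_isSubordinate_chartAt_source (𝓡 n) M
  have hfin := χ.locallyFinite.finite_nonempty_inter_compact hK
  set T := hfin.toFinset with hT
  have hχsm : ∀ j, ContMDiff (𝓡 n) 𝓘(ℝ, ℝ) ∞ (χ j) := fun j => (χ j).contMDiff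
  have hsum : ∀ x ∈ K, ∑ j : T, χ j x = 1 := by
    intro x hx
    rw [Finset.sum_coe_sort T (fun j => χ j x)]
    refine χ.sum_finsupport' x (mem_univ x) fun j hj => ?_
    rw [hT, Set.Finite.mem_toFinset]
    exact ⟨x, (χ.mem_finsupport x).mp hj, hx⟩
  set s' : T → CovTensor n M := fun j x => χ j x • s x with hs'
  set h' : T → M → ℝ := fun j x => χ j x * h x with hh'
  have hs'sm : ∀ j, IsSmoothSymmetric (s' j) := fun j => hs.smul (hχsm j)
  have hh'sm : ∀ j, ContMDiff (𝓡 n) 𝓘(ℝ, ℝ) ∞ (h' j) := fun j => (hχsm j).mul hh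
  have hv := isSmoothVariation_add_sum (P := T → ℝ) (ContinuousLinearMap.proj) hg hs'sm hf hh'sm
  obtain ⟨-, hdiff⟩ := hv.differentiableAt_action hK hK.measurableSet subset_rfl
  simp only [ContinuousLinearMap.proj_apply] at hdiff
  set Φ : (T → ℝ) → ℝ := fun u => action K (g + ∑ j, u j • s' j) (f + ∑ j, u j • h' j) with hΦ
  -- The partial derivatives vanish.
  have hpart : ∀ j, fderiv ℝ Φ 0 (Pi.single j 1) = 0 := by
    intro j
    have hpath : HasDerivAt (fun t : ℝ => (Pi.single j t : T → ℝ)) (Pi.single j 1) 0 :=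
      hasDerivAt_single j 0
    have hd0 : DifferentiableAt ℝ Φ (Pi.single j (0 : ℝ)) := by rwa [Pi.single_zero]
    have h1 := hd0.hasFDerivAt.comp_hasDerivAt (0 : ℝ) hpath
    rw [Pi.single_zero] at h1
    have h2 : (Φ ∘ fun t : ℝ => (Pi.single j t : T → ℝ)) =
        fun t : ℝ => action K (g + t • s' j) (f + t • h' j) := by
      funext t
      simp only [hΦ, Function.comp_apply]
      rw [Finset.sum_eq_single j (fun k _ hk => by
          rw [Pi.single_eq_of_ne hk]
          exact funext fun x => (s' k).zero_smul_apply x) (by simp),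
        Finset.sum_eq_single j (fun k _ hk => by
          rw [Pi.single_eq_of_ne hk]; exact zero_smul ℝ (h' k)) (by simp), Pi.single_eq_same]
    rw [h2] at h1
    have hCcl : IsClosed (tsupport (χ j)) := isClosed_tsupport _
    have h3 := hasDerivAt_action_of_chart (p := (j : M)) hg (hs'sm j) hf (hh'sm j) hK
      (hK.inter_right hCcl) inter_subset_left
      (by rw [extChartAt_source]; exact inter_subset_right.trans (hχ j))
      (fun x hx => by
        by_cases hxK : x ∈ K
        · have hz : χ j x = 0 := image_eq_zero_of_notMem_tsupport fun hm => hx ⟨hxK, hm⟩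
          simp only [hs', hh', hz, zero_mul, and_true]
          exact s.zero_smul_apply x
        · simp only [hs', hh', (h0 x hxK).1, (h0 x hxK).2, mul_zero, and_true]
          exact ContinuousLinearMap.ext fun v => smul_zero (χ j x))
    rw [h1.unique h3]
    refine (setIntegral_congr_fun (measurableSet_coordSet (hK.inter_right hCcl).measurableSet)
      fun y hy => ?_).trans (integral_zero _ _)
    have hRic := ricciCoord_eq_of_ricci_eq hg hf hR hy.1
    have hLap := sum_inv_hessCoord_eq_zero hg hf hL hy.1
    have hLap' : ∑ a, ∑ b, densInv (comp g (j : M) y) a b * hessCoord (comp g (j : M))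
        (f ∘ (extChartAt (𝓡 n) (j : M)).symm) y a b = 0 := by
      simp only [densInv, mul_assoc, ← Finset.mul_sum, hLap, mul_zero]
    simp only [eulerLagrange, hRic, sub_self, mul_zero, Finset.sum_const_zero, hLap', add_zero]
  -- The derivative in the direction `(1, …, 1)` is the one in the direction `(s, h)`.
  have hL0 : fderiv ℝ Φ 0 = 0 := by
    refine ContinuousLinearMap.coe_injective (LinearMap.pi_ext' fun j => LinearMap.ext_ring ?_)
    exact hpart j
  have hpath : HasDerivAt (fun t : ℝ => (fun _ => t : T → ℝ)) (fun _ => 1) 0 :=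
    hasDerivAt_pi.mpr fun _ => hasDerivAt_id 0
  have hΦ0 : DifferentiableAt ℝ Φ (fun _ => (0 : ℝ)) := hdiff
  have h1 := hΦ0.hasFDerivAt.comp_hasDerivAt (0 : ℝ) hpath
  rw [show (fun _ => (0 : ℝ) : T → ℝ) = 0 from rfl, hL0] at h1
  refine (h1.congr_deriv rfl).congr_of_eventuallyEq (Eventually.of_forall fun t => ?_)
  have es : ∑ j : T, t • s' j = t • s := by
    funext x
    rw [Finset.sum_apply]
    change ∑ j : T, t • (χ j x • s x) = t • s x
    by_cases hx : x ∈ K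
    · rw [← Finset.smul_sum, ← Finset.sum_smul, hsum x hx]
      exact congrArg (t • ·) (one_smul ℝ (s x))
    · rw [(h0 x hx).1]
      refine (Finset.sum_eq_zero fun j _ => ?_).trans ?_
      · exact ContinuousLinearMap.ext fun v => by simp
      · exact ContinuousLinearMap.ext fun v => by simp
  have eh : ∑ j : T, t • h' j = t • h := by
    funext x
    rw [Finset.sum_apply]
    simp only [Pi.smul_apply, smul_eq_mul, hh', ← Finset.mul_sum, ← Finset.sum_mul]
    by_cases hx : x ∈ K
    · rw [hsum x hx, one_mul]
    · rw [(h0 x hx).2, mul_zero]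
  simp only [hΦ, Function.comp_apply, es, eh]

/-- At a critical pair the Euler-Lagrange expression vanishes, as one sees from variations that are
constant in a chart up to a bump function. -/
lemma IsCritical.eulerLagrange_eq_zero (hc : IsCritical g f) (hg : IsSemiRiemannianMetric g)
    (hf : ContMDiff (𝓡 n) 𝓘(ℝ, ℝ) ∞ f) (p : M) {A : Matrix (Fin n) (Fin n) ℝ}
    (hA : ∀ i j, A i j = A j i) (c : ℝ) :
    eulerLagrange (comp g p) (f ∘ (extChartAt (𝓡 n) p).symm) A c (extChartAt (𝓡 n) p p) = 0 := by
  set φ := extChartAt (𝓡 n) p with hφ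
  set e := eulerLagrange (comp g p) (f ∘ φ.symm) A c with he
  have hmetric : IsMetricOn (comp g p) φ.target := by
    have := hg.isMetricOn p (isOpen_extChartAt_target p) subset_rfl
    have hsub : φ.target ⊆ nondegSet g p := fun y hy => ⟨hy, hg.det_comp_ne hy⟩
    rwa [inter_eq_left.mpr hsub] at this
  have hcont : ContinuousOn e φ.target :=
    (hmetric.contDiffOn_eulerLagrange (contDiffOn_comp_chartSymm hf p) A c).continuousOn
  by_contra hne
  -- A bump function supported where `e` has the same sign as at `p`.
  have hnear : {x ∈ φ.source | 0 < e (φ x) * e (φ p)} ∈ 𝓝 p := by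
    have hc1 : ContinuousAt (fun x => e (φ x) * e (φ p)) p :=
      ContinuousAt.mul (ContinuousAt.comp (g := e) (hcont.continuousAt
        (extChartAt_target_mem_nhds p)) (continuousAt_extChartAt p)) continuousAt_const
    filter_upwards [extChartAt_source_mem_nhds (I := 𝓡 n) p,
      hc1.eventually (lt_mem_nhds (mul_self_pos.mpr hne))] with x hx hx' using ⟨hx, hx'⟩
  obtain ⟨ρ, -, hρ⟩ := (SmoothBumpFunction.nhds_basis_tsupport (I := 𝓡 n) p).mem_iff.mp hnear
  have hρs : ContMDiff (𝓡 n) 𝓘(ℝ, ℝ) ∞ ρ := ρ.contMDiff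
  have hρsrc : tsupport ρ ⊆ φ.source := fun x hx => (hρ hx).1
  obtain ⟨s, hs, hs0, hsc⟩ := exists_tensor p hA hρs hρsrc
  have hh : ContMDiff (𝓡 n) 𝓘(ℝ, ℝ) ∞ (fun x => ρ x * c) := hρs.mul contMDiff_const
  have hK : IsCompact (tsupport ρ) := ρ.hasCompactSupport
  have h0 : ∀ x, x ∉ tsupport ρ → s x = 0 ∧ ρ x * c = 0 := fun x hx => by
    have hz : ρ x = 0 := image_eq_zero_of_notMem_tsupport hx
    exact ⟨hs0 x hz, by rw [hz, zero_mul]⟩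
  have h1 := (hc s _ hs hh _ hK h0).unique
    (hasDerivAt_action_of_chart hg hs hf hh hK hK subset_rfl hρsrc h0)
  have hmeas : MeasurableSet (coordSet p (tsupport ρ) : Set (EuclideanSpace ℝ (Fin n))) :=
    measurableSet_coordSet hK.measurableSet
  have h2 : ∫ y in coordSet p (tsupport ρ), ρ (φ.symm y) * (e y * e (φ p)) = 0 := by
    have : ∫ y in coordSet p (tsupport ρ), ρ (φ.symm y) * e y = 0 := by
      rw [h1]
      refine setIntegral_congr_fun hmeas fun y hy => ?_
      simp only [hsc y hy.1, eulerLagrange_smul, he, hφ]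
    simp only [← mul_assoc]
    rw [integral_mul_const, this, zero_mul]
  have hpos : ∀ y ∈ (coordSet p (tsupport ρ) : Set (EuclideanSpace ℝ (Fin n))),
      0 < e y * e (φ p) := fun y hy => by
    have := (hρ hy.2).2
    rwa [φ.right_inv hy.1] at this
  have hρc : ContinuousOn (fun y => ρ (φ.symm y)) φ.target :=
    (contDiffOn_comp_chartSymm hρs p).continuousOn
  have hint : IntegrableOn (fun y => ρ (φ.symm y) * (e y * e (φ p))) (coordSet p (tsupport ρ)) :=
    ((hρc.mul (hcont.mul continuousOn_const)).mono inter_subset_left).integrableOn_compact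
      (isCompact_coordSet hK hρsrc)
  have hnn : 0 ≤ᵐ[volume.restrict (coordSet p (tsupport ρ))]
      fun y => ρ (φ.symm y) * (e y * e (φ p)) := by
    filter_upwards [ae_restrict_mem hmeas] with y hy
    exact mul_nonneg ρ.nonneg (hpos y hy).le
  have hopen : IsOpen (coordSet p (Function.support ρ) : Set (EuclideanSpace ℝ (Fin n))) :=
    (continuousOn_extChartAt_symm p).isOpen_inter_preimage (isOpen_extChartAt_target p)
      ρ.isOpen_support
  have hmem : φ p ∈ (coordSet p (Function.support ρ) : Set (EuclideanSpace ℝ (Fin n))) := by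
    refine ⟨mem_extChartAt_target p, ?_⟩
    rw [mem_preimage, ← hφ, hφ, extChartAt_to_inv]
    exact ρ.c_mem_support
  have hlt := (setIntegral_pos_iff_support_of_nonneg_ae hnn hint).mpr
    ((hopen.measure_pos volume ⟨_, hmem⟩).trans_le (measure_mono fun y hy => ⟨?_, hy.1,
      subset_tsupport _ hy.2⟩))
  · exact hlt.ne' h2
  · exact mul_ne_zero hy.2 (hpos y ⟨hy.1, subset_tsupport _ hy.2⟩).ne'

lemma IsCritical.laplacian_eq_zero (hc : IsCritical g f) (hg : IsSemiRiemannianMetric g)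
    (hf : ContMDiff (𝓡 n) 𝓘(ℝ, ℝ) ∞ f) (p : M) : laplacian g f p = 0 := by
  have h := hc.eulerLagrange_eq_zero hg hf p (A := 0) (fun _ _ => rfl) 1
  have hd := (dens_pos (hg.det_comp_ne (mem_extChartAt_target (I := 𝓡 n) p))).ne'
  simp only [eulerLagrange, densInvVar, mul_zero, zero_mul, Matrix.trace_zero, zero_div,
    Matrix.zero_apply, sub_zero, Finset.sum_const_zero, zero_add, densInv, mul_assoc,
    ← Finset.mul_sum, mul_one] at h
  unfold laplacian traceOf
  rw [comp_hessian]
  exact (mul_eq_zero.mp ((mul_eq_zero.mp h).resolve_left two_ne_zero)).resolve_left hd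

lemma IsCritical.ricci_eq (hn : 3 ≤ n) (hc : IsCritical g f) (hg : IsSemiRiemannianMetric g)
    (hf : ContMDiff (𝓡 n) 𝓘(ℝ, ℝ) ∞ f) : ricci g = dfTensorDf n f := by
  funext p
  have hy := mem_extChartAt_target (I := 𝓡 n) p
  have hG := hg.isMetricOn p (isOpen_extChartAt_target p) subset_rfl
  have hyU : extChartAt (𝓡 n) p p ∈ (extChartAt (𝓡 n) p).target ∩ nondegSet g p :=
    ⟨hy, hy, hg.det_comp_ne hy⟩
  set F := f ∘ (extChartAt (𝓡 n) p).symm with hF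
  have hT : ricciCoord (comp g p) (extChartAt (𝓡 n) p p) - comp (dfTensorDf n f) p
      (extChartAt (𝓡 n) p p) = 0 := by
    refine eq_zero_of_sum_densInvVar_eq_zero hn (hG.transpose_eq hyU) (hg.det_comp_ne hy) ?_
      fun S hS => ?_
    · ext i j
      simp only [Matrix.transpose_apply, Matrix.sub_apply, comp_dfTensorDf hf hy]
      rw [hG.ricciCoord_symm hyU, mul_comm]
    · have h := hc.eulerLagrange_eq_zero hg hf p hS 0
      simp only [eulerLagrange, mul_zero, zero_mul, add_zero, ← comp_dfTensorDf hf hy] at h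
      exact h
  have h1 := toFun_ext hy ((comp_ricci g p).trans (sub_eq_zero.mp hT))
  rw [extChartAt_to_inv] at h1
  exact h1

end Critical

end BakryEmery

end

theorem theorem2 {n : ℕ} (hn : 3 ≤ n) {M : Type*} [TopologicalSpace M] [T2Space M]
    [SecondCountableTopology M] [ChartedSpace (EuclideanSpace ℝ (Fin n)) M]
    [IsManifold (𝓡 n) ∞ M] [MeasurableSpace M] [BorelSpace M]
    (g : BakryEmery.CovTensor n M) (hg : BakryEmery.IsSemiRiemannianMetric g)
    (f : M → ℝ) (hf : ContMDiff (𝓡 n) 𝓘(ℝ, ℝ) ∞ f) :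
    BakryEmery.IsCritical g f ↔
      BakryEmery.ricci g = BakryEmery.dfTensorDf n f ∧
        ∀ p : M, BakryEmery.laplacian g f p = 0 :=
  ⟨fun hc => ⟨hc.ricci_eq hn hg hf, hc.laplacian_eq_zero hg hf⟩,
    fun h => BakryEmery.isCritical_of_ricci_eq hg hf h.1 h.2⟩
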